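/- Let $A>0$, $\gamma>1$, and consider the isentropic compressible Euler equations in $\mathbb{R}^2$, $$\rho_t+\nabla\cdot(\rho u)=0,\qquad (\rho u)_t+\nabla\cdot(\rho u\otimes u)+\nabla p=0,\qquad p=A\rho^\gamma ,$$ with sound speed $c(\rho)=\sqrt{A\gamma}\,\rho^{(\gamma-1)/2}$ and radially symmetric initial data $\rho(0,x)=\rho_0(r)\ge 0$, $u(0,x)=u_0(x)=\frac{x}{r}v_0(r)$, $r=|x|$. Assume that $c(\rho_0)$ and $u_0$ belong to $H^3(\mathbb{R}^2)$ (and are represented by continuous functions), that $$\rho_0(0)=0,\qquad \int_{\mathbb{R}^2}\rho_0(r)\,dx>0,$$ and that, with the modified Bessel function $K_0(r)=\int_0^\infty e^{-r\cosh t}\,dt$, $$\int_{\mathbb{R}^2}\rho_0(r)v_0(r)K_0'(r)\,dx\ \ge\ \sqrt{\frac{A}{\gamma+1}}\;\frac{\bigl(\int_{\mathbb{R}^2}\rho_0(r)K_0(r)\,dx\bigr)^{\frac{\gamma+1}{2}}}{\bigl(\int_{\mathbb{R}^2}K_0(r)\,dx\bigr)^{\frac{\gamma-1}{2}}}.$$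 Put $$G_0=\int_{\mathbb{R}^2}\rho_0(r)K_0(r)\,dx,\qquad C_1=\sqrt{\frac{A}{\gamma+1}}\Bigl(\int_{\mathbb{R}^2}K_0(r)\,dx\Bigr)^{-\frac{\gamma-1}{2}},\qquad T^*=\frac{2\,G_0^{-\frac{\gamma-1}{2}}}{(\gamma-1)C_1}.$$ Then the solution develops a singularity no later than at the time $T^*$, in the following sense. Let $0<T<\infty$ and let $(\rho,u)$ be a solution on $[0,T)\times\mathbb{R}^2$ with these initial data, that is: $\rho\ge 0$ and $u$ are continuous on $[0,T)\times\mathbb{R}^2$, $c(\rho),u\in C([0,T),H^3(\mathbb{R}^2))\cap C^1([0,T),H^2(\mathbb{R}^2))$, and the Euler equations hold in the sense of distributions on $(0,T)\times\mathbb{R}^2$. Then $T\le T^*$, and if $\sup_{0\le t<T}\bigl(\|c(\rho(t))\|_{H^3}+\|u(t)\|_{H^3}\bigr)<\infty$, then $T<T^*$. In particular there is no global solution, and the $H^3$ norm of $(c(\rho),u)$ cannot stay bounded on $[0,T^*)$. -/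

import Mathlib

open MeasureTheory Set Filter Topology
open scoped ENNReal ContDiff SchwartzMap

noncomputable section

namespace CompressibleEuler

/-- The plane with its Euclidean norm. -/
abbrev Plane : Type := EuclideanSpace ℝ (Fin 2)

/-- The modified Bessel function `K₀(r) = ∫₀^∞ exp (-r cosh t) dt`. -/
def besselK0 (r : ℝ) : ℝ := ∫ t in Ioi (0 : ℝ), Real.exp (-(r * Real.cosh t))

/-- The pressure law `p = A ρ ^ γ`. -/
def pressure (A γ ρ : ℝ) : ℝ := A * ρ ^ γ

/-- The sound speed `c(ρ) = √(p'(ρ)) = √(A γ) ρ ^ ((γ - 1) / 2)`. -/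
def soundSpeed (A γ ρ : ℝ) : ℝ := Real.sqrt (A * γ) * ρ ^ ((γ - 1) / 2)

/-- The `H^s` norm of a real function on the plane, for `s ≥ 0`: the `L²` norm of the Bessel
potential of order `s` applied to `f`, that is, of `(1 + ‖ξ‖ ^ 2) ^ (s / 2) * 𝓕 f`.
It is `∞` if `f` is not in `L²`, or is in `L²` but not in `H^s`
(in the sense of `TemperedDistribution.MemSobolev s 2`). -/
def sobolevNorm (s : ℝ) (f : Plane → ℝ) : ℝ≥0∞ :=
  ⨅ (F : Lp ℂ 2 (volume : Measure Plane)) (g : Lp ℂ 2 (volume : Measure Plane))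
    (_ : F =ᵐ[volume] fun x => (f x : ℂ))
    (_ : TemperedDistribution.besselPotential Plane ℂ s (F : 𝓢'(Plane, ℂ)) = (g : 𝓢'(Plane, ℂ))),
    ‖g‖ₑ

/-- `f ∈ H^s(ℝ²)`. -/
def MemH (s : ℝ) (f : Plane → ℝ) : Prop := sobolevNorm s f < ⊤

/-- `f ∈ C([0, T), H^s(ℝ²))`. -/
def ContinuousInH (T s : ℝ) (f : ℝ → Plane → ℝ) : Prop :=
  ∀ t ∈ Ico 0 T, MemH s (f t) ∧
    Tendsto (fun τ => sobolevNorm s (fun x => f τ x - f t x)) (𝓝[Ico 0 T] t) (𝓝 0)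

/-- `f ∈ C¹([0, T), H^s(ℝ²))`; the time derivative `g` is the limit of the difference quotients
in `H^s`, one-sided at `t = 0`. -/
def ContDiffOneInH (T s : ℝ) (f : ℝ → Plane → ℝ) : Prop :=
  ContinuousInH T s f ∧ ∃ g : ℝ → Plane → ℝ, ContinuousInH T s g ∧
    ∀ t ∈ Ico 0 T,
      Tendsto (fun τ => sobolevNorm s (fun x => (f τ x - f t x) / (τ - t) - g t x))
        (𝓝[Ico 0 T \ {t}] t) (𝓝 0)

/-- Test functions on `(0, T) × ℝ²`: smooth, with compact support in this open set. -/
def IsTest (T : ℝ) (φ : ℝ × Plane → ℝ) : Prop :=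
  ContDiff ℝ ∞ φ ∧ HasCompactSupport φ ∧ tsupport φ ⊆ Ioo 0 T ×ˢ univ

/-- The partial derivative of `φ` in time. -/
def dt (φ : ℝ × Plane → ℝ) (z : ℝ × Plane) : ℝ := fderiv ℝ φ z (1, 0)

/-- The partial derivative of `φ` in the `i`-th space coordinate. -/
def dx (i : Fin 2) (φ : ℝ × Plane → ℝ) (z : ℝ × Plane) : ℝ :=
  fderiv ℝ φ z (0, EuclideanSpace.single i 1)

/-- Conservation of mass `ρ_t + ∇ · (ρ u) = 0` in the sense of distributions on `(0, T) × ℝ²`. -/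
def MassConservation (T : ℝ) (ρ : ℝ → Plane → ℝ) (u : ℝ → Plane → Plane) : Prop :=
  ∀ φ : ℝ × Plane → ℝ, IsTest T φ →
    ∫ z : ℝ × Plane, (ρ z.1 z.2 * dt φ z + ∑ j, ρ z.1 z.2 * u z.1 z.2 j * dx j φ z) = 0

/-- Conservation of momentum `(ρ u)_t + ∇ · (ρ u ⊗ u) + ∇ p = 0`, `p = A ρ ^ γ`, in the sense of
distributions on `(0, T) × ℝ²`. -/
def MomentumConservation (A γ T : ℝ) (ρ : ℝ → Plane → ℝ) (u : ℝ → Plane → Plane) : Prop :=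
  ∀ (i : Fin 2) (φ : ℝ × Plane → ℝ), IsTest T φ →
    ∫ z : ℝ × Plane, (ρ z.1 z.2 * u z.1 z.2 i * dt φ z
      + ∑ j, ρ z.1 z.2 * u z.1 z.2 i * u z.1 z.2 j * dx j φ z
      + pressure A γ (ρ z.1 z.2) * dx i φ z) = 0

/-- `(ρ, u)` is an `H³` solution on `[0, T)` of the isentropic compressible Euler equations in the
plane: `ρ ≥ 0`, the sound speed `c(ρ)` and the velocity `u` are in
`C([0, T), H³) ∩ C¹([0, T), H²)`, and mass and momentum are conserved. As usual, elements of `H³`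
are represented by continuous functions. -/
structure IsSolution (A γ T : ℝ) (ρ : ℝ → Plane → ℝ) (u : ℝ → Plane → Plane) : Prop where
  density_nonneg : ∀ t ∈ Ico 0 T, ∀ x, 0 ≤ ρ t x
  density_continuous : ContinuousOn (fun z : ℝ × Plane => ρ z.1 z.2) (Ico 0 T ×ˢ univ)
  velocity_continuous : ContinuousOn (fun z : ℝ × Plane => u z.1 z.2) (Ico 0 T ×ˢ univ)
  sound_H3 : ContinuousInH T 3 (fun t x => soundSpeed A γ (ρ t x))
  sound_H2 : ContDiffOneInH T 2 (fun t x => soundSpeed A γ (ρ t x))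
  velocity_H3 : ∀ i, ContinuousInH T 3 (fun t x => u t x i)
  velocity_H2 : ∀ i, ContDiffOneInH T 2 (fun t x => u t x i)
  mass : MassConservation T ρ u
  momentum : MomentumConservation A γ T ρ u

/-- The radial velocity field `u₀(x) = v₀(r) x / r`, `r = ‖x‖` (with value `0` at `x = 0`). -/
def radialField (v₀ : ℝ → ℝ) (x : Plane) : Plane := (v₀ ‖x‖ / ‖x‖) • x

/-- The `H³` norm of `(c, u)` at time `t`. -/
def stateNorm (A γ : ℝ) (ρ : ℝ → Plane → ℝ) (u : ℝ → Plane → Plane) (t : ℝ) : ℝ≥0∞ :=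
  sobolevNorm 3 (fun x => soundSpeed A γ (ρ t x)) + ∑ i, sobolevNorm 3 (fun x => u t x i)

/-- `∫ K₀(r) dx` over the plane. -/
def besselMass : ℝ := ∫ x : Plane, besselK0 ‖x‖

/-- `∫ ρ₀(r) K₀(r) dx` over the plane. -/
def weightedMass (ρ₀ : ℝ → ℝ) : ℝ := ∫ x : Plane, ρ₀ ‖x‖ * besselK0 ‖x‖

/-- The upper bound `2 G^(-(γ - 1) / 2) / ((γ - 1) C)` for the time of blow-up, where
`G = ∫ ρ₀ K₀ dx` and `C = √(A / (γ + 1)) (∫ K₀ dx)^(-(γ - 1) / 2)`. -/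
def blowupTime (A γ : ℝ) (ρ₀ : ℝ → ℝ) : ℝ :=
  2 * weightedMass ρ₀ ^ (-((γ - 1) / 2)) /
    ((γ - 1) * (Real.sqrt (A / (γ + 1)) * besselMass ^ (-((γ - 1) / 2))))

end CompressibleEuler

end

/-! The weighted mass `G(t) = ∫ ρ K₀ dx` obeys a superlinear second order differential inequality.
Conservation of mass gives `G' = ∫ ρ u·∇K₀`, and conservation of momentum gives `G'' = ∫ (ρ u⊗u :
D²K₀ + p ΔK₀)`. For radial flow the first term is `ρ v² K₀'' ≥ 0`, since `K₀` is convex in `r`. In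
the plane `ΔK₀ = K₀ - 2πδ₀`, and the point mass is harmless because the pressure vanishes at the
origin. Hence `G'' ≥ ∫ p K₀`, and Jensen's inequality for the weight `K₀` yields `G'' ≥ (γ + 1) C₁²
G^γ`. Multiplying by `G'` and integrating, the hypothesis on the initial momentum gives `G' ≥ C₁
G^((γ+1)/2)`, whose solutions cannot live beyond `T*` (`lt_of_superlinear`).

The solution is not assumed radial, nor its vacuum at the origin to persist; both come from a
uniqueness statement. This is delicate because the momentum equation does not determine the velocity
in the vacuum, so uniqueness can hold only in the gas. By Sobolev embedding, `c(ρ)` and `u` are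
classical, with the velocity equation valid where `c > 0` (`IsSolution.isClassical`). On the
boundary of the gas the pressure force vanishes, so boundary particles move on straight lines fixed
by the initial data. Hence two solutions with the same data have the same gas region and the same
velocity on its boundary (`IsClassical.pos_of_pos`, `IsClassical.velocity_eq_of_vacuumBoundary`).
The velocity difference, cut off to the gas, therefore still has a differentiable square, and a
weighted energy estimate for the symmetric hyperbolic system shows that it vanishes
(`IsClassical.energyGap_eq_zero`). Comparing a solution with its mirror image in the line through
`x` makes `u(t, x)` parallel to `x` in the gas, and zero at the origin should gas be there; then the
transport equation keeps `c(t, 0) = 0`.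

Finally, `K₀` is singular at `0` and not compactly supported, so the equations are tested with a
smooth convex truncation of `K₀(√(|x|² + δ²))`. Convexity and the Laplace identity survive up to the
error `6δ²/(|x|² + δ²)²`, an approximate point mass whose contribution tends to `0` by the vacuum at
the origin (`IsSolution.tendsto_stressError`, `IsSolution.le_besselAverage`). -/

noncomputable section

namespace CompressibleEuler

/-! ### Sobolev embedding in the plane, by Fourier inversion. -/

section Sobolev

open FourierTransform Real

/-- Cauchy–Schwarz for a square integrable weight. The reflected argument is there because the
inverse Fourier transform will be written as a Fourier transform of the reflected function. -/
lemma integrable_mul_norm_comp_neg {a : Plane → ℝ} (ha : Continuous a) (ha0 : ∀ x, 0 ≤ a x)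
    (ha2 : Integrable (fun x => a x ^ 2)) (G : Lp ℂ 2 (volume : Measure Plane)) :
    Integrable (fun x => a x * ‖G (-x)‖) ∧
      ∫ x, a x * ‖G (-x)‖ ≤ Real.sqrt (∫ x, a x ^ 2) * ‖G‖ := by
  have hG : MemLp (fun x => ‖G (-x)‖) 2 (volume : Measure Plane) :=
    ((Lp.memLp G).comp_measurePreserving (Measure.measurePreserving_neg volume)).norm
  have hA : MemLp a 2 (volume : Measure Plane) :=
    (memLp_two_iff_integrable_sq ha.aestronglyMeasurable).2 ha2
  refine ⟨hA.integrable_mul hG, ?_⟩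
  have h := integral_mul_le_Lp_mul_Lq_of_nonneg (μ := (volume : Measure Plane)) (p := 2) (q := 2)
    (by constructor <;> norm_num) (Eventually.of_forall ha0)
    (Eventually.of_forall fun x => norm_nonneg (G (-x)))
    (by simpa using hA) (by simpa using hG)
  have hn : ‖G‖ = (∫ x, ‖G (-x)‖ ^ (2 : ℝ)) ^ (1 / 2 : ℝ) := by
    rw [integral_neg_eq_self (fun x => ‖G x‖ ^ (2 : ℝ)) volume, Lp.norm_def,
      (Lp.memLp G).eLpNorm_eq_integral_rpow_norm (by norm_num) (by norm_num),
      ENNReal.toReal_ofReal (by positivity)]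
    norm_num
  rw [hn, Real.sqrt_eq_rpow]
  simpa using h

/-- On the Fourier side `F` is the weight `(1 + |ξ|²)^(-s/2)` times the square integrable `𝓕 g`. The
weight is square integrable exactly when `s > 1`, half the dimension, so the product is integrable
and Fourier inversion is an honest integral. -/
lemma ae_eq_fourier_of_besselPotential {s : ℝ} (hs : 1 < s) {F g : Lp ℂ 2 (volume : Measure Plane)}
    (h : TemperedDistribution.besselPotential Plane ℂ s (F : 𝓢'(Plane, ℂ)) = (g : 𝓢'(Plane, ℂ))) :
    ∃ G : Lp ℂ 2 (volume : Measure Plane), ‖G‖ = ‖g‖ ∧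
      Integrable (fun x : Plane => (((1 + ‖x‖ ^ 2) ^ (-s / 2) : ℝ) : ℂ) * G (-x)) ∧
      F =ᵐ[volume] 𝓕 (fun x : Plane => (((1 + ‖x‖ ^ 2) ^ (-s / 2) : ℝ) : ℂ) * G (-x)) := by
  refine ⟨𝓕 g, Lp.norm_fourier_eq g, ?_⟩
  set G := 𝓕 g
  set w : Plane → ℝ := fun x => (1 + ‖x‖ ^ 2) ^ (-s / 2) with hw
  have hwc : Continuous w := by
    refine Continuous.rpow_const (by fun_prop) fun x => Or.inl (by positivity)
  have hw2 : Integrable (fun x => w x ^ 2) := by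
    have := integrable_rpow_neg_one_add_norm_sq (E := Plane) (μ := volume) (r := 2 * s)
      (by simp; linarith)
    refine this.congr (Eventually.of_forall fun x => ?_)
    simp only [hw]
    rw [← Real.rpow_mul_natCast (by positivity)]
    congr 1; push_cast; ring
  have hint : Integrable (fun x : Plane => ((w x : ℝ) : ℂ) * G (-x)) := by
    have h1 := (integrable_mul_norm_comp_neg hwc (fun x => by positivity) hw2 G).1
    refine h1.mono' ?_ (Eventually.of_forall fun x => ?_)
    · refine AEStronglyMeasurable.mul (by fun_prop) ?_
      exact ((Lp.aestronglyMeasurable G).comp_measurePreserving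
        (Measure.measurePreserving_neg volume))
    · simp only [norm_mul, Complex.norm_real, Real.norm_eq_abs]
      rw [abs_of_nonneg (by positivity)]
  refine ⟨hint, ?_⟩
  -- The multiplier of the Bessel potential is inverted by multiplying with the reciprocal weight.
  have hF : 𝓕 (F : 𝓢'(Plane, ℂ)) = TemperedDistribution.smulLeftCLM ℂ
      (fun x => ((w x : ℝ) : ℂ)) (G : 𝓢'(Plane, ℂ)) := by
    have h2 := congrArg (𝓕 ·) h
    simp only [TemperedDistribution.fourier_besselPotential_eq_smulLeftCLM_fourier_apply,
      Lp.fourier_toTemperedDistribution_eq g] at h2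
    rw [← Lp.fourier_toTemperedDistribution_eq g] at h2
    have h3 := congrArg (TemperedDistribution.smulLeftCLM ℂ (fun x => ((w x : ℝ) : ℂ))) h2
    rw [TemperedDistribution.smulLeftCLM_smulLeftCLM_apply (by fun_prop) (by fun_prop)] at h3
    rw [Lp.fourier_toTemperedDistribution_eq g] at h3
    rw [← h3]
    have h4 : (fun x : Plane => (((1 + ‖x‖ ^ 2) ^ (s / 2) : ℝ) : ℂ)) *
        (fun x => ((w x : ℝ) : ℂ)) = fun _ => 1 := by
      ext x
      simp only [Pi.mul_apply, hw]
      rw [← Complex.ofReal_mul, ← Real.rpow_add (by positivity)]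
      ring_nf
      simp
    rw [h4]
    exact ((TemperedDistribution.smulLeftCLM_const 1 (𝓕 (F : 𝓢'(Plane, ℂ)))).trans
      (one_smul _ _)).symm
  refine ae_eq_of_integral_contDiff_smul_eq ((Lp.memLp F).locallyIntegrable (by norm_num)) ?_ ?_
  · exact (VectorFourier.fourierIntegral_continuous Real.continuous_fourierChar
      (L := innerₗ Plane) continuous_inner hint).locallyIntegrable
  · intro ψ hψ hψc
    have hψ1 : HasCompactSupport (Complex.ofRealCLM ∘ ψ) := hψc.comp_left rfl
    have hψ2 : ContDiff ℝ ∞ (Complex.ofRealCLM ∘ ψ) := by fun_prop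
    let Ψ : 𝓢(Plane, ℂ) := hψ1.toSchwartzMap hψ2
    have hΨ : ∀ x, Ψ x = ψ x := fun x => rfl
    have h4 : (F : 𝓢'(Plane, ℂ)) Ψ = 𝓕 (F : 𝓢'(Plane, ℂ)) (𝓕⁻ Ψ) := by
      rw [TemperedDistribution.fourier_apply, fourier_fourierInv_eq]
    rw [hF, TemperedDistribution.smulLeftCLM_apply_apply, Lp.toTemperedDistribution_apply,
      Lp.toTemperedDistribution_apply] at h4
    -- The Fourier transform is moved from the test function to the integrable function.
    have h7 := VectorFourier.integral_fourierIntegral_smul_eq_flip (L := innerₗ Plane)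
      Real.continuous_fourierChar continuous_inner (μ := volume) (ν := volume)
      (Ψ.integrable (μ := volume)) hint
    have h8 : (innerₗ Plane).flip = innerₗ Plane := by
      ext x y; simp
    rw [h8] at h7
    calc ∫ x, ψ x • F x = ∫ x, Ψ x • F x := by simp [hΨ]
      _ = ∫ x, (𝓕⁻ Ψ) x • (((w x : ℝ) : ℂ) * G x) := by
        rw [h4]
        refine integral_congr_ae (Eventually.of_forall fun x => ?_)
        simp only [smul_eq_mul]
        rw [SchwartzMap.smulLeftCLM_apply_apply (by fun_prop)]
        simp only [smul_eq_mul]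
        ring
      _ = ∫ x, (𝓕 Ψ) x • (((w x : ℝ) : ℂ) * G (-x)) := by
        rw [← integral_neg_eq_self]
        refine integral_congr_ae (Eventually.of_forall fun x => ?_)
        simp only [SchwartzMap.fourierInv_coe, SchwartzMap.fourier_coe, Real.fourierInv_eq_fourier_neg,
          neg_neg, hw, norm_neg]
      _ = ∫ x, Ψ x • 𝓕 (fun x : Plane => ((w x : ℝ) : ℂ) * G (-x)) x := by
        rw [SchwartzMap.fourier_coe]; exact h7
      _ = _ := by simp only [hΨ, hw]; rfl

lemma ContinuousEq.of_ae {f h : Plane → ℝ} (hf : Continuous f) (hh : Continuous h)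
    (e : f =ᵐ[volume] h) : f = h :=
  (hf.ae_eq_iff_eq volume hh).1 e

lemma sobolevNorm_congr_ae {s : ℝ} {f h : Plane → ℝ} (e : f =ᵐ[volume] h) :
    sobolevNorm s f = sobolevNorm s h := by
  unfold sobolevNorm
  refine iInf_congr fun F => iInf_congr fun g => ?_
  have : (F =ᵐ[volume] fun x => (f x : ℂ)) ↔ (F =ᵐ[volume] fun x => (h x : ℂ)) := by
    have e' : (fun x => (f x : ℂ)) =ᵐ[volume] fun x => (h x : ℂ) := by
      filter_upwards [e] with x hx; rw [hx]
    exact ⟨fun k => k.trans e', fun k => k.trans e'.symm⟩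
  exact iInf_congr_Prop this fun _ => rfl

/-- The infimum may be over an empty family, where the norm is `⊤`; positivity of `C` then keeps `C
* ⊤ = ⊤`. -/
lemma le_mul_sobolevNorm {s : ℝ} {f : Plane → ℝ} {C : NNReal} (hC : 0 < C) {a : ℝ≥0∞}
    (h : ∀ F g : Lp ℂ 2 (volume : Measure Plane), (F =ᵐ[volume] fun x => (f x : ℂ)) →
      TemperedDistribution.besselPotential Plane ℂ s (F : 𝓢'(Plane, ℂ)) = (g : 𝓢'(Plane, ℂ)) →
      a ≤ C * ‖g‖ₑ) : a ≤ C * sobolevNorm s f := by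
  rw [mul_comm, ← ENNReal.div_le_iff (by simpa using hC.ne') (by simp)]
  unfold sobolevNorm
  refine le_iInf fun F => le_iInf fun g => le_iInf fun h1 => le_iInf fun h2 => ?_
  rw [ENNReal.div_le_iff (by simpa using hC.ne') (by simp), mul_comm]
  exact h F g h1 h2

lemma MemH.exists_bessel {s : ℝ} {f : Plane → ℝ} (h : MemH s f) :
    ∃ F g : Lp ℂ 2 (volume : Measure Plane), (F =ᵐ[volume] fun x => (f x : ℂ)) ∧
      TemperedDistribution.besselPotential Plane ℂ s (F : 𝓢'(Plane, ℂ)) =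
        (g : 𝓢'(Plane, ℂ)) := by
  by_contra! hc
  refine h.ne ?_
  unfold sobolevNorm
  simp only [iInf_eq_top]
  exact fun F g h1 h2 => (hc F g h1 h2).elim

lemma integrable_sobolevWeight {s : ℝ} (hs : 1 < s) :
    Integrable (fun x : Plane => ((1 + ‖x‖ ^ 2) ^ (-s / 2) : ℝ) ^ 2) := by
  have := integrable_rpow_neg_one_add_norm_sq (E := Plane) (μ := volume) (r := 2 * s)
    (by simp; linarith)
  refine this.congr (Eventually.of_forall fun x => ?_)
  simp only
  rw [← Real.rpow_mul_natCast (by positivity)]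
  congr 1; push_cast; ring

lemma norm_fourier_le (v : Plane → ℂ) (x : Plane) : ‖𝓕 v x‖ ≤ ∫ y, ‖v y‖ :=
  VectorFourier.norm_fourierIntegral_le_integral_norm _ _ _ _ _

lemma exists_continuous_rep {s : ℝ} (hs : 1 < s) : ∃ C : NNReal, 0 < C ∧
    ∀ (f : Plane → ℝ) (F g : Lp ℂ 2 (volume : Measure Plane)),
      (F =ᵐ[volume] fun x => (f x : ℂ)) →
      TemperedDistribution.besselPotential Plane ℂ s (F : 𝓢'(Plane, ℂ)) = (g : 𝓢'(Plane, ℂ)) →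
      ∃ h : Plane → ℝ, Continuous h ∧ f =ᵐ[volume] h ∧ ∀ x, ‖h x‖ₑ ≤ C * ‖g‖ₑ := by
  set C₀ := Real.sqrt (∫ x : Plane, ((1 + ‖x‖ ^ 2) ^ (-s / 2) : ℝ) ^ 2) + 1
  have hC₀ : 0 < C₀ := by positivity
  refine ⟨C₀.toNNReal, by simpa using hC₀, fun f F g h1 h2 => ?_⟩
  obtain ⟨G, hG, hint, hFG⟩ := ae_eq_fourier_of_besselPotential hs h2
  set v := (fun x : Plane => (((1 + ‖x‖ ^ 2) ^ (-s / 2) : ℝ) : ℂ) * G (-x))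
  have hb := (integrable_mul_norm_comp_neg (a := fun x => (1 + ‖x‖ ^ 2) ^ (-s / 2))
    (Continuous.rpow_const (by fun_prop) fun x => Or.inl (by positivity))
    (fun x => by positivity) (integrable_sobolevWeight hs) G).2
  refine ⟨fun x => (𝓕 v x).re, ?_, ?_, fun x => ?_⟩
  · exact Complex.continuous_re.comp (VectorFourier.fourierIntegral_continuous
      Real.continuous_fourierChar (L := innerₗ Plane) continuous_inner hint)
  · filter_upwards [h1, hFG] with x e1 e2
    rw [← e2, e1, Complex.ofReal_re]
  · have : ‖(𝓕 v x).re‖ ≤ C₀ * ‖g‖ := by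
      refine (Complex.abs_re_le_norm _).trans ((norm_fourier_le _ _).trans ?_)
      rw [← hG]
      calc ∫ y, ‖v y‖ = ∫ y : Plane, (1 + ‖y‖ ^ 2) ^ (-s / 2) * ‖G (-y)‖ := by
            refine integral_congr_ae (Eventually.of_forall fun y => ?_)
            simp only [v, norm_mul, Complex.norm_real, Real.norm_eq_abs]
            rw [abs_of_nonneg (by positivity)]
        _ ≤ _ := hb
        _ ≤ C₀ * ‖G‖ := by gcongr; simp [C₀]
    rw [← ofReal_norm, ← ofReal_norm]
    refine (ENNReal.ofReal_le_ofReal this).trans ?_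
    rw [ENNReal.ofReal_mul hC₀.le]; rfl

/-- The Sobolev embedding of `H^s` in bounded continuous functions. -/
lemma exists_enorm_le_sobolevNorm {s : ℝ} (hs : 1 < s) : ∃ C : NNReal, 0 < C ∧
    ∀ f : Plane → ℝ, Continuous f → ∀ x, ‖f x‖ₑ ≤ C * sobolevNorm s f := by
  obtain ⟨C, hC, h⟩ := exists_continuous_rep hs
  refine ⟨C, hC, fun f hf x => le_mul_sobolevNorm hC fun F g h1 h2 => ?_⟩
  obtain ⟨k, hk, e, hb⟩ := h f F g h1 h2
  rw [ContinuousEq.of_ae hf hk e]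
  exact hb x

lemma MemH.exists_continuous {s : ℝ} (hs : 1 < s) {f : Plane → ℝ} (hf : MemH s f) :
    ∃ h : Plane → ℝ, Continuous h ∧ f =ᵐ[volume] h := by
  obtain ⟨C, hC, h⟩ := exists_continuous_rep hs
  obtain ⟨F, g, h1, h2⟩ := hf.exists_bessel
  obtain ⟨k, hk, e, hb⟩ := h f F g h1 h2
  exact ⟨k, hk, e⟩

/-- A derivative costs one factor `|ξ|`, which the weight absorbs by lowering `s` to `s - 1`; this
must still exceed `1`. -/
lemma exists_contDiff_rep {s : ℝ} (hs : 2 < s) : ∃ C : NNReal, 0 < C ∧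
    ∀ (f : Plane → ℝ) (F g : Lp ℂ 2 (volume : Measure Plane)), Continuous f →
      (F =ᵐ[volume] fun x => (f x : ℂ)) →
      TemperedDistribution.besselPotential Plane ℂ s (F : 𝓢'(Plane, ℂ)) = (g : 𝓢'(Plane, ℂ)) →
      ContDiff ℝ 1 f ∧ ∀ x, ‖fderiv ℝ f x‖ₑ ≤ C * ‖g‖ₑ := by
  set C₀ := 2 * π * (Real.sqrt (∫ x : Plane, ((1 + ‖x‖ ^ 2) ^ (-(s - 1) / 2) : ℝ) ^ 2) + 1)
  have hC₀ : 0 < C₀ := by positivity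
  refine ⟨C₀.toNNReal, by simpa using hC₀, fun f F g hf h1 h2 => ?_⟩
  obtain ⟨G, hG, hint, hFG⟩ := ae_eq_fourier_of_besselPotential (by linarith) h2
  set v := (fun x : Plane => (((1 + ‖x‖ ^ 2) ^ (-s / 2) : ℝ) : ℂ) * G (-x)) with hv
  have hb := (integrable_mul_norm_comp_neg (a := fun x => (1 + ‖x‖ ^ 2) ^ (-(s - 1) / 2))
    (Continuous.rpow_const (by fun_prop) fun x => Or.inl (by positivity))
    (fun x => by positivity) (integrable_sobolevWeight (by linarith)) G)
  have hle : ∀ x, ‖x‖ * ‖v x‖ ≤ (1 + ‖x‖ ^ 2) ^ (-(s - 1) / 2) * ‖G (-x)‖ := by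
    intro x
    simp only [hv, norm_mul, Complex.norm_real, Real.norm_eq_abs]
    rw [abs_of_nonneg (by positivity), ← mul_assoc]
    gcongr
    have : -(s - 1) / 2 = 1 / 2 + -s / 2 := by ring
    rw [this, Real.rpow_add (by positivity)]
    gcongr
    rw [← Real.sqrt_eq_rpow]
    exact Real.le_sqrt_of_sq_le (by linarith)
  have hvi : Integrable (fun x => ‖x‖ * ‖v x‖) := by
    refine hb.1.mono' (by fun_prop) (Eventually.of_forall fun x => ?_)
    rw [Real.norm_of_nonneg (by positivity)]
    exact hle x
  have hfe : f = fun x => (𝓕 v x).re := by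
    refine ContinuousEq.of_ae hf ?_ ?_
    · exact Complex.continuous_re.comp (VectorFourier.fourierIntegral_continuous
        Real.continuous_fourierChar (L := innerₗ Plane) continuous_inner hint)
    · filter_upwards [h1, hFG] with x e1 e2
      rw [← e2, e1, Complex.ofReal_re]
  have hcd : ContDiff ℝ 1 (𝓕 v) := by
    refine Real.contDiff_fourier (N := 1) fun n hn => ?_
    have hn' : n ≤ 1 := by exact_mod_cast hn
    interval_cases n
    · simpa using hint.norm
    · simpa using hvi
  refine ⟨?_, fun x => ?_⟩
  · rw [hfe]
    exact Complex.reCLM.contDiff.comp hcd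
  · have hd : HasFDerivAt f (Complex.reCLM.comp
        (𝓕 (VectorFourier.fourierSMulRight (innerSL ℝ) v) x)) x := by
      rw [hfe]
      exact Complex.reCLM.hasFDerivAt.comp x (Real.hasFDerivAt_fourier hint hvi x)
    rw [hd.fderiv]
    have : ‖Complex.reCLM.comp (𝓕 (VectorFourier.fourierSMulRight (innerSL ℝ) v) x)‖ ≤
        C₀ * ‖g‖ := by
      refine (ContinuousLinearMap.opNorm_comp_le _ _).trans ?_
      rw [Complex.reCLM_norm, one_mul, ← hG]
      refine (VectorFourier.norm_fourierIntegral_le_integral_norm _ _ _ _ _).trans ?_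
      have hL : ‖(innerSL ℝ : Plane →L[ℝ] Plane →L[ℝ] ℝ)‖ ≤ 1 := norm_innerSL_le ℝ
      calc ∫ y, ‖VectorFourier.fourierSMulRight (innerSL ℝ) v y‖
          ≤ ∫ y, 2 * π * ((1 + ‖y‖ ^ 2) ^ (-(s - 1) / 2) * ‖G (-y)‖) := by
            refine integral_mono_of_nonneg (Eventually.of_forall fun y => norm_nonneg _)
              (hb.1.const_mul _) (Eventually.of_forall fun y => ?_)
            refine (VectorFourier.norm_fourierSMulRight_le _ _ _).trans ?_
            calc 2 * π * ‖(innerSL ℝ : Plane →L[ℝ] Plane →L[ℝ] ℝ)‖ * ‖y‖ * ‖v y‖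
                ≤ 2 * π * 1 * ‖y‖ * ‖v y‖ := by gcongr
              _ = 2 * π * (‖y‖ * ‖v y‖) := by ring
              _ ≤ _ := mul_le_mul_of_nonneg_left (hle y) (by positivity)
        _ = 2 * π * ∫ y : Plane, ((1 + ‖y‖ ^ 2) ^ (-(s - 1) / 2) * ‖G (-y)‖) := by
            rw [integral_const_mul]
        _ ≤ 2 * π * ((Real.sqrt (∫ x : Plane, ((1 + ‖x‖ ^ 2) ^ (-(s - 1) / 2) : ℝ) ^ 2) + 1)
            * ‖G‖) := by
            gcongr
            refine hb.2.trans ?_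
            gcongr
            simp
        _ = C₀ * ‖G‖ := by ring
    rw [← ofReal_norm, ← ofReal_norm]
    refine (ENNReal.ofReal_le_ofReal this).trans ?_
    rw [ENNReal.ofReal_mul hC₀.le]; rfl

/-- The Sobolev embedding of `H^s`, `s > 2`, in `C¹` functions with bounded derivative. -/
lemma exists_enorm_fderiv_le_sobolevNorm {s : ℝ} (hs : 2 < s) : ∃ C : NNReal, 0 < C ∧
    ∀ f : Plane → ℝ, Continuous f → (MemH s f → ContDiff ℝ 1 f) ∧
      ∀ x, ‖fderiv ℝ f x‖ₑ ≤ C * sobolevNorm s f := by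
  obtain ⟨C, hC, h⟩ := exists_contDiff_rep hs
  refine ⟨C, hC, fun f hf => ⟨fun hm => ?_, fun x => le_mul_sobolevNorm hC fun F g h1 h2 =>
    (h f F g hf h1 h2).2 x⟩⟩
  obtain ⟨F, g, h1, h2⟩ := hm.exists_bessel
  exact (h f F g hf h1 h2).1

end Sobolev

/-! ### Classical regularity in space-time from Sobolev regularity. -/

/-- A function on `[0, T) × ℝ²` that is continuous, is `C¹` on `(0, T) × ℝ²`, and is bounded
together with its derivative on compact time intervals. -/
structure IsRegular {V : Type*} [NormedAddCommGroup V] [NormedSpace ℝ V] (T : ℝ)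
    (f : ℝ → Plane → V) : Prop where
  cont : ContinuousOn (fun z : ℝ × Plane => f z.1 z.2) (Ico 0 T ×ˢ univ)
  contDiff : ContDiffOn ℝ 1 (fun z : ℝ × Plane => f z.1 z.2) (Ioo 0 T ×ˢ univ)
  bound : ∀ b < T, ∃ C, ∀ t ∈ Icc 0 b, ∀ x, ‖f t x‖ ≤ C
  bound_fderiv : ∀ b < T, ∃ C, ∀ t ∈ Ioc 0 b, ∀ x,
    ‖fderiv ℝ (fun z : ℝ × Plane => f z.1 z.2) (t, x)‖ ≤ C

section UniformContinuity

variable {V : Type*} [NormedAddCommGroup V]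

/-- Continuity in time that is uniform in space, together with continuous slices, gives joint
continuity. -/
lemma continuousOn_of_uniform {S : Set ℝ} {h : ℝ → Plane → V} (hc : ∀ t ∈ S, Continuous (h t))
    (hu : ∀ t ∈ S, ∀ ε > 0, ∀ᶠ τ in 𝓝[S] t, ∀ x, ‖h τ x - h t x‖ ≤ ε) :
    ContinuousOn (fun z : ℝ × Plane => h z.1 z.2) (S ×ˢ univ) := by
  rintro ⟨t, x⟩ ⟨ht, -⟩
  rw [ContinuousWithinAt, Metric.tendsto_nhds]
  intro ε hε
  rw [nhdsWithin_prod_eq, nhdsWithin_univ]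
  have h1 := hu t ht (ε / 3) (by positivity)
  have h2 : ∀ᶠ y in 𝓝 x, dist (h t y) (h t x) < ε / 3 :=
    Metric.tendsto_nhds.1 ((hc t ht).tendsto x) _ (by positivity)
  filter_upwards [h1.prod_mk h2] with ⟨τ, y⟩ ⟨e1, e2⟩
  calc dist (h τ y) (h t x) ≤ dist (h τ y) (h t y) + dist (h t y) (h t x) := dist_triangle _ _ _
    _ < ε := by rw [dist_eq_norm]; have := e1 y; simp only at e2; linarith

lemma exists_bound_of_uniform {S K : Set ℝ} {h : ℝ → Plane → V} (hK : IsCompact K) (hKS : K ⊆ S)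
    (hb : ∀ t ∈ S, ∃ C, ∀ x, ‖h t x‖ ≤ C)
    (hu : ∀ t ∈ S, ∀ ε > 0, ∀ᶠ τ in 𝓝[S] t, ∀ x, ‖h τ x - h t x‖ ≤ ε) :
    ∃ C, ∀ t ∈ K, ∀ x, ‖h t x‖ ≤ C := by
  refine hK.induction_on (p := fun S => ∃ C, ∀ t ∈ S, ∀ x, ‖h t x‖ ≤ C) ⟨0, by simp⟩ ?_ ?_ ?_
  · rintro A B hAB ⟨C, hC⟩
    exact ⟨C, fun t ht => hC t (hAB ht)⟩
  · rintro A B ⟨C, hC⟩ ⟨D, hD⟩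
    refine ⟨max C D, fun t ht x => ?_⟩
    rcases ht with ht | ht
    · exact (hC t ht x).trans (le_max_left _ _)
    · exact (hD t ht x).trans (le_max_right _ _)
  · intro t ht
    obtain ⟨C, hC⟩ := hb t (hKS ht)
    refine ⟨{τ | ∀ x, ‖h τ x - h t x‖ ≤ 1}, nhdsWithin_mono t hKS (hu t (hKS ht) 1 one_pos),
      C + 1, fun τ hτ x => ?_⟩
    have h1 := hτ x
    have h2 := hC x
    have h3 := norm_le_norm_add_norm_sub' (h τ x) (h t x)
    linarith

end UniformContinuity

lemma eventually_norm_le {ι : Type*} {l : Filter ι} {V : Type*} [NormedAddCommGroup V]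
    {N : ι → ℝ≥0∞} (hN : Tendsto N l (𝓝 0)) {C : NNReal} {F : ι → Plane → V}
    (h : ∀ᶠ i in l, ∀ x, ‖F i x‖ₑ ≤ C * N i) {ε : ℝ} (hε : 0 < ε) :
    ∀ᶠ i in l, ∀ x, ‖F i x‖ ≤ ε := by
  have h1 : Tendsto (fun i => (C : ℝ≥0∞) * N i) l (𝓝 0) := by
    simpa using ENNReal.Tendsto.const_mul hN (Or.inr ENNReal.coe_ne_top)
  have h2 := h1.eventually_lt_const (ENNReal.ofReal_pos.2 hε)
  filter_upwards [h, h2] with i e1 e2 x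
  have := (e1 x).trans e2.le
  rw [← ofReal_norm] at this
  exact (ENNReal.ofReal_le_ofReal_iff hε.le).1 this

lemma eventually_mem_Ico {T t : ℝ} : ∀ᶠ τ in 𝓝[Ico 0 T] t, τ ∈ Ico 0 T := self_mem_nhdsWithin

lemma exists_bound_of_enorm {V : Type*} [NormedAddCommGroup V] {C : NNReal} {N : ℝ≥0∞}
    (hN : N < ⊤) {F : Plane → V} (h : ∀ x, ‖F x‖ₑ ≤ C * N) : ∃ D, ∀ x, ‖F x‖ ≤ D := by
  refine ⟨((C : ℝ≥0∞) * N).toReal, fun x => ?_⟩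
  rw [← toReal_enorm]
  exact ENNReal.toReal_mono (ENNReal.mul_ne_top ENNReal.coe_ne_top hN.ne) (h x)

-- The `H³` embedding makes `f` and its space derivative continuous in time uniformly in space. The
-- `H²` embedding turns convergence of the difference quotients into a pointwise time derivative
-- with the same uniform continuity. Jointly continuous partial derivatives then give a `C¹`
-- function.
set_option maxHeartbeats 1000000 in
theorem isRegular_of_continuousInH {T : ℝ} {f : ℝ → Plane → ℝ}
    (hc : ∀ t ∈ Ico 0 T, Continuous (f t)) (h3 : ContinuousInH T 3 f)
    (h2 : ContDiffOneInH T 2 f) : IsRegular T f := by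
  obtain ⟨C, hC, hsup⟩ := exists_enorm_le_sobolevNorm (s := 2) (by norm_num)
  obtain ⟨C₃, hC₃, hsup₃⟩ := exists_enorm_le_sobolevNorm (s := 3) (by norm_num)
  obtain ⟨D, hD, hder⟩ := exists_enorm_fderiv_le_sobolevNorm (s := 3) (by norm_num)
  obtain ⟨-, g₀, hg₀, hquot⟩ := h2
  -- continuous representatives of the time derivative
  have hrep : ∀ t, ∃ h : Plane → ℝ, t ∈ Ico 0 T → Continuous h ∧ g₀ t =ᵐ[volume] h := by
    intro t
    by_cases ht : t ∈ Ico 0 T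
    · obtain ⟨h, e1, e2⟩ := (hg₀ t ht).1.exists_continuous (by norm_num)
      exact ⟨h, fun _ => ⟨e1, e2⟩⟩
    · exact ⟨0, fun h => (ht h).elim⟩
  choose g hg using hrep
  have hcd : ∀ t ∈ Ico 0 T, ContDiff ℝ 1 (f t) := fun t ht => (hder (f t) (hc t ht)).1 (h3 t ht).1
  have uf : ∀ t ∈ Ico 0 T, ∀ ε > 0, ∀ᶠ τ in 𝓝[Ico 0 T] t, ∀ x, ‖f τ x - f t x‖ ≤ ε := by
    intro t ht ε hε
    refine eventually_norm_le (h3 t ht).2 (C := C₃) ?_ hε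
    filter_upwards [eventually_mem_Ico] with τ hτ
    exact hsup₃ _ ((hc τ hτ).sub (hc t ht))
  have ufx : ∀ t ∈ Ico 0 T, ∀ ε > 0, ∀ᶠ τ in 𝓝[Ico 0 T] t, ∀ x,
      ‖fderiv ℝ (f τ) x - fderiv ℝ (f t) x‖ ≤ ε := by
    intro t ht ε hε
    refine eventually_norm_le (h3 t ht).2 (C := D) ?_ hε
    filter_upwards [eventually_mem_Ico] with τ hτ x
    have := (hder _ ((hc τ hτ).sub (hc t ht))).2 x
    rwa [fderiv_sub ((hcd τ hτ).differentiable (by norm_num) x)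
      ((hcd t ht).differentiable (by norm_num) x)] at this
  have ug : ∀ t ∈ Ico 0 T, ∀ ε > 0, ∀ᶠ τ in 𝓝[Ico 0 T] t, ∀ x, ‖g τ x - g t x‖ ≤ ε := by
    intro t ht ε hε
    refine eventually_norm_le (hg₀ t ht).2 (C := C) ?_ hε
    filter_upwards [eventually_mem_Ico] with τ hτ x
    have e : (fun x => g₀ τ x - g₀ t x) =ᵐ[volume] fun x => g τ x - g t x :=
      (hg τ hτ).2.sub (hg t ht).2
    rw [sobolevNorm_congr_ae e]
    exact hsup _ ((hg τ hτ).1.sub (hg t ht).1) x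
  -- The slopes converge uniformly in `x`, since their `H²` distance to the derivative tends to `0`.
  have hft : ∀ t ∈ Ico 0 T, ∀ x, HasDerivWithinAt (fun τ => f τ x) (g t x) (Ico 0 T) t := by
    intro t ht x
    rw [hasDerivWithinAt_iff_tendsto_slope, Metric.tendsto_nhds]
    intro ε hε
    have h4 := eventually_norm_le (hquot t ht) (C := C)
      (F := fun τ x => (f τ x - f t x) / (τ - t) - g t x) ?_ (half_pos hε)
    · filter_upwards [h4] with τ hτ
      rw [Real.dist_eq, slope_def_field]
      exact (hτ x).trans_lt (half_lt_self hε)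
    · filter_upwards [self_mem_nhdsWithin] with τ hτ x
      have e : (fun x => (f τ x - f t x) / (τ - t) - g₀ t x) =ᵐ[volume]
          fun x => (f τ x - f t x) / (τ - t) - g t x := by
        filter_upwards [(hg t ht).2] with x hx
        rw [hx]
      rw [sobolevNorm_congr_ae e]
      exact hsup _ ((((hc τ hτ.1).sub (hc t ht)).div_const _).sub (hg t ht).1) x
  have cf := continuousOn_of_uniform hc uf
  have cg := continuousOn_of_uniform (fun t ht => (hg t ht).1) ug
  have cfx := continuousOn_of_uniform
    (fun t ht => (hcd t ht).continuous_fderiv (by norm_num)) ufx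
  have hopen : IsOpen (Ioo (0 : ℝ) T ×ˢ (univ : Set Plane)) := isOpen_Ioo.prod isOpen_univ
  have hsub : Ioo (0 : ℝ) T ×ˢ (univ : Set Plane) ⊆ Ico 0 T ×ˢ univ :=
    prod_mono Ioo_subset_Ico_self Subset.rfl
  have hstrict : ∀ z ∈ Ioo (0 : ℝ) T ×ˢ (univ : Set Plane),
      HasFDerivAt (fun z : ℝ × Plane => f z.1 z.2)
        ((ContinuousLinearMap.toSpanSingleton ℝ (g z.1 z.2)).coprod (fderiv ℝ (f z.1) z.2)) z := by
    intro z hz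
    refine (hasStrictFDerivAt_uncurry_coprod (f := f)
      (f₁ := fun t x => ContinuousLinearMap.toSpanSingleton ℝ (g t x))
      (f₂ := fun t x => fderiv ℝ (f t) x) ?_ ?_ ?_ ?_).hasFDerivAt
    · filter_upwards [hopen.mem_nhds hz] with w hw
      exact ((hft w.1 (hsub hw).1 w.2).hasDerivAt (Ico_mem_nhds hw.1.1 hw.1.2)).hasFDerivAt
    · filter_upwards [hopen.mem_nhds hz] with w hw
      exact ((hcd w.1 (hsub hw).1).differentiable (by norm_num) w.2).hasFDerivAt
    · exact (ContinuousLinearMap.toSpanSingletonCLE (𝕜 := ℝ) (E := ℝ)).continuous.continuousAt.comp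
        ((cg.mono hsub).continuousAt (hopen.mem_nhds hz))
    · exact (cfx.mono hsub).continuousAt (hopen.mem_nhds hz)
  refine ⟨cf, ?_, fun b hb => ?_, fun b hb => ?_⟩
  · rw [show (1 : WithTop ℕ∞) = 0 + 1 from rfl, contDiffOn_succ_iff_fderiv_of_isOpen hopen]
    refine ⟨fun z hz => (hstrict z hz).differentiableAt.differentiableWithinAt, by simp, ?_⟩
    rw [contDiffOn_zero]
    refine ContinuousOn.congr (f := fun z : ℝ × Plane =>
      (ContinuousLinearMap.toSpanSingleton ℝ (g z.1 z.2)).coprod (fderiv ℝ (f z.1) z.2)) ?_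
      fun z hz => (hstrict z hz).fderiv
    refine (ContinuousLinearMap.coprodEquivL (𝕜 := ℝ) (S := ℝ) (E := ℝ) (F := Plane)
      (G := ℝ)).continuous.comp_continuousOn (ContinuousOn.prodMk ?_ (cfx.mono hsub))
    exact (ContinuousLinearMap.toSpanSingletonCLE (𝕜 := ℝ) (E := ℝ)).continuous.comp_continuousOn
      (cg.mono hsub)
  · refine exists_bound_of_uniform (S := Ico 0 T) isCompact_Icc (fun t ht => ⟨ht.1, ht.2.trans_lt hb⟩)
      (fun t ht => ?_) uf
    exact exists_bound_of_enorm (h3 t ht).1 (hsup₃ _ (hc t ht))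
  · obtain ⟨C1, h1⟩ := exists_bound_of_uniform (S := Ico 0 T) (K := Icc 0 b) isCompact_Icc
      (fun t ht => ⟨ht.1, ht.2.trans_lt hb⟩) (fun t ht => by
        refine exists_bound_of_enorm (C := C) (hg₀ t ht).1 fun x => ?_
        rw [sobolevNorm_congr_ae (hg t ht).2]
        exact hsup _ (hg t ht).1 x) ug
    obtain ⟨C2, h2⟩ := exists_bound_of_uniform (S := Ico 0 T) (K := Icc 0 b) isCompact_Icc
      (fun t ht => ⟨ht.1, ht.2.trans_lt hb⟩) (fun t ht =>
        exists_bound_of_enorm (C := D) (F := fderiv ℝ (f t)) (h3 t ht).1 (hder _ (hc t ht)).2) ufx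
    refine ⟨C1 + C2, fun t ht x => ?_⟩
    have ht' : t ∈ Icc 0 b := Ioc_subset_Icc_self ht
    have hz : ((t, x) : ℝ × Plane) ∈ Ioo (0 : ℝ) T ×ˢ (univ : Set Plane) :=
      ⟨⟨ht.1, ht.2.trans_lt hb⟩, mem_univ _⟩
    refine (congrArg norm (hstrict (t, x) hz).fderiv).trans_le ?_
    have hC1 := (norm_nonneg _).trans (h1 t ht' x)
    have hC2 := (norm_nonneg _).trans (h2 t ht' x)
    refine ContinuousLinearMap.opNorm_le_bound _ (by positivity) fun w => ?_
    simp only [ContinuousLinearMap.coprod_apply, ContinuousLinearMap.toSpanSingleton_apply]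
    calc ‖w.1 • g t x + fderiv ℝ (f t) x w.2‖ ≤ ‖w.1‖ * ‖g t x‖ + ‖fderiv ℝ (f t) x‖ * ‖w.2‖ := by
          refine (norm_add_le _ _).trans (add_le_add (norm_smul_le _ _) ?_)
          exact ContinuousLinearMap.le_opNorm _ _
      _ ≤ ‖w‖ * C1 + C2 * ‖w‖ := by
          gcongr
          · exact norm_fst_le w
          · exact h1 t ht' x
          · exact h2 t ht' x
          · exact norm_snd_le w
      _ = _ := by ring

/-- The derivative in space-time. -/
abbrev stDeriv {V : Type*} [NormedAddCommGroup V] [NormedSpace ℝ V] (f : ℝ → Plane → V)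
    (z : ℝ × Plane) : ℝ × Plane →L[ℝ] V :=
  fderiv ℝ (fun z : ℝ × Plane => f z.1 z.2) z

/-- The divergence of a velocity field in space. -/
def divergence (u : ℝ → Plane → Plane) (z : ℝ × Plane) : ℝ :=
  ∑ j, stDeriv u z (0, EuclideanSpace.single j 1) j

lemma isOpen_slab (T : ℝ) : IsOpen (Ioo (0 : ℝ) T ×ˢ (univ : Set Plane)) :=
  isOpen_Ioo.prod isOpen_univ

lemma IsRegular.differentiableAt {V : Type*} [NormedAddCommGroup V] [NormedSpace ℝ V] {T : ℝ}
    {f : ℝ → Plane → V} (h : IsRegular T f) {z : ℝ × Plane} (hz : z ∈ Ioo (0 : ℝ) T ×ˢ univ) :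
    DifferentiableAt ℝ (fun z : ℝ × Plane => f z.1 z.2) z :=
  (h.contDiff.differentiableOn (by norm_num)).differentiableAt ((isOpen_slab T).mem_nhds hz)

lemma IsRegular.continuousOn_stDeriv {V : Type*} [NormedAddCommGroup V] [NormedSpace ℝ V] {T : ℝ}
    {f : ℝ → Plane → V} (h : IsRegular T f) : ContinuousOn (stDeriv f) (Ioo (0 : ℝ) T ×ˢ univ) :=
  h.contDiff.continuousOn_fderiv_of_isOpen (isOpen_slab T) le_rfl

lemma stDeriv_coord {u : ℝ → Plane → Plane} {z : ℝ × Plane}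
    (h : DifferentiableAt ℝ (fun z : ℝ × Plane => u z.1 z.2) z) (w : ℝ × Plane) (i : Fin 2) :
    stDeriv (fun t x => u t x i) z w = stDeriv u z w i := by
  have := (hasFDerivWithinAt_euclidean.1 (h.hasFDerivAt.hasFDerivWithinAt (s := univ)) i)
  rw [hasFDerivWithinAt_univ] at this
  rw [stDeriv, this.fderiv]
  rfl

lemma norm_le_sum_coord (v : Plane) : ‖v‖ ≤ ∑ i, |v i| := by
  rw [EuclideanSpace.norm_eq]
  refine Real.sqrt_le_iff.2 ⟨by positivity, ?_⟩
  simp only [Fin.sum_univ_two, Real.norm_eq_abs]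
  nlinarith [abs_nonneg (v 0), abs_nonneg (v 1)]

theorem isRegular_of_coord {T : ℝ} {u : ℝ → Plane → Plane}
    (hc : ContinuousOn (fun z : ℝ × Plane => u z.1 z.2) (Ico 0 T ×ˢ univ))
    (h : ∀ i, IsRegular T (fun t x => u t x i)) : IsRegular T u := by
  have hcd : ContDiffOn ℝ 1 (fun z : ℝ × Plane => u z.1 z.2) (Ioo 0 T ×ˢ univ) :=
    contDiffOn_euclidean.2 fun i => (h i).contDiff
  refine ⟨hc, hcd, fun b hb => ?_, fun b hb => ?_⟩
  · choose C hC using fun i => (h i).bound b hb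
    refine ⟨∑ i, C i, fun t ht x => (norm_le_sum_coord _).trans ?_⟩
    exact Finset.sum_le_sum fun i _ => hC i t ht x
  · choose C hC using fun i => (h i).bound_fderiv b hb
    refine ⟨∑ i, C i, fun t ht x => ?_⟩
    have hz : ((t, x) : ℝ × Plane) ∈ Ioo (0 : ℝ) T ×ˢ (univ : Set Plane) :=
      ⟨⟨ht.1, ht.2.trans_lt hb⟩, mem_univ _⟩
    have hd := (hcd.differentiableOn (by norm_num)).differentiableAt ((isOpen_slab T).mem_nhds hz)
    have hC0 : ∀ i, 0 ≤ C i := fun i => (norm_nonneg _).trans (hC i t ht x)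
    refine ContinuousLinearMap.opNorm_le_bound _ (Finset.sum_nonneg fun i _ => hC0 i) fun w => ?_
    refine (norm_le_sum_coord _).trans ?_
    rw [Finset.sum_mul]
    refine Finset.sum_le_sum fun i _ => ?_
    have := (stDeriv (fun t x => u t x i) (t, x)).le_opNorm w
    rw [stDeriv_coord hd] at this
    exact this.trans (by gcongr; exact hC i t ht x)

/-- A classical solution of the Euler equations written for the sound speed `c` and the
velocity `u`, with `κ = (γ - 1) / 2`; the velocity equation holds where `c > 0`. -/
structure IsClassical (κ T : ℝ) (c : ℝ → Plane → ℝ) (u : ℝ → Plane → Plane) : Prop where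
  nonneg : ∀ t ∈ Ico 0 T, ∀ x, 0 ≤ c t x
  regc : IsRegular T c
  regu : IsRegular T u
  transport : ∀ t ∈ Ioo 0 T, ∀ x,
    stDeriv c (t, x) (1, u t x) = -(κ * c t x * divergence u (t, x))
  accel : ∀ t ∈ Ioo 0 T, ∀ x, 0 < c t x → ∀ v,
    inner ℝ (stDeriv u (t, x) (1, u t x)) v = -(κ⁻¹ * c t x * stDeriv c (t, x) (0, v))

/-! ### From equations in the sense of distributions to pointwise equations. -/

section WeakToStrong

/-- The product extends continuously by zero outside `U`, so `f` need only be continuous near the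
support of `g`. -/
lemma integrable_mul_of_tsupport {E : Type*} [NormedAddCommGroup E] [MeasurableSpace E]
    [BorelSpace E] {μ : Measure E} [IsFiniteMeasureOnCompacts μ] {U : Set E} (hU : IsOpen U) {f g : E → ℝ}
    (hf : ContinuousOn f U) (hg : Continuous g) (hgc : HasCompactSupport g)
    (hgU : tsupport g ⊆ U) : Integrable (fun x => f x * g x) μ := by
  have hs : tsupport (fun x => f x * g x) ⊆ tsupport g := closure_mono fun x hx hx' =>
    hx (by simp [hx'])
  refine Continuous.integrable_of_hasCompactSupport ?_ ?_
  · refine continuous_of_tsupport fun x hx => ?_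
    exact (hf.continuousAt (hU.mem_nhds (hgU (hs hx)))).mul hg.continuousAt
  · exact hgc.of_isClosed_subset (isClosed_tsupport _) hs

variable {E : Type*} [NormedAddCommGroup E] [NormedSpace ℝ E] [FiniteDimensional ℝ E]
  [MeasurableSpace E] [BorelSpace E] {μ : Measure E} [μ.IsAddHaarMeasure]

lemma integral_mul_fderiv_of_tsupport {U : Set E} (hU : IsOpen U) {f φ : E → ℝ}
    (hf : ContDiffOn ℝ 1 f U) (hφ : ContDiff ℝ ∞ φ) (hφc : HasCompactSupport φ)
    (hφU : tsupport φ ⊆ U) (v : E) :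
    ∫ x, f x * fderiv ℝ φ x v ∂μ = - ∫ x, φ x * fderiv ℝ f x v ∂μ := by
  have h1 : Continuous fun x => fderiv ℝ φ x v :=
    (hφ.continuous_fderiv (by norm_num)).clm_apply continuous_const
  have h2 : ContinuousOn (fun x => fderiv ℝ f x v) U :=
    (hf.continuousOn_fderiv_of_isOpen hU le_rfl).clm_apply continuousOn_const
  rw [integral_mul_fderiv_eq_neg_fderiv_mul_of_integrable]
  · simp only [mul_comm]
  · exact integrable_mul_of_tsupport hU h2 hφ.continuous hφc hφU
  · exact integrable_mul_of_tsupport hU hf.continuousOn h1 (hφc.fderiv_apply (𝕜 := ℝ) v)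
      ((tsupport_fderiv_apply_subset ℝ v).trans hφU)
  · exact integrable_mul_of_tsupport hU hf.continuousOn hφ.continuous hφc hφU
  · exact fun x hx => (hf.differentiableOn (by norm_num)).differentiableAt (hU.mem_nhds (hφU hx))
  · exact fun x _ => hφ.differentiable (by norm_num) x

/-- A `C¹` field whose weak divergence vanishes on an open set has vanishing divergence there. -/
lemma sum_fderiv_eq_zero_of_weak {ι : Type*} [Fintype ι] {U : Set E} (hU : IsOpen U)
    {F : ι → E → ℝ} {v : ι → E} (hF : ∀ i, ContDiffOn ℝ 1 (F i) U)
    (h : ∀ φ : E → ℝ, ContDiff ℝ ∞ φ → HasCompactSupport φ → tsupport φ ⊆ U →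
      ∫ x, ∑ i, F i x * fderiv ℝ φ x (v i) ∂μ = 0) :
    ∀ x ∈ U, ∑ i, fderiv ℝ (F i) x (v i) = 0 := by
  have hc : ContinuousOn (fun x => ∑ i, fderiv ℝ (F i) x (v i)) U :=
    continuousOn_finsetSum _ fun i _ =>
      ((hF i).continuousOn_fderiv_of_isOpen hU le_rfl).clm_apply continuousOn_const
  have hae : ∀ᵐ x ∂μ, x ∈ U → ∑ i, fderiv ℝ (F i) x (v i) = 0 := by
    refine hU.ae_eq_zero_of_integral_contDiff_smul_eq_zero
      (hc.locallyIntegrableOn hU.measurableSet) fun φ hφ hφc hφU => ?_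
    have h1 := h φ hφ hφc hφU
    rw [integral_finsetSum] at h1
    · simp only [smul_eq_mul, Finset.mul_sum]
      rw [integral_finsetSum, ← neg_eq_zero, ← Finset.sum_neg_distrib, ← h1]
      · exact Finset.sum_congr rfl fun i _ =>
          (integral_mul_fderiv_of_tsupport hU (hF i) hφ hφc hφU (v i)).symm
      · intro i _
        simp only [mul_comm (φ _)]
        exact integrable_mul_of_tsupport hU
          (((hF i).continuousOn_fderiv_of_isOpen hU le_rfl).clm_apply continuousOn_const)
          hφ.continuous hφc hφU
    · intro i _
      exact integrable_mul_of_tsupport hU (hF i).continuousOn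
        ((hφ.continuous_fderiv (by norm_num)).clm_apply continuous_const)
        (hφc.fderiv_apply (𝕜 := ℝ) _)
        ((tsupport_fderiv_apply_subset ℝ _).trans hφU)
  have hae' : (fun x => ∑ i, fderiv ℝ (F i) x (v i)) =ᵐ[μ.restrict U] fun _ => 0 :=
    (ae_restrict_iff' hU.measurableSet).2 hae
  exact Measure.eqOn_open_of_ae_eq hae' hU hc continuousOn_const

end WeakToStrong

/-! ### The Euler equations for the sound speed and the velocity. -/

section Derivation

lemma rpow_soundSpeed {A γ r : ℝ} (hA : 0 < A) (hγ : 1 < γ) (hr : 0 ≤ r) :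
    r = (soundSpeed A γ r / Real.sqrt (A * γ)) ^ (2 / (γ - 1)) := by
  have h1 : 0 < Real.sqrt (A * γ) := Real.sqrt_pos.2 (by nlinarith)
  have h2 : γ - 1 ≠ 0 := by linarith
  rw [soundSpeed, mul_div_cancel_left₀ _ h1.ne', ← Real.rpow_mul hr]
  have : (γ - 1) / 2 * (2 / (γ - 1)) = 1 := by field_simp
  rw [this, Real.rpow_one]

lemma soundSpeed_pos_iff {A γ r : ℝ} (hA : 0 < A) (hγ : 1 < γ) (hr : 0 ≤ r) :
    0 < soundSpeed A γ r ↔ 0 < r := by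
  have h1 : 0 < Real.sqrt (A * γ) := Real.sqrt_pos.2 (by nlinarith)
  constructor
  · intro h
    rcases hr.eq_or_lt with h0 | h0
    · rw [← h0, soundSpeed, Real.zero_rpow (by linarith)] at h
      simp at h
    · exact h0
  · intro h
    exact mul_pos h1 (Real.rpow_pos_of_pos h _)

lemma soundSpeed_nonneg (A γ : ℝ) {r : ℝ} (hr : 0 ≤ r) : 0 ≤ soundSpeed A γ r :=
  mul_nonneg (Real.sqrt_nonneg _) (Real.rpow_nonneg hr _)

variable {A γ T : ℝ} {ρ : ℝ → Plane → ℝ} {u : ℝ → Plane → Plane}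

lemma IsSolution.continuous_slice (h : IsSolution A γ T ρ u) {t : ℝ} (ht : t ∈ Ico 0 T) :
    Continuous (ρ t) := by
  have : ContinuousOn (fun x : Plane => ((t, x) : ℝ × Plane)) univ := by fun_prop
  exact continuousOn_univ.1 (h.density_continuous.comp this fun x _ => ⟨ht, mem_univ _⟩)

lemma IsSolution.continuous_velocity_slice (h : IsSolution A γ T ρ u) {t : ℝ}
    (ht : t ∈ Ico 0 T) : Continuous (u t) := by
  have : ContinuousOn (fun x : Plane => ((t, x) : ℝ × Plane)) univ := by fun_prop
  exact continuousOn_univ.1 (h.velocity_continuous.comp this fun x _ => ⟨ht, mem_univ _⟩)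

lemma IsSolution.isRegular_soundSpeed (h : IsSolution A γ T ρ u) (hγ : 1 < γ) :
    IsRegular T (fun t x => soundSpeed A γ (ρ t x)) := by
  refine isRegular_of_continuousInH (fun t ht => ?_) h.sound_H3 h.sound_H2
  exact continuous_const.mul ((h.continuous_slice ht).rpow_const fun x => Or.inr (by linarith))

lemma IsSolution.isRegular_velocity (h : IsSolution A γ T ρ u) : IsRegular T u := by
  refine isRegular_of_coord h.velocity_continuous fun i =>
    isRegular_of_continuousInH (fun t ht => ?_) (h.velocity_H3 i) (h.velocity_H2 i)
  have := h.continuous_velocity_slice ht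
  fun_prop

/-- The set where the gas is present. -/
def gasRegion (T : ℝ) (c : ℝ → Plane → ℝ) : Set (ℝ × Plane) :=
  {z | z ∈ Ioo 0 T ×ˢ (univ : Set Plane) ∧ 0 < c z.1 z.2}

lemma IsRegular.isOpen_gasRegion {c : ℝ → Plane → ℝ} (h : IsRegular T c) :
    IsOpen (gasRegion T c) :=
  h.contDiff.continuousOn.isOpen_inter_preimage (isOpen_slab T) isOpen_Ioi

/-- The density is a power of the sound speed whose exponent `2 / (γ - 1)` may be less than `1`, so
differentiability is claimed only where the base is positive. -/
lemma IsSolution.contDiffOn_density (h : IsSolution A γ T ρ u) (hA : 0 < A) (hγ : 1 < γ) :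
    ContDiffOn ℝ 1 (fun z : ℝ × Plane => ρ z.1 z.2)
      (gasRegion T fun t x => soundSpeed A γ (ρ t x)) := by
  have h1 : 0 < Real.sqrt (A * γ) := Real.sqrt_pos.2 (by nlinarith)
  have h2 : ContDiffOn ℝ 1 (fun z : ℝ × Plane =>
      (soundSpeed A γ (ρ z.1 z.2) / Real.sqrt (A * γ)) ^ (2 / (γ - 1)))
      (gasRegion T fun t x => soundSpeed A γ (ρ t x)) := by
    refine ContDiffOn.rpow_const_of_ne ?_ fun z hz => (div_pos hz.2 h1).ne'
    exact ((h.isRegular_soundSpeed hγ).contDiff.mono fun z hz => hz.1).div_const _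
  exact h2.congr fun z hz => rpow_soundSpeed hA hγ
    (h.density_nonneg z.1 (Ioo_subset_Ico_self hz.1.1) z.2)

lemma fderiv_split (L : ℝ × Plane →L[ℝ] ℝ) (v : Plane) :
    L (1, v) = L (1, 0) + ∑ j, v j * L (0, EuclideanSpace.single j 1) := by
  have h1 : v = ∑ j, v j • (EuclideanSpace.single j (1 : ℝ) : Plane) := by
    ext i
    fin_cases i <;> simp
  have h2 : ((1, v) : ℝ × Plane) =
      (1, 0) + ∑ j, v j • ((0 : ℝ), (EuclideanSpace.single j (1 : ℝ) : Plane)) := by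
    refine Prod.ext ?_ ?_
    · simp
    · simpa using h1
  rw [h2, map_add, map_sum]
  congr 1
  exact Finset.sum_congr rfl fun j _ => by rw [map_smul, smul_eq_mul]

lemma fderiv_split_zero (L : ℝ × Plane →L[ℝ] ℝ) (v : Plane) :
    L (0, v) = ∑ j, v j * L (0, EuclideanSpace.single j 1) := by
  have h := fderiv_split L v
  have h2 : ((0, v) : ℝ × Plane) = (1, v) - (1, 0) := by simp
  rw [h2, map_sub, h]
  ring

instance isAddHaarMeasure_volume_prod : (volume : Measure (ℝ × Plane)).IsAddHaarMeasure :=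
  inferInstanceAs (((volume : Measure ℝ).prod (volume : Measure Plane)).IsAddHaarMeasure)

/-- In the gas `ρ` is `C¹`, so the weak equations hold pointwise and the chain rule rewrites them
for `c`; the velocity equation needs a division by `ρ`. The transport equation also holds in the
vacuum, where `c` is at its minimum. -/
theorem IsSolution.isClassical (h : IsSolution A γ T ρ u) (hA : 0 < A) (hγ : 1 < γ) :
    IsClassical ((γ - 1) / 2) T (fun t x => soundSpeed A γ (ρ t x)) u := by
  have hs : 0 < Real.sqrt (A * γ) := Real.sqrt_pos.2 (by nlinarith)
  have hs2 : Real.sqrt (A * γ) ^ 2 = A * γ := Real.sq_sqrt (by nlinarith)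
  have hrc := h.isRegular_soundSpeed hγ
  have hru := h.isRegular_velocity
  set c := fun t x => soundSpeed A γ (ρ t x) with hcdef
  set U := gasRegion T c with hU
  have hUo : IsOpen U := hrc.isOpen_gasRegion
  have hUs : U ⊆ Ioo 0 T ×ˢ univ := fun z hz => hz.1
  have hcn : ∀ t ∈ Ico 0 T, ∀ x, 0 ≤ c t x := fun t ht x =>
    soundSpeed_nonneg A γ (h.density_nonneg t ht x)
  have hρp : ∀ z ∈ U, 0 < ρ z.1 z.2 := fun z hz => (soundSpeed_pos_iff hA hγ
    (h.density_nonneg z.1 (Ioo_subset_Ico_self hz.1.1) z.2)).1 hz.2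
  have hρ := h.contDiffOn_density hA hγ
  have hui : ∀ i, ContDiffOn ℝ 1 (fun z : ℝ × Plane => u z.1 z.2 i) U := fun i =>
    (contDiffOn_euclidean.1 hru.contDiff i).mono hUs
  have hdρ : ∀ z ∈ U, DifferentiableAt ℝ (fun z : ℝ × Plane => ρ z.1 z.2) z := fun z hz =>
    (hρ.differentiableOn (by norm_num)).differentiableAt (hUo.mem_nhds hz)
  have hdu : ∀ i, ∀ z ∈ U, DifferentiableAt ℝ (fun z : ℝ × Plane => u z.1 z.2 i) z :=
    fun i z hz => ((hui i).differentiableOn (by norm_num)).differentiableAt (hUo.mem_nhds hz)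
  have hp : ContDiffOn ℝ 1 (fun z : ℝ × Plane => pressure A γ (ρ z.1 z.2)) U :=
    contDiffOn_const.mul (hρ.rpow_const_of_ne fun z hz => (hρp z hz).ne')
  have hdp : ∀ z ∈ U, ∀ w, fderiv ℝ (fun z : ℝ × Plane => pressure A γ (ρ z.1 z.2)) z w =
      A * (γ * ρ z.1 z.2 ^ (γ - 1) * stDeriv ρ z w) := by
    intro z hz w
    have := ((hdρ z hz).hasFDerivAt.rpow_const (p := γ) (Or.inl (hρp z hz).ne')).const_mul A
    simp only [pressure]
    rw [this.fderiv]
    simp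
  have hdc : ∀ z ∈ U, ∀ w, stDeriv c z w = Real.sqrt (A * γ) *
      ((γ - 1) / 2 * ρ z.1 z.2 ^ ((γ - 1) / 2 - 1) * stDeriv ρ z w) := by
    intro z hz w
    have := ((hdρ z hz).hasFDerivAt.rpow_const (p := (γ - 1) / 2)
      (Or.inl (hρp z hz).ne')).const_mul (Real.sqrt (A * γ))
    simp only [stDeriv, hcdef, soundSpeed]
    rw [this.fderiv]
    simp
  have hmass : ∀ z ∈ U, stDeriv ρ z (1, u z.1 z.2) + ρ z.1 z.2 * divergence u z = 0 := by
    intro z hz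
    -- The conservation law is a space-time divergence: `none` indexes the time component and `some
    -- j` the space components.
    have h1 := sum_fderiv_eq_zero_of_weak (μ := volume) (ι := Option (Fin 2)) hUo
      (F := fun o z => o.elim (ρ z.1 z.2) fun j => ρ z.1 z.2 * u z.1 z.2 j)
      (v := fun o => o.elim (1, 0) fun j => (0, EuclideanSpace.single j 1))
      (by
        rintro (_ | j)
        · exact hρ
        · exact hρ.mul (hui j))
      (by
        intro φ h1 h2 h3
        have := h.mass φ ⟨h1, h2, h3.trans hUs⟩
        simpa only [Fintype.sum_option, dt, dx, Option.elim] using this) z hz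
    simp only [Fintype.sum_option, Option.elim] at h1
    rw [fderiv_split, divergence, Finset.mul_sum, add_assoc, ← Finset.sum_add_distrib]
    refine Eq.trans ?_ h1
    congr 1
    refine Finset.sum_congr rfl fun j _ => ?_
    rw [fderiv_fun_mul (hdρ z hz) (hdu j z hz)]
    rw [← stDeriv_coord (hru.differentiableAt (hUs hz))]
    simp only [stDeriv, add_apply, smul_apply,
      smul_eq_mul]
    ring
  have hmom : ∀ z ∈ U, ∀ i, ρ z.1 z.2 * stDeriv u z (1, u z.1 z.2) i +
      A * (γ * ρ z.1 z.2 ^ (γ - 1) * stDeriv ρ z (0, EuclideanSpace.single i 1)) = 0 := by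
    intro z hz i
    -- Here `none` indexes the pressure, `some none` the time component and `some (some j)` the
    -- convective flux.
    have h1 := sum_fderiv_eq_zero_of_weak (μ := volume) (ι := Option (Option (Fin 2))) hUo
      (F := fun o z => o.elim (pressure A γ (ρ z.1 z.2)) fun o => o.elim (ρ z.1 z.2 * u z.1 z.2 i)
        fun j => ρ z.1 z.2 * u z.1 z.2 i * u z.1 z.2 j)
      (v := fun o => o.elim (0, EuclideanSpace.single i 1) fun o =>
        o.elim (1, 0) fun j => (0, EuclideanSpace.single j 1))
      (by
        rintro (_ | _ | j)
        · exact hp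
        · exact hρ.mul (hui i)
        · exact (hρ.mul (hui i)).mul (hui j))
      (by
        intro φ h1 h2 h3
        have := h.momentum i φ ⟨h1, h2, h3.trans hUs⟩
        refine Eq.trans ?_ this
        refine integral_congr_ae (Eventually.of_forall fun z => ?_)
        simp only [Fintype.sum_option, dt, dx, Option.elim]
        ring) z hz
    simp only [Fintype.sum_option, Option.elim] at h1
    rw [hdp z hz] at h1
    rw [← stDeriv_coord (hru.differentiableAt (hUs hz)), fderiv_split]
    have h2 := hmass z hz
    rw [fderiv_split, divergence] at h2
    have e2 := fderiv_fun_mul (hdρ z hz) (hdu i z hz)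
    have e1 : ∀ j, fderiv ℝ (fun z : ℝ × Plane => ρ z.1 z.2 * u z.1 z.2 i * u z.1 z.2 j) z
        (0, EuclideanSpace.single j 1) =
        u z.1 z.2 i * (u z.1 z.2 j * stDeriv ρ z (0, EuclideanSpace.single j 1) +
          ρ z.1 z.2 * stDeriv u z (0, EuclideanSpace.single j 1) j) +
        ρ z.1 z.2 * (u z.1 z.2 j * stDeriv (fun t x => u t x i) z
          (0, EuclideanSpace.single j 1)) := by
      intro j
      rw [fderiv_fun_mul ((hdρ z hz).fun_mul (hdu i z hz)) (hdu j z hz), e2,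
        ← stDeriv_coord (hru.differentiableAt (hUs hz))]
      simp only [stDeriv, add_apply, smul_apply, smul_eq_mul]
      ring
    have e3 : fderiv ℝ (fun z : ℝ × Plane => ρ z.1 z.2 * u z.1 z.2 i) z (1, 0) =
        u z.1 z.2 i * stDeriv ρ z (1, 0) + ρ z.1 z.2 * stDeriv (fun t x => u t x i) z (1, 0) := by
      rw [e2]
      simp only [stDeriv, add_apply, smul_apply, smul_eq_mul]
      ring
    simp only [e1, e3, Fin.sum_univ_two] at h1
    simp only [Fin.sum_univ_two] at h2 ⊢
    -- The momentum equation minus `u i` times the mass equation leaves `ρ` times the acceleration.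
    linear_combination h1 - u z.1 z.2 i * h2
  refine ⟨hcn, hrc, hru, ?_, ?_⟩
  · intro t ht x
    rcases (hcn t (Ioo_subset_Ico_self ht) x).eq_or_lt with h0 | h0
    -- At an interior zero of the nonnegative function `c` its whole space-time derivative vanishes,
    -- so both sides are zero.
    · have hmin : IsLocalMin (fun z : ℝ × Plane => c z.1 z.2) (t, x) := by
        filter_upwards [(isOpen_slab T).mem_nhds (x := (t, x)) ⟨ht, mem_univ _⟩] with w hw
        simp only [← h0]
        exact hcn w.1 (Ioo_subset_Ico_self hw.1) w.2
      simp only [stDeriv]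
      rw [hmin.fderiv_eq_zero, ← h0]
      simp
    · have hz : (t, x) ∈ U := ⟨⟨ht, mem_univ _⟩, h0⟩
      have h1 := hmass _ hz
      have h2 : stDeriv ρ (t, x) (1, u t x) = -(ρ t x * divergence u (t, x)) := by
        simp only at h1; linarith
      have h3 : ρ t x ^ ((γ - 1) / 2 - 1) * ρ t x = ρ t x ^ ((γ - 1) / 2) := by
        rw [← Real.rpow_add_one (hρp _ hz).ne']; ring_nf
      rw [hdc _ hz, h2]
      simp only [hcdef, soundSpeed]
      rw [← h3]
      ring
  · intro t ht x h0 v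
    have hz : (t, x) ∈ U := ⟨⟨ht, mem_univ _⟩, h0⟩
    have key : ∀ i, stDeriv u (t, x) (1, u t x) i =
        -(((γ - 1) / 2)⁻¹ * c t x * stDeriv c (t, x) (0, EuclideanSpace.single i 1)) := by
      intro i
      have h1 := hmom _ hz i
      have hr := hρp _ hz
      simp only at h1 hr
      have h3 : ρ t x ^ ((γ - 1) / 2) * ρ t x ^ ((γ - 1) / 2 - 1) * ρ t x = ρ t x ^ (γ - 1) := by
        rw [mul_assoc, ← Real.rpow_add_one hr.ne', ← Real.rpow_add hr]; ring_nf
      have h4 : 0 < γ - 1 := by linarith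
      rw [hdc _ hz]
      simp only [hcdef, soundSpeed]
      refine mul_left_cancel₀ hr.ne' ?_
      have h5 : ((γ - 1) / 2)⁻¹ * ((γ - 1) / 2) = 1 := inv_mul_cancel₀ (by positivity)
      rw [← h3] at h1
      linear_combination h1 + ρ t x * ρ t x ^ ((γ - 1) / 2) * ρ t x ^ ((γ - 1) / 2 - 1) *
        stDeriv ρ (t, x) (0, EuclideanSpace.single i 1) * (Real.sqrt (A * γ) ^ 2 * h5 + hs2)
    rw [PiLp.inner_apply, fderiv_split_zero, Finset.mul_sum, ← Finset.sum_neg_distrib]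
    refine Finset.sum_congr rfl fun i _ => ?_
    rw [key i]
    simp only [RCLike.inner_apply, conj_trivial]
    ring

end Derivation

/-! ### Grönwall's inequality and particle paths. -/

/-- A two-sided Grönwall inequality with a differential inequality in the open interval only. -/
lemma le_mul_exp_of_abs_deriv_le {f f' : ℝ → ℝ} {K b : ℝ} (hf : ContinuousOn f (Icc 0 b))
    (hd : ∀ t ∈ Ioo 0 b, HasDerivAt f (f' t) t) (hb : ∀ t ∈ Ioo 0 b, |f' t| ≤ K * f t)
    (hf0 : ∀ t ∈ Icc 0 b, 0 ≤ f t) (hK : 0 ≤ K) {r s : ℝ} (hr : r ∈ Icc 0 b) (hs : s ∈ Icc 0 b) :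
    f s ≤ f r * Real.exp (K * b) := by
  have hexp : ∀ (a t : ℝ), HasDerivAt (fun t => Real.exp (a * t)) (Real.exp (a * t) * a) t := by
    intro a t
    simpa using ((hasDerivAt_id t).const_mul a).exp
  have key : ∀ (x y a : ℝ), 0 ≤ a → f x * Real.exp (-a) ≤ y → f x ≤ y * Real.exp a := by
    intro x y a _ h
    rw [Real.exp_neg, ← div_eq_mul_inv, div_le_iff₀ (Real.exp_pos a)] at h
    exact h
  rcases le_total r s with h | h
  -- Forward in time `f * exp (-K t)` decreases; the other case uses that `f * exp (K t)` increases.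
  · have hanti : AntitoneOn (fun t => f t * Real.exp (-K * t)) (Icc 0 b) := by
      refine antitoneOn_of_deriv_nonpos (convex_Icc 0 b) (hf.mul (by fun_prop)) ?_ ?_
      · intro t ht
        rw [interior_Icc] at ht
        exact ((hd t ht).mul (hexp (-K) t)).differentiableAt.differentiableWithinAt
      · intro t ht
        rw [interior_Icc] at ht
        rw [((hd t ht).fun_mul (hexp (-K) t)).deriv]
        have := (abs_le.1 (hb t ht)).2
        nlinarith [Real.exp_pos (-K * t)]
    have h1 := hanti hr hs h
    simp only at h1
    have h2 : f s * Real.exp (-(K * (s - r))) ≤ f r := by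
      have e : Real.exp (-(K * (s - r))) = Real.exp (-K * s) * Real.exp (K * r) := by
        rw [← Real.exp_add]; ring_nf
      have e2 : Real.exp (-K * r) * Real.exp (K * r) = 1 := by
        rw [← Real.exp_add]; simp
      have h3 := mul_le_mul_of_nonneg_right h1 (Real.exp_pos (K * r)).le
      rw [mul_assoc, mul_assoc, e2, mul_one] at h3
      rwa [e]
    refine (key s _ _ (mul_nonneg hK (by linarith)) h2).trans ?_
    refine mul_le_mul_of_nonneg_left (Real.exp_le_exp.2 ?_) (hf0 r hr)
    exact mul_le_mul_of_nonneg_left (by linarith [hr.1, hs.2]) hK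
  · have hmono : MonotoneOn (fun t => f t * Real.exp (K * t)) (Icc 0 b) := by
      refine monotoneOn_of_deriv_nonneg (convex_Icc 0 b) (hf.mul (by fun_prop)) ?_ ?_
      · intro t ht
        rw [interior_Icc] at ht
        exact ((hd t ht).mul (hexp K t)).differentiableAt.differentiableWithinAt
      · intro t ht
        rw [interior_Icc] at ht
        rw [((hd t ht).fun_mul (hexp K t)).deriv]
        have := (abs_le.1 (hb t ht)).1
        nlinarith [Real.exp_pos (K * t)]
    have h1 := hmono hs hr h
    simp only at h1
    have h2 : f s * Real.exp (-(K * (r - s))) ≤ f r := by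
      have e : Real.exp (-(K * (r - s))) = Real.exp (K * s) * Real.exp (-K * r) := by
        rw [← Real.exp_add]; ring_nf
      have e2 : Real.exp (K * r) * Real.exp (-K * r) = 1 := by
        rw [← Real.exp_add]; simp
      have h3 := mul_le_mul_of_nonneg_right h1 (Real.exp_pos (-K * r)).le
      rw [mul_assoc, mul_assoc, e2, mul_one] at h3
      rwa [e]
    refine (key s _ _ (mul_nonneg hK (by linarith)) h2).trans ?_
    refine mul_le_mul_of_nonneg_left (Real.exp_le_exp.2 ?_) (hf0 r hr)
    exact mul_le_mul_of_nonneg_left (by linarith [hs.1, hr.2]) hK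

lemma eq_of_hasDerivAt_zero {V : Type*} [NormedAddCommGroup V] [InnerProductSpace ℝ V]
    {g : ℝ → V} {b : ℝ} (hg : ContinuousOn g (Icc 0 b))
    (hd : ∀ t ∈ Ioo 0 b, HasDerivAt g 0 t) {r s : ℝ} (hr : r ∈ Icc 0 b) (hs : s ∈ Icc 0 b) :
    g s = g r := by
  have h := le_mul_exp_of_abs_deriv_le (f := fun t => ‖g t - g r‖ ^ 2) (f' := fun _ => 0) (K := 0)
    ((hg.sub continuousOn_const).norm.pow 2) (fun t ht => ?_) (by simp)
    (fun t _ => by positivity) le_rfl hr hs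
  · simp only [sub_self, norm_zero] at h
    have : ‖g s - g r‖ ^ 2 = 0 := le_antisymm (by simpa using h) (by positivity)
    exact sub_eq_zero.1 (norm_eq_zero.1 (pow_eq_zero_iff (two_ne_zero) |>.1 this))
  · simpa using ((hd t ht).sub_const (g r)).norm_sq

/-- `X` is a particle path of the velocity field `u` on `[0, b]`. -/
def IsPath (u : ℝ → Plane → Plane) (b : ℝ) (X : ℝ → Plane) : Prop :=
  ∀ s ∈ Icc 0 b, HasDerivWithinAt X (u s (X s)) (Icc 0 b) s

section Path

variable {T b : ℝ} {u : ℝ → Plane → Plane} {X Y : ℝ → Plane}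

lemma IsPath.continuousOn (h : IsPath u b X) : ContinuousOn X (Icc 0 b) :=
  fun s hs => (h s hs).continuousWithinAt

lemma IsPath.hasDerivAt (h : IsPath u b X) {s : ℝ} (hs : s ∈ Ioo 0 b) :
    HasDerivAt X (u s (X s)) s :=
  (h s (Ioo_subset_Icc_self hs)).hasDerivAt (Icc_mem_nhds hs.1 hs.2)

lemma IsRegular.continuous_slice {V : Type*} [NormedAddCommGroup V] [NormedSpace ℝ V]
    {f : ℝ → Plane → V} (h : IsRegular T f) {t : ℝ} (ht : t ∈ Ico 0 T) : Continuous (f t) := by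
  have : ContinuousOn (fun x : Plane => ((t, x) : ℝ × Plane)) univ := by fun_prop
  exact continuousOn_univ.1 (h.cont.comp this fun x _ => ⟨ht, mem_univ _⟩)

lemma IsRegular.continuousOn_time {V : Type*} [NormedAddCommGroup V] [NormedSpace ℝ V]
    {f : ℝ → Plane → V} (h : IsRegular T f) (x : Plane) :
    ContinuousOn (fun t => f t x) (Ico 0 T) := by
  have : ContinuousOn (fun t : ℝ => ((t, x) : ℝ × Plane)) (Ico 0 T) := by fun_prop
  exact h.cont.comp this fun t ht => ⟨ht, mem_univ _⟩

lemma IsRegular.hasFDerivAt_slice {V : Type*} [NormedAddCommGroup V] [NormedSpace ℝ V]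
    {f : ℝ → Plane → V} (h : IsRegular T f) {t : ℝ} (ht : t ∈ Ioo 0 T) (x : Plane) :
    HasFDerivAt (f t) ((stDeriv f (t, x)).comp (ContinuousLinearMap.inr ℝ ℝ Plane)) x := by
  have h1 := (h.differentiableAt (z := (t, x)) ⟨ht, mem_univ _⟩).hasFDerivAt
  exact h1.comp x (hasFDerivAt_prodMk_right t x)

lemma IsRegular.hasDerivAt_time {V : Type*} [NormedAddCommGroup V] [NormedSpace ℝ V]
    {f : ℝ → Plane → V} (h : IsRegular T f) {t : ℝ} (ht : t ∈ Ioo 0 T) (x : Plane) :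
    HasDerivAt (fun s => f s x) (stDeriv f (t, x) (1, 0)) t := by
  have h1 := (h.differentiableAt (z := (t, x)) ⟨ht, mem_univ _⟩).hasFDerivAt
  exact HasFDerivAt.comp_hasDerivAt (f := fun s : ℝ => ((s, x) : ℝ × Plane)) t h1
    ((hasDerivAt_id t).prodMk (hasDerivAt_const t x))

lemma IsRegular.hasDerivAt_path {V : Type*} [NormedAddCommGroup V] [NormedSpace ℝ V]
    {f : ℝ → Plane → V} (h : IsRegular T f) (hb : b < T) (hX : IsPath u b X) {s : ℝ}
    (hs : s ∈ Ioo 0 b) :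
    HasDerivAt (fun s => f s (X s)) (stDeriv f (s, X s) (1, u s (X s))) s := by
  have h1 := (h.differentiableAt (z := (s, X s)) ⟨⟨hs.1, hs.2.trans hb⟩, mem_univ _⟩).hasFDerivAt
  exact HasFDerivAt.comp_hasDerivAt (f := fun s : ℝ => ((s, X s) : ℝ × Plane)) s h1
    ((hasDerivAt_id s).prodMk (hX.hasDerivAt hs))

lemma IsRegular.continuousOn_path {V : Type*} [NormedAddCommGroup V] [NormedSpace ℝ V]
    {f : ℝ → Plane → V} (h : IsRegular T f) (hb : b < T) (hX : IsPath u b X) :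
    ContinuousOn (fun s => f s (X s)) (Icc 0 b) := by
  have : ContinuousOn (fun s : ℝ => ((s, X s) : ℝ × Plane)) (Icc 0 b) :=
    continuousOn_id.prodMk hX.continuousOn
  exact h.cont.comp this fun s hs => ⟨⟨hs.1, hs.2.trans_lt hb⟩, mem_univ _⟩

lemma IsRegular.exists_lipschitz (h : IsRegular T u) (hb0 : 0 < b) (hb : b < T) :
    ∃ K : NNReal, ∀ t ∈ Icc 0 b, LipschitzWith K (u t) := by
  obtain ⟨C, hC⟩ := h.bound_fderiv b hb
  have hC0 : 0 ≤ C := (norm_nonneg _).trans (hC b ⟨hb0, le_rfl⟩ 0)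
  have h1 : ∀ t ∈ Ioc 0 b, LipschitzWith C.toNNReal (u t) := by
    intro t ht
    have ht' : t ∈ Ioo 0 T := ⟨ht.1, ht.2.trans_lt hb⟩
    refine lipschitzWith_of_nnnorm_fderiv_le
      (fun x => (h.hasFDerivAt_slice ht' x).differentiableAt) fun x => ?_
    rw [(h.hasFDerivAt_slice ht' x).fderiv, ← NNReal.coe_le_coe, coe_nnnorm,
      Real.coe_toNNReal _ hC0]
    calc _ ≤ ‖stDeriv u (t, x)‖ * ‖ContinuousLinearMap.inr ℝ ℝ Plane‖ :=
          ContinuousLinearMap.opNorm_comp_le _ _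
      _ ≤ C * 1 := by
          gcongr
          · exact hC t ht x
          · exact ContinuousLinearMap.norm_inr_le_one ℝ ℝ Plane
      _ = C := mul_one C
  refine ⟨C.toNNReal, fun t ht => ?_⟩
  rcases ht.1.eq_or_lt with h0 | h0
  -- No derivative is controlled at time `0`; the Lipschitz bound is inherited as a limit from
  -- positive times.
  · subst h0
    refine LipschitzWith.of_dist_le_mul fun x y => ?_
    have hne : (𝓝[Ioo 0 b] (0 : ℝ)).NeBot := left_nhdsWithin_Ioo_neBot hb0
    have hsub : Ioo 0 b ⊆ Ico 0 T := fun s hs => ⟨hs.1.le, hs.2.trans hb⟩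
    have h2 : ∀ x, Tendsto (fun t => u t x) (𝓝[Ioo 0 b] 0) (𝓝 (u 0 x)) := fun x =>
      ((h.continuousOn_time x) 0 ⟨le_rfl, hb0.trans hb⟩).mono hsub
    refine le_of_tendsto ((h2 x).dist (h2 y)) ?_
    filter_upwards [self_mem_nhdsWithin] with t ht
    exact (h1 t (Ioo_subset_Ioc_self ht)).dist_le_mul x y
  · exact h1 t ⟨h0, ht.2⟩

lemma IsRegular.exists_path (h : IsRegular T u) (hb0 : 0 < b) (hb : b < T) {t₀ : ℝ}
    (ht₀ : t₀ ∈ Icc 0 b) (x₀ : Plane) : ∃ X, IsPath u b X ∧ X t₀ = x₀ := by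
  obtain ⟨K, hK⟩ := h.exists_lipschitz hb0 hb
  obtain ⟨C, hC⟩ := h.bound b hb
  have hC0 : 0 ≤ C := (norm_nonneg _).trans (hC b ⟨hb0.le, le_rfl⟩ 0)
  -- A path of speed at most `C` stays within `C * b` of its start, so this radius yields a solution
  -- on all of `[0, b]`.
  have hpl : IsPicardLindelof u (⟨t₀, ht₀⟩ : Icc (0 : ℝ) b) x₀ (C * b).toNNReal 0 C.toNNReal K := by
    refine ⟨fun t ht => (hK t ht).lipschitzOnWith, fun x _ => ?_, fun t ht x _ => ?_, ?_⟩
    · exact (h.continuousOn_time x).mono fun t ht => ⟨ht.1, ht.2.trans_lt hb⟩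
    · rw [Real.coe_toNNReal _ hC0]
      exact hC t ht x
    · rw [Real.coe_toNNReal _ hC0, Real.coe_toNNReal _ (by positivity), NNReal.coe_zero]
      rw [sub_zero (C * b)]
      refine mul_le_mul_of_nonneg_left (max_le ?_ ?_) hC0
      · simp only; linarith [ht₀.1]
      · simp only; linarith [ht₀.2]
  obtain ⟨X, h1, h2⟩ := hpl.exists_eq_forall_mem_Icc_hasDerivWithinAt₀
  exact ⟨X, h2, h1⟩

/-- Grönwall for the squared distance, in both time directions: the flow and its inverse are
Lipschitz. In particular paths that meet coincide. -/
lemma IsRegular.exists_dist_path_le (h : IsRegular T u) (hb0 : 0 < b) (hb : b < T) :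
    ∃ C > 0, ∀ X Y, IsPath u b X → IsPath u b Y → ∀ r ∈ Icc 0 b, ∀ s ∈ Icc 0 b,
      ‖X s - Y s‖ ≤ C * ‖X r - Y r‖ := by
  obtain ⟨K, hK⟩ := h.exists_lipschitz hb0 hb
  refine ⟨Real.sqrt (Real.exp (2 * K * b)), by positivity, fun X Y hX hY r hr s hs => ?_⟩
  have h1 := le_mul_exp_of_abs_deriv_le (f := fun t => ‖X t - Y t‖ ^ 2)
    (f' := fun t => 2 * inner ℝ (X t - Y t) (u t (X t) - u t (Y t))) (K := 2 * K) (b := b)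
    ((hX.continuousOn.sub hY.continuousOn).norm.pow 2)
    (fun t ht => ((hX.hasDerivAt ht).sub (hY.hasDerivAt ht)).norm_sq) (fun t ht => ?_)
    (fun t _ => by positivity) (by positivity) hr hs
  · have h2 : ‖X s - Y s‖ ^ 2 ≤ (Real.sqrt (Real.exp (2 * K * b)) * ‖X r - Y r‖) ^ 2 := by
      rw [mul_pow, Real.sq_sqrt (Real.exp_pos _).le, mul_comm]
      exact h1
    exact le_of_sq_le_sq h2 (by positivity)
  · have h2 := abs_real_inner_le_norm (X t - Y t) (u t (X t) - u t (Y t))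
    have h3 := (hK t (Ioo_subset_Icc_self ht)).norm_sub_le (X t) (Y t)
    rw [abs_mul, abs_two]
    nlinarith [mul_le_mul_of_nonneg_left h3 (norm_nonneg (X t - Y t))]

lemma IsPath.norm_sub_le (hX : IsPath u b X) {C : ℝ} (hC : ∀ t ∈ Icc 0 b, ∀ x, ‖u t x‖ ≤ C)
    {r s : ℝ} (hr : r ∈ Icc 0 b) (hs : s ∈ Icc 0 b) : ‖X s - X r‖ ≤ C * ‖s - r‖ :=
  (convex_Icc 0 b).norm_image_sub_le_of_norm_hasDerivWithin_le (fun t ht => hX t ht)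
    (fun t ht => hC t ht _) hr hs

end Path

/-! ### Motion of the boundary between gas and vacuum. -/

section Vacuum

variable {κ T b : ℝ} {c d : ℝ → Plane → ℝ} {u v : ℝ → Plane → Plane} {X : ℝ → Plane}

lemma IsRegular.exists_abs_divergence_le (h : IsRegular T u) (hb : b < T) :
    ∃ C ≥ 0, ∀ t ∈ Ioc 0 b, ∀ x, |divergence u (t, x)| ≤ C := by
  obtain ⟨C, hC⟩ := h.bound_fderiv b hb
  refine ⟨2 * max C 0, by positivity, fun t ht x => ?_⟩
  have h1 : ∀ j : Fin 2, |stDeriv u (t, x) (0, EuclideanSpace.single j 1) j| ≤ max C 0 := by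
    intro j
    have h2 := (stDeriv u (t, x)).le_opNorm (0, EuclideanSpace.single j (1 : ℝ))
    have h3 : ‖((0 : ℝ), (EuclideanSpace.single j (1 : ℝ) : Plane))‖ = 1 := by
      simp [Prod.norm_def]
    rw [h3, mul_one] at h2
    exact (PiLp.norm_apply_le _ j).trans (h2.trans ((hC t ht x).trans (le_max_left _ _)))
  rw [divergence, Fin.sum_univ_two]
  exact (abs_add_le _ _).trans (by linarith [h1 0, h1 1])

/-- A particle path that meets the gas stays in the gas. -/
lemma IsClassical.pos_path (h : IsClassical κ T c u) (hb : b < T) (hX : IsPath u b X)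
    {r s : ℝ} (hr : r ∈ Icc 0 b) (hs : s ∈ Icc 0 b) (hp : 0 < c s (X s)) : 0 < c r (X r) := by
  obtain ⟨C, hC0, hC⟩ := h.regu.exists_abs_divergence_le hb
  have hmem : ∀ t ∈ Icc 0 b, t ∈ Ico 0 T := fun t ht => ⟨ht.1, ht.2.trans_lt hb⟩
  have h1 := le_mul_exp_of_abs_deriv_le (K := |κ| * C) (h.regc.continuousOn_path hb hX)
    (fun t ht => h.regc.hasDerivAt_path hb hX ht) (fun t ht => ?_)
    (fun t ht => h.nonneg t (hmem t ht) _) (by positivity) hr hs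
  · by_contra hcon
    have h2 := h.nonneg r (hmem r hr) (X r)
    have h3 : c r (X r) = 0 := le_antisymm (not_lt.1 hcon) h2
    rw [h3, zero_mul] at h1
    linarith
  · have ht' : t ∈ Ioo 0 T := ⟨ht.1, ht.2.trans hb⟩
    rw [h.transport t ht', abs_neg, abs_mul, abs_mul,
      abs_of_nonneg (h.nonneg t (Ioo_subset_Ico_self ht') _)]
    have h4 := hC t (Ioo_subset_Ioc_self ht) (X t)
    have h5 := h.nonneg t (Ioo_subset_Ico_self ht') (X t)
    calc |κ| * c t (X t) * |divergence u (t, X t)| ≤ |κ| * c t (X t) * C := by gcongr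
      _ = _ := by ring

/-- The boundary between gas and vacuum at a given time. -/
def vacuumBoundary (c : ℝ → Plane → ℝ) (t : ℝ) : Set Plane :=
  {x | c t x = 0 ∧ x ∈ closure {y | 0 < c t y}}

/-- Along a path `c` can neither become nor cease to be zero. Nearby gas points are carried along
their own paths, remain gas and remain near. -/
lemma IsClassical.vacuumBoundary_path (h : IsClassical κ T c u) (hb0 : 0 < b) (hb : b < T)
    (hX : IsPath u b X) {r s : ℝ} (hr : r ∈ Icc 0 b) (hs : s ∈ Icc 0 b)
    (hx : X r ∈ vacuumBoundary c r) : X s ∈ vacuumBoundary c s := by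
  have hmem : ∀ t ∈ Icc 0 b, t ∈ Ico 0 T := fun t ht => ⟨ht.1, ht.2.trans_lt hb⟩
  refine ⟨?_, ?_⟩
  · refine le_antisymm (not_lt.1 fun hp => ?_) (h.nonneg s (hmem s hs) _)
    exact (h.pos_path hb hX hr hs hp).ne' hx.1
  · obtain ⟨C, hC0, hC⟩ := h.regu.exists_dist_path_le hb0 hb
    rw [Metric.mem_closure_iff]
    intro ε hε
    obtain ⟨y, hy, hyd⟩ := Metric.mem_closure_iff.1 hx.2 (ε / C) (by positivity)
    obtain ⟨Y, hY, hYr⟩ := h.regu.exists_path hb0 hb hr y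
    refine ⟨Y s, h.pos_path hb hY hs hr (by rw [hYr]; exact hy), ?_⟩
    rw [dist_eq_norm]
    refine (hC X Y hX hY r hr s hs).trans_lt ?_
    rw [hYr, ← dist_eq_norm, mul_comm]
    exact (lt_div_iff₀ hC0).1 hyd

/-- The velocity equation in the gas is a closed condition on `x`, so it extends to the boundary,
where the pressure force `κ⁻¹ c ∇c` vanishes with `c`. -/
lemma IsClassical.accel_eq_zero (h : IsClassical κ T c u) {t : ℝ} (ht : t ∈ Ioo 0 T) {x : Plane}
    (hx : x ∈ vacuumBoundary c t) : stDeriv u (t, x) (1, u t x) = 0 := by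
  have ht' : t ∈ Ico 0 T := Ioo_subset_Ico_self ht
  have hcs : ∀ {V : Type} [NormedAddCommGroup V] [NormedSpace ℝ V] {f : ℝ → Plane → V},
      IsRegular T f → Continuous fun y => stDeriv f (t, y) := by
    intro V _ _ f hf
    have : ContinuousOn (fun x : Plane => ((t, x) : ℝ × Plane)) univ := by fun_prop
    exact continuousOn_univ.1 (hf.continuousOn_stDeriv.comp this fun x _ => ⟨ht, mem_univ _⟩)
  have hc := h.regc.continuous_slice ht'
  have hu := h.regu.continuous_slice ht'
  refine ext_inner_right ℝ fun w => ?_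
  have hcl : IsClosed {y | inner ℝ (stDeriv u (t, y) (1, u t y)) w =
      -(κ⁻¹ * c t y * stDeriv c (t, y) (0, w))} := by
    refine isClosed_eq ?_ ?_
    · exact ((hcs h.regu).clm_apply (continuous_const.prodMk hu)).inner continuous_const
    · exact ((continuous_const.mul hc).mul ((hcs h.regc).clm_apply continuous_const)).neg
  have := closure_minimal (fun y hy => h.accel t ht y hy w) hcl hx.2
  rw [this.out, hx.1]
  simp

/-- Particles on the vacuum boundary move along straight lines. -/
lemma IsClassical.path_eq_line (h : IsClassical κ T c u) (hb0 : 0 < b) (hb : b < T)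
    (hX : IsPath u b X) {r : ℝ} (hr : r ∈ Icc 0 b) (hx : X r ∈ vacuumBoundary c r) {s : ℝ}
    (hs : s ∈ Icc 0 b) : u s (X s) = u 0 (X 0) ∧ X s = X 0 + s • u 0 (X 0) := by
  have h0 : (0 : ℝ) ∈ Icc 0 b := ⟨le_rfl, hb0.le⟩
  have h1 : ∀ s ∈ Icc 0 b, u s (X s) = u 0 (X 0) := by
    intro s hs
    refine eq_of_hasDerivAt_zero (g := fun s => u s (X s)) (h.regu.continuousOn_path hb hX)
      (fun t ht => ?_) h0 hs
    have := h.regu.hasDerivAt_path hb hX ht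
    rwa [h.accel_eq_zero ⟨ht.1, ht.2.trans hb⟩
      (h.vacuumBoundary_path hb0 hb hX hr (Ioo_subset_Icc_self ht) hx)] at this
  refine ⟨h1 s hs, ?_⟩
  have h2 := eq_of_hasDerivAt_zero (g := fun s => X s - s • u 0 (X 0))
    (hX.continuousOn.sub (by fun_prop)) (fun t ht => ?_) h0 hs
  · simp only [zero_smul, sub_zero] at h2
    rw [← sub_eq_iff_eq_add, h2]
  · have h3 := (hX.hasDerivAt ht).sub ((hasDerivAt_id t).smul_const (u 0 (X 0)))
    rw [h1 t (Ioo_subset_Icc_self ht), one_smul, sub_self] at h3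
    exact h3

/-- A gas particle of the first flow is followed from time `0`. If `d` vanished on its path, then at
the first such time the particle would sit on the vacuum boundary of the second solution, which
moves there on a straight line from the initial boundary. The first flow carries the same initial
boundary point along the same line, so the gas particle would meet a boundary particle of its own
flow, against uniqueness of paths. -/
lemma IsClassical.pos_of_pos (h : IsClassical κ T c u) (h' : IsClassical κ T d v)
    (hc0 : c 0 = d 0) (hu0 : u 0 = v 0) {t : ℝ} (ht : t ∈ Ico 0 T) {x : Plane} (hp : 0 < c t x) :
    0 < d t x := by
  rcases ht.1.eq_or_lt with ht0 | ht0
  · subst ht0; rwa [← hc0]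
  have hmem : ∀ s ∈ Icc 0 t, s ∈ Ico 0 T := fun s hs => ⟨hs.1, hs.2.trans_lt ht.2⟩
  have h0 : (0 : ℝ) ∈ Icc 0 t := ⟨le_rfl, ht0.le⟩
  have htt : t ∈ Icc 0 t := ⟨ht0.le, le_rfl⟩
  obtain ⟨X, hX, hXt⟩ := h.regu.exists_path ht0 ht.2 htt x
  have hpos0 : 0 < c 0 (X 0) := h.pos_path ht.2 hX h0 htt (by rwa [hXt])
  by_contra hcon
  set Z := {s | s ∈ Icc 0 t ∧ d s (X s) = 0} with hZ
  have hZc : IsCompact Z := by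
    have hd : ContinuousOn (fun s => d s (X s)) (Icc 0 t) :=
      h'.regc.continuousOn_path (u := u) ht.2 hX
    refine isCompact_Icc.of_isClosed_subset ?_ fun s hs => hs.1
    exact hd.preimage_isClosed_of_isClosed isClosed_Icc isClosed_singleton
  have hZn : Z.Nonempty := ⟨t, htt, le_antisymm (by rw [hXt]; exact not_lt.1 hcon)
    (h'.nonneg t ht _)⟩
  obtain ⟨s, ⟨hs, hs0⟩, hmin⟩ := hZc.exists_isLeast hZn
  have hspos : 0 < s := by
    refine lt_of_le_of_ne hs.1 fun e => ?_
    rw [← e, ← hc0] at hs0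
    exact hpos0.ne' hs0
  obtain ⟨M, hM⟩ := h.regu.bound t ht.2
  obtain ⟨M', hM'⟩ := h'.regu.bound t ht.2
  have hM0 : 0 ≤ M := (norm_nonneg _).trans (hM t htt 0)
  have hM0' : 0 ≤ M' := (norm_nonneg _).trans (hM' t htt 0)
  have hbd : X s ∈ vacuumBoundary d s := by
    refine ⟨hs0, Metric.mem_closure_iff.2 fun ε hε => ?_⟩
    -- Shortly before `s` the point `X (s - δ)` is gas for the second solution. Over a time `δ` the
    -- two flows separate by at most `(M + M') δ`, less than `ε`; the bound `s / 2` keeps the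
    -- earlier time positive.
    set δ := min (s / 2) (ε / (M + M' + 1) / 2)
    have hδ : 0 < δ := by positivity
    have hδs : δ ≤ s / 2 := min_le_left _ _
    have hδε : δ ≤ ε / (M + M' + 1) / 2 := min_le_right _ _
    have hr : s - δ ∈ Icc 0 t := ⟨by linarith, by linarith [hs.2]⟩
    obtain ⟨Y, hY, hYr⟩ := h'.regu.exists_path ht0 ht.2 hr (X (s - δ))
    have hdr : 0 < d (s - δ) (X (s - δ)) := by
      refine lt_of_le_of_ne (h'.nonneg _ (hmem _ hr) _) fun e => ?_
      have := hmin ⟨hr, e.symm⟩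
      linarith
    refine ⟨Y s, h'.pos_path ht.2 hY hs hr (by rwa [hYr]), ?_⟩
    have e1 := hX.norm_sub_le hM hr hs
    have e2 := hY.norm_sub_le hM' hr hs
    rw [hYr] at e2
    have e3 : ‖s - (s - δ)‖ = δ := by rw [sub_sub_cancel, Real.norm_of_nonneg hδ.le]
    rw [e3] at e1 e2
    calc dist (X s) (Y s) ≤ dist (X s) (X (s - δ)) + dist (X (s - δ)) (Y s) :=
          dist_triangle _ _ _
      _ = ‖X s - X (s - δ)‖ + ‖Y s - X (s - δ)‖ := by rw [dist_eq_norm, dist_comm, dist_eq_norm]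
      _ ≤ (M + M' + 1) * δ := by linarith
      _ ≤ (M + M' + 1) * (ε / (M + M' + 1) / 2) := by gcongr
      _ = ε / 2 := by field_simp
      _ < ε := half_lt_self hε
  obtain ⟨Z', hZ', hZs⟩ := h'.regu.exists_path ht0 ht.2 hs (X s)
  have hbdZ : Z' s ∈ vacuumBoundary d s := by rwa [hZs]
  have hl := (h'.path_eq_line ht0 ht.2 hZ' hs hbdZ hs).2
  have hβ := h'.vacuumBoundary_path ht0 ht.2 hZ' hs h0 hbdZ
  obtain ⟨W, hW, hW0⟩ := h.regu.exists_path ht0 ht.2 h0 (Z' 0)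
  have hβ' : W 0 ∈ vacuumBoundary c 0 := by
    rw [hW0]; simpa only [vacuumBoundary, hc0] using hβ
  have hl' := (h.path_eq_line ht0 ht.2 hW h0 hβ' hs).2
  -- Both flows start at the same boundary point with the same initial velocity and move it along
  -- the same line.
  have hWX : W s = X s := by rw [hl', hW0, hu0, ← hl, hZs]
  obtain ⟨C, hC0, hC⟩ := h.regu.exists_dist_path_le ht0 ht.2
  have h5 := hC W X hW hX s hs 0 h0
  rw [hWX, sub_self, norm_zero, mul_zero] at h5
  have h6 : W 0 = X 0 := sub_eq_zero.1 (norm_le_zero_iff.1 h5)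
  rw [h6] at hβ'
  exact hpos0.ne' hβ'.1

/-- Both velocities equal the initial velocity at the foot of the common straight line through the
point. -/
lemma IsClassical.velocity_eq_of_vacuumBoundary (h : IsClassical κ T c u) (h' : IsClassical κ T d v)
    (hc0 : c 0 = d 0) (hu0 : u 0 = v 0) {t : ℝ} (ht : t ∈ Ico 0 T) {x : Plane}
    (hx : x ∈ vacuumBoundary c t) : u t x = v t x := by
  rcases ht.1.eq_or_lt with ht0 | ht0
  · subst ht0; rw [hu0]
  have h0 : (0 : ℝ) ∈ Icc 0 t := ⟨le_rfl, ht0.le⟩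
  have htt : t ∈ Icc 0 t := ⟨ht0.le, le_rfl⟩
  obtain ⟨X, hX, hXt⟩ := h.regu.exists_path ht0 ht.2 htt x
  have hx' : X t ∈ vacuumBoundary c t := by rwa [hXt]
  have hl := h.path_eq_line ht0 ht.2 hX htt hx' htt
  obtain ⟨Y, hY, hY0⟩ := h'.regu.exists_path ht0 ht.2 h0 (X 0)
  have hβ : Y 0 ∈ vacuumBoundary d 0 := by
    rw [hY0]
    simpa only [vacuumBoundary, hc0] using h.vacuumBoundary_path ht0 ht.2 hX htt h0 hx'
  have hl' := h'.path_eq_line ht0 ht.2 hY h0 hβ htt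
  have hYt : Y t = x := by rw [hl'.2, hY0, ← hu0, ← hl.2, hXt]
  rw [hXt] at hl
  rw [hYt, hY0, ← hu0] at hl'
  rw [hl.1, hl'.1]

end Vacuum

/-! ### Uniqueness in the gas by an energy estimate. -/

section Energy

lemma inner_plane (a b : Plane) : inner ℝ a b = a 0 * b 0 + a 1 * b 1 := by
  simp [PiLp.inner_apply, Fin.sum_univ_two, mul_comm]

variable {κ T b : ℝ} {c d : ℝ → Plane → ℝ} {u v : ℝ → Plane → Plane}

/-- The difference of two velocities, cut off to the gas. -/
def velocityGap (c : ℝ → Plane → ℝ) (u v : ℝ → Plane → Plane) (t : ℝ) (x : Plane) : Plane :=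
  if 0 < c t x then u t x - v t x else 0

/-- The energy density of the difference of two states. -/
def energyGap (κ : ℝ) (c d : ℝ → Plane → ℝ) (u v : ℝ → Plane → Plane) (t : ℝ) (x : Plane) : ℝ :=
  κ⁻¹ ^ 2 * (c t x - d t x) ^ 2 + ‖velocityGap c u v t x‖ ^ 2

/-- The flux of the energy density of the difference of two states. -/
def energyFlux (κ : ℝ) (c d : ℝ → Plane → ℝ) (u v : ℝ → Plane → Plane) (j : Fin 2) (t : ℝ)
    (x : Plane) : ℝ :=
  energyGap κ c d u v t x * u t x j + 2 * κ⁻¹ * (c t x * (c t x - d t x) * (u t x j - v t x j))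

lemma energyGap_nonneg (t : ℝ) (x : Plane) : 0 ≤ energyGap κ c d u v t x := by
  unfold energyGap; positivity

/-- Gas close by at another time is carried to time `t` along its path, which moves it by at most `M
|t - s|`. -/
lemma IsClassical.mem_closure_slice (h : IsClassical κ T c u) {t : ℝ} (ht : t ∈ Ioo 0 T)
    {x : Plane} (hx : (t, x) ∈ closure (gasRegion T c)) : x ∈ closure {y | 0 < c t y} := by
  obtain ⟨b, htb, hbT⟩ := exists_between ht.2
  have hb0 : 0 < b := ht.1.trans htb
  have htb' : t ∈ Icc 0 b := ⟨ht.1.le, htb.le⟩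
  obtain ⟨M, hM⟩ := h.regu.bound b hbT
  have hM0 : 0 ≤ M := (norm_nonneg _).trans (hM t htb' 0)
  rw [Metric.mem_closure_iff] at hx ⊢
  intro ε hε
  -- The bound `b - t` keeps `s` in `[0, b]`; the other gives total displacement below `(1 + M) ε /
  -- (M + 1) = ε`.
  obtain ⟨⟨s, y⟩, hsy, hd⟩ := hx (min (b - t) (ε / (M + 1))) (lt_min (by linarith) (by positivity))
  have hd1 : dist t s < min (b - t) (ε / (M + 1)) := lt_of_le_of_lt (le_max_left _ _) hd
  have hd2 : dist x y < min (b - t) (ε / (M + 1)) := lt_of_le_of_lt (le_max_right _ _) hd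
  have hs : s ∈ Icc 0 b := by
    refine ⟨hsy.1.1.1.le, ?_⟩
    have := hd1.trans_le (min_le_left _ _)
    rw [Real.dist_eq] at this
    linarith [(abs_lt.1 this).1]
  obtain ⟨Y, hY, hYs⟩ := h.regu.exists_path hb0 hbT hs y
  refine ⟨Y t, h.pos_path hbT hY htb' hs (by rw [hYs]; exact hsy.2), ?_⟩
  have e1 := hY.norm_sub_le hM hs htb'
  rw [hYs, ← dist_eq_norm, ← dist_eq_norm] at e1
  calc dist x (Y t) ≤ dist x y + dist (Y t) y := dist_triangle_right _ _ _
    _ ≤ dist x y + M * dist t s := by gcongr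
    _ < ε / (M + 1) + M * (ε / (M + 1)) := by
        have h1 := hd1.trans_le (min_le_right _ _)
        have h2 := hd2.trans_le (min_le_right _ _)
        have h3 := mul_le_mul_of_nonneg_left h1.le hM0
        linarith
    _ = ε := by field_simp; ring

lemma IsClassical.stDeriv_eq_zero (h : IsClassical κ T c u) {t : ℝ} (ht : t ∈ Ioo 0 T) {x : Plane}
    (h0 : c t x = 0) : stDeriv c (t, x) = 0 := by
  refine IsLocalMin.fderiv_eq_zero ?_
  filter_upwards [(isOpen_slab T).mem_nhds (x := (t, x)) ⟨ht, mem_univ _⟩] with w hw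
  simp only [h0]
  exact h.nonneg w.1 (Ioo_subset_Ico_self hw.1) w.2

lemma hasFDerivAt_coord {u : ℝ → Plane → Plane} (h : IsRegular T u) {z : ℝ × Plane}
    (hz : z ∈ Ioo (0 : ℝ) T ×ˢ univ) (j : Fin 2) :
    HasFDerivAt (fun z : ℝ × Plane => u z.1 z.2 j)
      ((EuclideanSpace.proj j : Plane →L[ℝ] ℝ).comp (stDeriv u z)) z := by
  have := (hasFDerivWithinAt_euclidean.1
    ((h.differentiableAt hz).hasFDerivAt.hasFDerivWithinAt (s := univ)) j)
  rwa [hasFDerivWithinAt_univ] at this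

/-- The cut-off does no harm: in the gas it is inactive, off the closure of the gas the function is
locally zero, and on the boundary the velocities agree, so that the square vanishes to first order.
-/
lemma IsClassical.hasFDerivAt_sq_velocityGap (h : IsClassical κ T c u) (h' : IsClassical κ T d v)
    (hc0 : c 0 = d 0) (hu0 : u 0 = v 0) {t : ℝ} (ht : t ∈ Ioo 0 T) (x : Plane) :
    HasFDerivAt (fun z : ℝ × Plane => ‖velocityGap c u v z.1 z.2‖ ^ 2)
      ((2 : ℝ) • (innerSL ℝ (velocityGap c u v t x)).comp
        (stDeriv u (t, x) - stDeriv v (t, x))) (t, x) := by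
  have hz : ((t, x) : ℝ × Plane) ∈ Ioo (0 : ℝ) T ×ˢ (univ : Set Plane) := ⟨ht, mem_univ _⟩
  have hw : HasFDerivAt (fun z : ℝ × Plane => u z.1 z.2 - v z.1 z.2)
      (stDeriv u (t, x) - stDeriv v (t, x)) (t, x) :=
    (h.regu.differentiableAt hz).hasFDerivAt.sub (h'.regu.differentiableAt hz).hasFDerivAt
  rcases (h.nonneg t (Ioo_subset_Ico_self ht) x).eq_or_lt with h0 | h0
  · have hv0 : velocityGap c u v t x = 0 := by simp [velocityGap, ← h0]
    rw [hv0, map_zero, ContinuousLinearMap.zero_comp, smul_zero]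
    by_cases hcl : (t, x) ∈ closure (gasRegion T c)
    · have hx : x ∈ vacuumBoundary c t := ⟨h0.symm, h.mem_closure_slice ht hcl⟩
      have hwz : u t x - v t x = 0 := sub_eq_zero.2
        (h.velocity_eq_of_vacuumBoundary h' hc0 hu0 (Ioo_subset_Ico_self ht) hx)
      have h2 : HasFDerivAt (fun z : ℝ × Plane => ‖u z.1 z.2 - v z.1 z.2‖ ^ 2)
          (0 : ℝ × Plane →L[ℝ] ℝ) (t, x) := by
        have := hw.norm_sq
        simp only at this
        rwa [hwz, map_zero, ContinuousLinearMap.zero_comp, smul_zero] at this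
      -- The square of the cut-off difference is dominated by that of the full difference, which has
      -- zero value and zero derivative here.
      rw [hasFDerivAt_iff_isLittleO] at h2 ⊢
      refine Asymptotics.IsBigO.trans_isLittleO (Asymptotics.IsBigO.of_bound 1
        (Eventually.of_forall fun z => ?_)) h2
      simp only [hv0, hwz, norm_zero, zero_apply, sub_zero, one_mul, ne_eq,
        OfNat.ofNat_ne_zero, not_false_eq_true, zero_pow]
      rw [norm_pow, norm_pow, norm_norm, norm_norm]
      unfold velocityGap
      split_ifs
      · exact le_rfl
      · simp
    · refine (hasFDerivAt_const (0 : ℝ) _).congr_of_eventuallyEq ?_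
      filter_upwards [(isClosed_closure.isOpen_compl).mem_nhds hcl, (isOpen_slab T).mem_nhds hz]
        with z h1 h2
      have : ¬ 0 < c z.1 z.2 := fun h3 => h1 (subset_closure ⟨h2, h3⟩)
      simp [velocityGap, this]
  · have hv0 : velocityGap c u v t x = u t x - v t x := by simp [velocityGap, h0]
    rw [hv0]
    refine (hw.norm_sq.congr_fderiv
      ((two_nsmul _).trans (two_smul ℝ _).symm)).congr_of_eventuallyEq ?_
    filter_upwards [h.regc.isOpen_gasRegion.mem_nhds (x := (t, x)) ⟨hz, h0⟩] with z h1
    simp [velocityGap, h1.2]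

/-- The derivative of the energy density. -/
def energyDeriv (κ : ℝ) (c d : ℝ → Plane → ℝ) (u v : ℝ → Plane → Plane) (z : ℝ × Plane) :
    ℝ × Plane →L[ℝ] ℝ :=
  (2 * κ⁻¹ ^ 2 * (c z.1 z.2 - d z.1 z.2)) • (stDeriv c z - stDeriv d z) +
    (2 : ℝ) • (innerSL ℝ (velocityGap c u v z.1 z.2)).comp (stDeriv u z - stDeriv v z)

/-- The derivative of the energy flux. -/
def fluxDeriv (κ : ℝ) (c d : ℝ → Plane → ℝ) (u v : ℝ → Plane → Plane) (j : Fin 2)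
    (z : ℝ × Plane) : ℝ × Plane →L[ℝ] ℝ :=
  energyGap κ c d u v z.1 z.2 • (EuclideanSpace.proj j : Plane →L[ℝ] ℝ).comp (stDeriv u z) +
    u z.1 z.2 j • energyDeriv κ c d u v z +
    (2 * κ⁻¹) • ((c z.1 z.2 * (c z.1 z.2 - d z.1 z.2)) •
        (EuclideanSpace.proj j : Plane →L[ℝ] ℝ).comp (stDeriv u z - stDeriv v z) +
      (u z.1 z.2 j - v z.1 z.2 j) • (c z.1 z.2 • (stDeriv c z - stDeriv d z) +
        (c z.1 z.2 - d z.1 z.2) • stDeriv c z))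

lemma energyDeriv_apply (z w : ℝ × Plane) : energyDeriv κ c d u v z w =
    2 * κ⁻¹ ^ 2 * (c z.1 z.2 - d z.1 z.2) * (stDeriv c z w - stDeriv d z w) +
      2 * inner ℝ (velocityGap c u v z.1 z.2) (stDeriv u z w - stDeriv v z w) := rfl

lemma fluxDeriv_apply (j : Fin 2) (z w : ℝ × Plane) : fluxDeriv κ c d u v j z w =
    energyGap κ c d u v z.1 z.2 * stDeriv u z w j + u z.1 z.2 j * energyDeriv κ c d u v z w +
      2 * κ⁻¹ * (c z.1 z.2 * (c z.1 z.2 - d z.1 z.2) * (stDeriv u z w - stDeriv v z w) j +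
        (u z.1 z.2 j - v z.1 z.2 j) * (c z.1 z.2 * (stDeriv c z w - stDeriv d z w) +
          (c z.1 z.2 - d z.1 z.2) * stDeriv c z w)) := rfl

lemma IsClassical.hasFDerivAt_energyGap (h : IsClassical κ T c u) (h' : IsClassical κ T d v)
    (hc0 : c 0 = d 0) (hu0 : u 0 = v 0) {t : ℝ} (ht : t ∈ Ioo 0 T) (x : Plane) :
    HasFDerivAt (fun z : ℝ × Plane => energyGap κ c d u v z.1 z.2)
      (energyDeriv κ c d u v (t, x)) (t, x) := by
  have hz : ((t, x) : ℝ × Plane) ∈ Ioo (0 : ℝ) T ×ˢ (univ : Set Plane) := ⟨ht, mem_univ _⟩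
  have h1 := (h.regc.differentiableAt hz).hasFDerivAt.sub (h'.regc.differentiableAt hz).hasFDerivAt
  have h2 := ((h1.pow 2).const_mul (κ⁻¹ ^ 2)).add (h.hasFDerivAt_sq_velocityGap h' hc0 hu0 ht x)
  refine h2.congr_fderiv ?_
  unfold energyDeriv
  congr 1
  ext w <;> simp <;> ring

lemma IsClassical.hasFDerivAt_energyFlux (h : IsClassical κ T c u) (h' : IsClassical κ T d v)
    (hc0 : c 0 = d 0) (hu0 : u 0 = v 0) {t : ℝ} (ht : t ∈ Ioo 0 T) (x : Plane) (j : Fin 2) :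
    HasFDerivAt (fun z : ℝ × Plane => energyFlux κ c d u v j z.1 z.2)
      (fluxDeriv κ c d u v j (t, x)) (t, x) := by
  have hz : ((t, x) : ℝ × Plane) ∈ Ioo (0 : ℝ) T ×ˢ (univ : Set Plane) := ⟨ht, mem_univ _⟩
  have h1 := (h.regc.differentiableAt hz).hasFDerivAt
  have h2 := (h'.regc.differentiableAt hz).hasFDerivAt
  have h3 := (h.hasFDerivAt_energyGap h' hc0 hu0 ht x).mul (hasFDerivAt_coord h.regu hz j)
  have h4 := ((h1.mul (h1.sub h2)).mul ((hasFDerivAt_coord h.regu hz j).sub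
    (hasFDerivAt_coord h'.regu hz j))).const_mul (2 * κ⁻¹)
  exact (h3.add h4).congr_fderiv rfl

/-- The energy identity, with a remainder that is quadratic in the difference of the states. -/
lemma IsClassical.energy_identity (hκ : κ ≠ 0) (h : IsClassical κ T c u)
    (h' : IsClassical κ T d v) {t : ℝ} (ht : t ∈ Ioo 0 T) {x : Plane} (hc : 0 < c t x)
    (hd : 0 < d t x) :
    energyDeriv κ c d u v (t, x) (1, 0) +
        ∑ j, fluxDeriv κ c d u v j (t, x) (0, EuclideanSpace.single j 1) =
      energyGap κ c d u v t x * divergence u (t, x)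
        - 2 * κ⁻¹ * (c t x - d t x) ^ 2 * divergence v (t, x)
        - 2 * κ⁻¹ ^ 2 * (c t x - d t x) * stDeriv d (t, x) (0, u t x - v t x)
        - 2 * κ⁻¹ * (c t x - d t x) * stDeriv d (t, x) (0, u t x - v t x)
        + 2 * κ⁻¹ * (c t x - d t x) * stDeriv c (t, x) (0, u t x - v t x)
        - 2 * inner ℝ (stDeriv v (t, x) (0, u t x - v t x)) (u t x - v t x) := by
  have hv0 : velocityGap c u v t x = u t x - v t x := by simp [velocityGap, hc]
  have t1 : κ⁻¹ * stDeriv c (t, x) (1, u t x) = -(c t x * divergence u (t, x)) := by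
    rw [h.transport t ht x]; field_simp
  have t2 : κ⁻¹ * stDeriv d (t, x) (1, v t x) = -(d t x * divergence v (t, x)) := by
    rw [h'.transport t ht x]; field_simp
  have a1 := h.accel t ht x hc (u t x - v t x)
  have a2 := h'.accel t ht x hd (u t x - v t x)
  have su : ∀ i, stDeriv u (t, x) (1, u t x) i = stDeriv u (t, x) (1, 0) i +
      ∑ j, u t x j * stDeriv u (t, x) (0, EuclideanSpace.single j 1) i := fun i =>
    fderiv_split ((EuclideanSpace.proj i : Plane →L[ℝ] ℝ).comp (stDeriv u (t, x))) (u t x)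
  have sv : ∀ i, stDeriv v (t, x) (1, v t x) i = stDeriv v (t, x) (1, 0) i +
      ∑ j, v t x j * stDeriv v (t, x) (0, EuclideanSpace.single j 1) i := fun i =>
    fderiv_split ((EuclideanSpace.proj i : Plane →L[ℝ] ℝ).comp (stDeriv v (t, x))) (v t x)
  have sv' : ∀ i, stDeriv v (t, x) (0, u t x - v t x) i =
      ∑ j, (u t x - v t x) j * stDeriv v (t, x) (0, EuclideanSpace.single j 1) i := fun i =>
    fderiv_split_zero ((EuclideanSpace.proj i : Plane →L[ℝ] ℝ).comp (stDeriv v (t, x))) (u t x - v t x)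
  rw [fderiv_split] at t1 t2
  simp only [inner_plane, su, sv, sv', fderiv_split_zero _ (u t x - v t x),
    Fin.sum_univ_two, divergence, PiLp.sub_apply] at t1 t2 a1 a2 ⊢
  simp only [energyDeriv_apply, fluxDeriv_apply, hv0, inner_plane, PiLp.sub_apply]
  -- The system is symmetric in `(κ⁻¹ c, u)`: the two transport equations are subtracted and tested
  -- with `2 κ⁻¹ (c - d)`, the two velocity equations with `2 (u - v)`.
  linear_combination 2 * κ⁻¹ * (c t x - d t x) * (t1 - t2) + 2 * (a1 - a2)

open Asymptotics

/-- Big-O along the principal filter of a slab is a bound uniform on the slab, so the calculus of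
`IsBigO` combines such bounds without naming constants. -/
lemma IsRegular.isBigO_one {V : Type*} [NormedAddCommGroup V] [NormedSpace ℝ V]
    {f : ℝ → Plane → V} (h : IsRegular T f) (hb : b < T) :
    (fun z : ℝ × Plane => f z.1 z.2) =O[𝓟 (Ioc 0 b ×ˢ univ)] (fun _ => (1 : ℝ)) := by
  obtain ⟨C, hC⟩ := h.bound b hb
  refine isBigO_principal.2 ⟨C, fun z hz => ?_⟩
  simpa using hC z.1 (Ioc_subset_Icc_self hz.1) z.2

lemma IsRegular.isBigO_stDeriv {V : Type*} [NormedAddCommGroup V] [NormedSpace ℝ V]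
    {f : ℝ → Plane → V} (h : IsRegular T f) (hb : b < T) {w : ℝ × Plane → ℝ × Plane}
    {g : ℝ × Plane → ℝ} {S : Set (ℝ × Plane)} (hS : S ⊆ Ioc 0 b ×ˢ univ) (hw : w =O[𝓟 S] g) :
    (fun z : ℝ × Plane => stDeriv f z (w z)) =O[𝓟 S] g := by
  obtain ⟨C, hC⟩ := h.bound_fderiv b hb
  refine IsBigO.trans (isBigO_principal.2 ⟨C, fun z hz => ?_⟩) hw
  exact ((stDeriv f z).le_opNorm _).trans
    (mul_le_mul_of_nonneg_right (hC z.1 (hS hz).1 z.2) (norm_nonneg _))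

lemma isBigO_coord {α : Type*} {l : Filter α} {f : α → Plane} {g : α → ℝ} (h : f =O[l] g)
    (j : Fin 2) : (fun z => f z j) =O[l] g :=
  (IsBigO.of_bound 1 (Eventually.of_forall fun z => by
    rw [one_mul]; exact PiLp.norm_apply_le _ j)).trans h

lemma isBigO_snd {α : Type*} {l : Filter α} {f : α → Plane} {g : α → ℝ} (h : f =O[l] g) :
    (fun z => ((0 : ℝ), f z)) =O[l] g :=
  (IsBigO.of_bound 1 (Eventually.of_forall fun z => by simp [Prod.norm_def])).trans h

lemma isBigO_const_vec {α V : Type*} [NormedAddCommGroup V] {l : Filter α} (w : V) :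
    (fun _ : α => w) =O[l] (fun _ => (1 : ℝ)) :=
  isBigO_const_const w one_ne_zero l

lemma IsBigO.mul_one' {α : Type*} {l : Filter α} {f g s : α → ℝ} (hf : f =O[l] s)
    (hg : g =O[l] fun _ => (1 : ℝ)) : (fun z => f z * g z) =O[l] s := by
  simpa using hf.mul hg

lemma IsRegular.isBigO_divergence (h : IsRegular T u) (hb : b < T) :
    (divergence u) =O[𝓟 (Ioc 0 b ×ˢ univ)] (fun _ => (1 : ℝ)) :=
  ((isBigO_coord (h.isBigO_stDeriv hb Subset.rfl (isBigO_const_vec _)) 0).add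
    (isBigO_coord (h.isBigO_stDeriv hb Subset.rfl (isBigO_const_vec _)) 1)).congr_left
      fun z => by rw [divergence, Fin.sum_univ_two]

lemma isBigO_inner {α : Type*} {l : Filter α} {f g : α → Plane} {r s : α → ℝ} (hf : f =O[l] r)
    (hg : g =O[l] s) : (fun z => inner ℝ (f z) (g z)) =O[l] fun z => r z * s z :=
  (IsBigO.of_bound 1 (Eventually.of_forall fun z => by
    rw [one_mul]
    exact (norm_inner_le_norm _ _).trans (le_of_eq (by simp)))).trans
    (hf.norm_left.mul hg.norm_left)

lemma velocityGap_isBigO_one (h : IsRegular T u) (h' : IsRegular T v) (hb : b < T) :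
    (fun z : ℝ × Plane => velocityGap c u v z.1 z.2) =O[𝓟 (Ioc 0 b ×ˢ univ)]
      (fun _ => (1 : ℝ)) := by
  refine (IsBigO.of_bound 1 (Eventually.of_forall fun z => ?_)).trans
    ((h.isBigO_one hb).sub (h'.isBigO_one hb))
  unfold velocityGap
  split_ifs
  · simp
  · simp

lemma IsClassical.isBigO_energyDeriv (h : IsClassical κ T c u) (h' : IsClassical κ T d v)
    (hb : b < T) (w : ℝ × Plane) :
    (fun z => energyDeriv κ c d u v z w) =O[𝓟 (Ioc 0 b ×ˢ univ)] (fun _ => (1 : ℝ)) := by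
  simp only [energyDeriv_apply]
  have hcw := h.regc.isBigO_stDeriv hb Subset.rfl (isBigO_const_vec w)
  have hdw := h'.regc.isBigO_stDeriv hb Subset.rfl (isBigO_const_vec w)
  have huw := h.regu.isBigO_stDeriv hb Subset.rfl (isBigO_const_vec w)
  have hvw := h'.regu.isBigO_stDeriv hb Subset.rfl (isBigO_const_vec w)
  refine IsBigO.add ?_ ?_
  · exact IsBigO.mul_one' (((h.regc.isBigO_one hb).sub (h'.regc.isBigO_one hb)).const_mul_left _)
      (hcw.sub hdw)
  · refine IsBigO.const_mul_left ?_ _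
    simpa using isBigO_inner (velocityGap_isBigO_one h.regu h'.regu hb) (huw.sub hvw)

lemma IsClassical.isBigO_energyGap (h : IsClassical κ T c u) (h' : IsClassical κ T d v)
    (hb : b < T) :
    (fun z : ℝ × Plane => energyGap κ c d u v z.1 z.2) =O[𝓟 (Ioc 0 b ×ˢ univ)]
      (fun _ => (1 : ℝ)) := by
  simp only [energyGap]
  have h1 := (h.regc.isBigO_one hb).sub (h'.regc.isBigO_one hb)
  refine IsBigO.add (IsBigO.const_mul_left (by simpa using h1.pow 2) _) ?_
  simpa using (velocityGap_isBigO_one (c := c) h.regu h'.regu hb).norm_left.pow 2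

lemma IsClassical.isBigO_fluxDeriv (h : IsClassical κ T c u) (h' : IsClassical κ T d v)
    (hb : b < T) (j : Fin 2) (w : ℝ × Plane) :
    (fun z => fluxDeriv κ c d u v j z w) =O[𝓟 (Ioc 0 b ×ˢ univ)] (fun _ => (1 : ℝ)) := by
  simp only [fluxDeriv_apply]
  have hcw := h.regc.isBigO_stDeriv hb Subset.rfl (isBigO_const_vec w)
  have hdw := h'.regc.isBigO_stDeriv hb Subset.rfl (isBigO_const_vec w)
  have huw := h.regu.isBigO_stDeriv hb Subset.rfl (isBigO_const_vec w)
  have hvw := h'.regu.isBigO_stDeriv hb Subset.rfl (isBigO_const_vec w)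
  have hc := h.regc.isBigO_one hb
  have hcd := hc.sub (h'.regc.isBigO_one hb)
  have huj := isBigO_coord (h.regu.isBigO_one hb) j
  have hvj := isBigO_coord (h'.regu.isBigO_one hb) j
  refine IsBigO.add (IsBigO.add ?_ ?_) (IsBigO.const_mul_left (IsBigO.add ?_ ?_) _)
  · exact IsBigO.mul_one' (h.isBigO_energyGap h' hb) (isBigO_coord huw j)
  · exact IsBigO.mul_one' huj (h.isBigO_energyDeriv h' hb w)
  · exact IsBigO.mul_one' (IsBigO.mul_one' hc hcd) (isBigO_coord (huw.sub hvw) j)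
  · exact IsBigO.mul_one' (huj.sub hvj)
      ((IsBigO.mul_one' hc (hcw.sub hdw)).add (IsBigO.mul_one' hcd hcw))

/-- Each difference counts as the square root of the energy, so expressions quadratic in the
differences are bounded by the energy. -/
lemma isBigO_sqrt_energyGap (hκ : κ ≠ 0) {l : Filter (ℝ × Plane)} :
    (fun z : ℝ × Plane => c z.1 z.2 - d z.1 z.2) =O[l]
        (fun z => Real.sqrt (energyGap κ c d u v z.1 z.2)) ∧
      (fun z : ℝ × Plane => velocityGap c u v z.1 z.2) =O[l]
        (fun z => Real.sqrt (energyGap κ c d u v z.1 z.2)) := by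
  constructor
  · refine IsBigO.of_bound |κ| (Eventually.of_forall fun z => ?_)
    rw [Real.norm_of_nonneg (Real.sqrt_nonneg _), Real.norm_eq_abs]
    have h1 : |κ⁻¹ * (c z.1 z.2 - d z.1 z.2)| ≤ Real.sqrt (energyGap κ c d u v z.1 z.2) := by
      refine Real.abs_le_sqrt ?_
      rw [mul_pow, energyGap]
      exact le_add_of_nonneg_right (by positivity)
    calc |c z.1 z.2 - d z.1 z.2| = |κ| * |κ⁻¹ * (c z.1 z.2 - d z.1 z.2)| := by
          rw [← abs_mul, mul_inv_cancel_left₀ hκ]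
      _ ≤ _ := by gcongr
  · refine IsBigO.of_bound 1 (Eventually.of_forall fun z => ?_)
    rw [Real.norm_of_nonneg (Real.sqrt_nonneg _), one_mul]
    refine Real.le_sqrt_of_sq_le ?_
    rw [energyGap]
    exact le_add_of_nonneg_left (by positivity)

lemma IsClassical.zero_iff (h : IsClassical κ T c u) (h' : IsClassical κ T d v)
    (hc0 : c 0 = d 0) (hu0 : u 0 = v 0) {t : ℝ} (ht : t ∈ Ico 0 T) {x : Plane}
    (hc : ¬ 0 < c t x) : c t x = 0 ∧ d t x = 0 :=
  ⟨le_antisymm (not_lt.1 hc) (h.nonneg t ht x), le_antisymm (not_lt.1 fun hp =>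
    hc (h'.pos_of_pos h hc0.symm hu0.symm ht hp)) (h'.nonneg t ht x)⟩

lemma IsClassical.isBigO_energyFlux (hκ : κ ≠ 0) (h : IsClassical κ T c u)
    (h' : IsClassical κ T d v) (hc0 : c 0 = d 0) (hu0 : u 0 = v 0) (hb : b < T) (j : Fin 2) :
    (fun z : ℝ × Plane => energyFlux κ c d u v j z.1 z.2) =O[𝓟 (Ioc 0 b ×ˢ univ)]
      (fun z => energyGap κ c d u v z.1 z.2) := by
  obtain ⟨h1, h2⟩ := isBigO_sqrt_energyGap (c := c) (d := d) (u := u) (v := v) hκ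
    (l := 𝓟 (Ioc 0 b ×ˢ univ))
  have h3 : (fun z : ℝ × Plane => energyGap κ c d u v z.1 z.2 * u z.1 z.2 j + 2 * κ⁻¹ *
      (c z.1 z.2 * ((c z.1 z.2 - d z.1 z.2) * velocityGap c u v z.1 z.2 j)))
      =O[𝓟 (Ioc 0 b ×ˢ univ)] (fun z => energyGap κ c d u v z.1 z.2) := by
    refine IsBigO.add (IsBigO.mul_one' (isBigO_refl _ _)
      (isBigO_coord (h.regu.isBigO_one hb) j)) (IsBigO.const_mul_left ?_ _)
    have h4 := (h.regc.isBigO_one hb).mul (h1.mul (isBigO_coord h2 j))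
    refine h4.congr_right fun z => ?_
    rw [one_mul, Real.mul_self_sqrt (energyGap_nonneg _ _)]
  refine h3.congr' (eventually_principal.2 fun z hz => ?_) EventuallyEq.rfl
  unfold energyFlux velocityGap
  beta_reduce
  split_ifs with hc
  · rw [PiLp.sub_apply, mul_assoc (c z.1 z.2)]
  -- Outside the gas `u - v` is not controlled, but its factor `c` is zero.
  · rw [(h.zero_iff h' hc0 hu0 ⟨hz.1.1.le, hz.1.2.trans_lt hb⟩ hc).1]
    simp

/-- Each term of the remainder in `energy_identity` is quadratic in the differences with bounded
coefficients. Outside the gas both sound speeds and the cut-off gap are zero, so both sides vanish.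
-/
lemma IsClassical.isBigO_energy_balance (hκ : κ ≠ 0) (h : IsClassical κ T c u)
    (h' : IsClassical κ T d v) (hc0 : c 0 = d 0) (hu0 : u 0 = v 0) (hb : b < T) :
    (fun z : ℝ × Plane => energyDeriv κ c d u v z (1, 0) +
        ∑ j, fluxDeriv κ c d u v j z (0, EuclideanSpace.single j 1)) =O[𝓟 (Ioc 0 b ×ˢ univ)]
      (fun z => energyGap κ c d u v z.1 z.2) := by
  obtain ⟨h1, h2⟩ := isBigO_sqrt_energyGap (c := c) (d := d) (u := u) (v := v) hκ
    (l := 𝓟 (Ioc 0 b ×ˢ univ))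
  have hsq : ∀ z : ℝ × Plane, Real.sqrt (energyGap κ c d u v z.1 z.2) *
      Real.sqrt (energyGap κ c d u v z.1 z.2) = energyGap κ c d u v z.1 z.2 := fun z =>
    Real.mul_self_sqrt (energyGap_nonneg _ _)
  have hD := h'.regc.isBigO_stDeriv hb Subset.rfl (isBigO_snd h2)
  have hC := h.regc.isBigO_stDeriv hb Subset.rfl (isBigO_snd h2)
  have hV := h'.regu.isBigO_stDeriv hb Subset.rfl (isBigO_snd h2)
  have key : (fun z : ℝ × Plane => energyGap κ c d u v z.1 z.2 * divergence u z
        - 2 * κ⁻¹ * ((c z.1 z.2 - d z.1 z.2) ^ 2 * divergence v z)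
        - 2 * κ⁻¹ ^ 2 * ((c z.1 z.2 - d z.1 z.2) * stDeriv d z (0, velocityGap c u v z.1 z.2))
        - 2 * κ⁻¹ * ((c z.1 z.2 - d z.1 z.2) * stDeriv d z (0, velocityGap c u v z.1 z.2))
        + 2 * κ⁻¹ * ((c z.1 z.2 - d z.1 z.2) * stDeriv c z (0, velocityGap c u v z.1 z.2))
        - 2 * inner ℝ (stDeriv v z (0, velocityGap c u v z.1 z.2)) (velocityGap c u v z.1 z.2))
      =O[𝓟 (Ioc 0 b ×ˢ univ)] (fun z => energyGap κ c d u v z.1 z.2) := by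
    refine IsBigO.sub (IsBigO.add (IsBigO.sub (IsBigO.sub (IsBigO.sub ?_ ?_) ?_) ?_) ?_) ?_
    · exact IsBigO.mul_one' (isBigO_refl _ _) (h.regu.isBigO_divergence hb)
    · refine IsBigO.const_mul_left (IsBigO.mul_one' ?_ (h'.regu.isBigO_divergence hb)) _
      refine (h1.pow 2).congr_right fun z => by rw [sq, hsq]
    · exact IsBigO.const_mul_left ((h1.mul hD).congr_right hsq) _
    · exact IsBigO.const_mul_left ((h1.mul hD).congr_right hsq) _
    · exact IsBigO.const_mul_left ((h1.mul hC).congr_right hsq) _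
    · exact IsBigO.const_mul_left ((isBigO_inner hV h2).congr_right hsq) _
  refine key.congr' (eventually_principal.2 ?_) EventuallyEq.rfl
  rintro ⟨t, x⟩ ⟨ht, -⟩
  have ht' : t ∈ Ioo 0 T := ⟨ht.1, ht.2.trans_lt hb⟩
  by_cases hc : 0 < c t x
  · have hd := h.pos_of_pos h' hc0 hu0 (Ioo_subset_Ico_self ht') hc
    have hv0 : velocityGap c u v t x = u t x - v t x := by simp [velocityGap, hc]
    beta_reduce
    rw [h.energy_identity hκ h' ht' hc hd]
    simp only [hv0]
    ring
  · obtain ⟨e1, e2⟩ := h.zero_iff h' hc0 hu0 (Ioo_subset_Ico_self ht') hc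
    have hv0 : velocityGap c u v t x = 0 := by simp [velocityGap, hc]
    simp [energyDeriv_apply, fluxDeriv_apply, energyGap, e1, e2, hv0]

/-- An integrable weight whose gradient it dominates. -/
def weight (x : Plane) : ℝ := ((1 + ‖x‖ ^ 2) ^ 2)⁻¹

lemma weight_pos (x : Plane) : 0 < weight x := by unfold weight; positivity

lemma integrable_weight : Integrable weight := by
  have := integrable_rpow_neg_one_add_norm_sq (E := Plane) (μ := volume) (r := 4)
    (by simp; norm_num)
  refine this.congr (Eventually.of_forall fun x => ?_)
  simp only [weight]
  rw [show (-4 / 2 : ℝ) = -((2 : ℕ) : ℝ) by norm_num, Real.rpow_neg (by positivity),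
    Real.rpow_natCast]

lemma hasFDerivAt_weight (x : Plane) : HasFDerivAt weight
    (-(4 * (1 + ‖x‖ ^ 2) * weight x ^ 2) • innerSL ℝ x) x := by
  have h1 : HasFDerivAt (fun x : Plane => ‖x‖ ^ 2) ((2 : ℝ) • innerSL ℝ x) x :=
    (hasStrictFDerivAt_norm_sq x).hasFDerivAt.congr_fderiv
      ((two_nsmul _).trans (two_smul ℝ _).symm)
  have h2 := (hasDerivAt_inv (by positivity : (1 + ‖x‖ ^ 2) ^ 2 ≠ 0)).comp_hasFDerivAt x
    ((h1.const_add 1).pow 2)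
  refine h2.congr_fderiv ?_
  ext w
  simp [weight]
  ring

lemma abs_fderiv_weight_le (x w : Plane) : |fderiv ℝ weight x w| ≤ 4 * weight x * ‖w‖ := by
  rw [(hasFDerivAt_weight x).fderiv]
  simp only [smul_apply, innerSL_apply_apply, smul_eq_mul]
  have h1 : |inner ℝ x w| ≤ (1 + ‖x‖ ^ 2) * ‖w‖ := by
    refine (abs_real_inner_le_norm x w).trans ?_
    gcongr
    nlinarith [sq_nonneg (‖x‖ - 1), norm_nonneg x]
  have h2 : (1 + ‖x‖ ^ 2) * (1 + ‖x‖ ^ 2) * weight x = 1 := by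
    unfold weight; field_simp
  rw [abs_mul, abs_neg, abs_of_nonneg (by positivity)]
  calc 4 * (1 + ‖x‖ ^ 2) * weight x ^ 2 * |inner ℝ x w|
      ≤ 4 * (1 + ‖x‖ ^ 2) * weight x ^ 2 * ((1 + ‖x‖ ^ 2) * ‖w‖) := by gcongr
    _ = 4 * weight x * ‖w‖ * ((1 + ‖x‖ ^ 2) * (1 + ‖x‖ ^ 2) * weight x) := by ring
    _ = _ := by rw [h2, mul_one]

lemma continuous_weight : Continuous weight := by
  unfold weight
  exact Continuous.inv₀ (by fun_prop) fun x => by positivity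

lemma measurable_stDeriv_slice {f : ℝ → Plane → ℝ} (t : ℝ) (w : ℝ × Plane) :
    Measurable fun x => stDeriv f (t, x) w :=
  (measurable_fderiv_apply_const ℝ (fun z : ℝ × Plane => f z.1 z.2) w).comp measurable_prodMk_left

lemma integrable_weight_mul {f : Plane → ℝ} (hf : AEStronglyMeasurable f volume) {C : ℝ}
    (hC : ∀ x, |f x| ≤ C) : Integrable fun x => weight x * f x := by
  refine (integrable_weight.mul_const C).mono' (continuous_weight.aestronglyMeasurable.mul hf)
    (Eventually.of_forall fun x => ?_)
  rw [norm_mul, Real.norm_of_nonneg (weight_pos x).le]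
  exact mul_le_mul_of_nonneg_left (hC x) (weight_pos x).le

section Gronwall

lemma IsClassical.continuous_energyGap (h : IsClassical κ T c u) (h' : IsClassical κ T d v)
    (hc0 : c 0 = d 0) (hu0 : u 0 = v 0) {t : ℝ} (ht : t ∈ Ioo 0 T) :
    Continuous (energyGap κ c d u v t) := by
  refine continuous_iff_continuousAt.2 fun x => ?_
  exact ContinuousAt.comp (f := fun x : Plane => ((t, x) : ℝ × Plane))
    (h.hasFDerivAt_energyGap h' hc0 hu0 ht x).continuousAt (by fun_prop)

lemma energyGap_zero (hc0 : c 0 = d 0) (hu0 : u 0 = v 0) (x : Plane) :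
    energyGap κ c d u v 0 x = 0 := by
  simp [energyGap, velocityGap, hc0, hu0]

lemma IsClassical.tendsto_energyGap_zero (h : IsClassical κ T c u) (h' : IsClassical κ T d v)
    (hc0 : c 0 = d 0) (hu0 : u 0 = v 0) (hT : 0 < T) (x : Plane) :
    Tendsto (fun t => energyGap κ c d u v t x) (𝓝[Ico 0 T] 0) (𝓝 0) := by
  have h0 : (0 : ℝ) ∈ Ico 0 T := ⟨le_rfl, hT⟩
  have h1 := ((h.regc.continuousOn_time x) 0 h0).sub ((h'.regc.continuousOn_time x) 0 h0)
  have h2 := ((h.regu.continuousOn_time x) 0 h0).sub ((h'.regu.continuousOn_time x) 0 h0)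
  have h3 : Tendsto (fun t => κ⁻¹ ^ 2 * (c t x - d t x) ^ 2 + ‖u t x - v t x‖ ^ 2)
      (𝓝[Ico 0 T] 0) (𝓝 0) := by
    have := ((h1.pow 2).const_mul (κ⁻¹ ^ 2)).add (h2.norm.pow 2)
    have e : κ⁻¹ ^ 2 * (c 0 x - d 0 x) ^ 2 + ‖u 0 x - v 0 x‖ ^ 2 = 0 := by simp [hc0, hu0]
    exact (congrArg 𝓝 e) ▸ this
  refine squeeze_zero (fun t => energyGap_nonneg t x) (fun t => ?_) h3
  unfold energyGap velocityGap
  gcongr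
  split_ifs
  · exact le_rfl
  · simp

/-- Integration by parts without boundary terms: flux and flux derivative are bounded on the slice,
and the weight and its gradient are integrable. -/
lemma IsClassical.integral_fluxDeriv (hκ : κ ≠ 0) (h : IsClassical κ T c u)
    (h' : IsClassical κ T d v) (hc0 : c 0 = d 0) (hu0 : u 0 = v 0) {t : ℝ} (ht : t ∈ Ioo 0 T)
    (j : Fin 2) :
    Integrable (fun x => weight x * fluxDeriv κ c d u v j (t, x) (0, EuclideanSpace.single j 1)) ∧
    Integrable (fun x => energyFlux κ c d u v j t x *
        fderiv ℝ weight x (EuclideanSpace.single j 1)) ∧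
    ∫ x, weight x * fluxDeriv κ c d u v j (t, x) (0, EuclideanSpace.single j 1) =
      - ∫ x, energyFlux κ c d u v j t x * fderiv ℝ weight x (EuclideanSpace.single j 1) := by
  obtain ⟨b, htb, hb⟩ := exists_between ht.2
  have hmem : ∀ x : Plane, ((t, x) : ℝ × Plane) ∈ Ioc 0 b ×ˢ (univ : Set Plane) := fun x =>
    ⟨⟨ht.1, htb.le⟩, mem_univ _⟩
  obtain ⟨C1, hC1⟩ := isBigO_principal.1 (h.isBigO_fluxDeriv h' hb j
    (0, EuclideanSpace.single j (1 : ℝ)))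
  obtain ⟨C2, hC2⟩ := isBigO_principal.1 ((h.isBigO_energyFlux hκ h' hc0 hu0 hb j).trans
    (h.isBigO_energyGap h' hb))
  have hd : ∀ x, HasFDerivAt (energyFlux κ c d u v j t)
      ((fluxDeriv κ c d u v j (t, x)).comp (ContinuousLinearMap.inr ℝ ℝ Plane)) x := fun x =>
    (h.hasFDerivAt_energyFlux h' hc0 hu0 ht x j).comp x (hasFDerivAt_prodMk_right t x)
  have hfd : ∀ x, fluxDeriv κ c d u v j (t, x) (0, EuclideanSpace.single j 1) =
      fderiv ℝ (energyFlux κ c d u v j t) x (EuclideanSpace.single j 1) := fun x => by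
    rw [(hd x).fderiv]; rfl
  have hFc : Continuous (energyFlux κ c d u v j t) :=
    continuous_iff_continuousAt.2 fun x => (hd x).continuousAt
  have i1 : Integrable (fun x => weight x * fderiv ℝ (energyFlux κ c d u v j t) x
      (EuclideanSpace.single j 1)) := by
    refine integrable_weight_mul (C := C1)
      (measurable_fderiv_apply_const ℝ _ _).aestronglyMeasurable fun x => ?_
    rw [← hfd]
    simpa using hC1 _ (hmem x)
  have i2 : Integrable (fun x => weight x * energyFlux κ c d u v j t x) :=
    integrable_weight_mul (C := C2) hFc.aestronglyMeasurable fun x => by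
      simpa using hC2 _ (hmem x)
  have i3 : Integrable (fun x => energyFlux κ c d u v j t x *
      fderiv ℝ weight x (EuclideanSpace.single j 1)) := by
    refine (i2.norm.const_mul 4).mono' (hFc.aestronglyMeasurable.mul
      (measurable_fderiv_apply_const ℝ _ _).aestronglyMeasurable) (Eventually.of_forall fun x => ?_)
    rw [norm_mul, norm_mul, Real.norm_of_nonneg (weight_pos x).le, Real.norm_eq_abs (fderiv _ _ _ _)]
    have := abs_fderiv_weight_le x (EuclideanSpace.single j 1)
    rw [PiLp.norm_single, norm_one, mul_one] at this
    calc _ ≤ ‖energyFlux κ c d u v j t x‖ * (4 * weight x) := by gcongr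
      _ = _ := by ring
  refine ⟨by simpa only [hfd] using i1, i3, ?_⟩
  simp only [hfd]
  have := integral_mul_fderiv_eq_neg_fderiv_mul_of_integrable (μ := volume) (f := weight)
    (g := energyFlux κ c d u v j t) (v := EuclideanSpace.single j (1 : ℝ))
    (by simpa only [mul_comm] using i3) i1 i2
    (fun x _ => (hasFDerivAt_weight x).differentiableAt) (fun x _ => (hd x).differentiableAt)
  rw [this]
  simp only [mul_comm]

/-- Two classical solutions with the same initial state agree in the gas. -/
theorem IsClassical.energyGap_eq_zero (hκ : κ ≠ 0) (h : IsClassical κ T c u)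
    (h' : IsClassical κ T d v) (hc0 : c 0 = d 0) (hu0 : u 0 = v 0) {t : ℝ} (ht : t ∈ Ioo 0 T)
    (x : Plane) : energyGap κ c d u v t x = 0 := by
  obtain ⟨b, htb, hb⟩ := exists_between ht.2
  have hb0 : 0 < b := ht.1.trans htb
  have hmem : ∀ s ∈ Ioc 0 b, ∀ x : Plane, ((s, x) : ℝ × Plane) ∈ Ioc 0 b ×ˢ (univ : Set Plane) :=
    fun s hs x => ⟨hs, mem_univ _⟩
  have hT : ∀ s ∈ Ioc 0 b, s ∈ Ioo 0 T := fun s hs => ⟨hs.1, hs.2.trans_lt hb⟩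
  obtain ⟨C1, hC1⟩ := isBigO_principal.1 (h.isBigO_energyDeriv h' hb (1, 0))
  obtain ⟨C2, hC2⟩ := isBigO_principal.1 (h.isBigO_energyGap h' hb)
  choose C3 hC3 using fun j => isBigO_principal.1 (h.isBigO_energyFlux hκ h' hc0 hu0 hb j)
  obtain ⟨C4, hC4⟩ := isBigO_principal.1 (h.isBigO_energy_balance hκ h' hc0 hu0 hb)
  have hC2' : ∀ s ∈ Icc 0 b, ∀ x, |energyGap κ c d u v s x| ≤ max C2 0 := by
    intro s hs x
    rcases hs.1.eq_or_lt with h0 | h0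
    · rw [← h0, energyGap_zero hc0 hu0]; simp
    · exact le_max_of_le_left (by simpa using hC2 _ (hmem s ⟨h0, hs.2⟩ x))
  have hmeas : ∀ s ∈ Icc 0 b, AEStronglyMeasurable (energyGap κ c d u v s) volume := by
    intro s hs
    rcases hs.1.eq_or_lt with h0 | h0
    · rw [← h0, show energyGap κ c d u v 0 = fun _ => 0 from funext (energyGap_zero hc0 hu0)]
      exact aestronglyMeasurable_const
    · exact (h.continuous_energyGap h' hc0 hu0 (hT s ⟨h0, hs.2⟩)).aestronglyMeasurable
  have hint : ∀ s ∈ Icc 0 b, Integrable fun x => weight x * energyGap κ c d u v s x :=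
    fun s hs => integrable_weight_mul (hmeas s hs) (hC2' s hs)
  set I : ℝ → ℝ := fun s => ∫ x, weight x * energyGap κ c d u v s x with hI
  have hI0 : I 0 = 0 := by simp [hI, energyGap_zero hc0 hu0]
  have hdt : ∀ s ∈ Ioo 0 T, ∀ x, HasDerivAt (fun s => weight x * energyGap κ c d u v s x)
      (weight x * energyDeriv κ c d u v (s, x) (1, 0)) s := fun s hs x =>
    (HasFDerivAt.comp_hasDerivAt (f := fun s : ℝ => ((s, x) : ℝ × Plane)) s
      (h.hasFDerivAt_energyGap h' hc0 hu0 hs x)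
      ((hasDerivAt_id s).prodMk (hasDerivAt_const s x))).const_mul _
  have hder : ∀ s ∈ Ioo 0 b, HasDerivAt I
      (∫ x, weight x * energyDeriv κ c d u v (s, x) (1, 0)) s := by
    intro s hs
    -- The energy derivative is bounded uniformly on the slab, so the weight times a constant
    -- dominates.
    refine (hasDerivAt_integral_of_dominated_loc_of_deriv_le (μ := volume) (s := Ioo 0 b)
      (F := fun s x => weight x * energyGap κ c d u v s x)
      (F' := fun s x => weight x * energyDeriv κ c d u v (s, x) (1, 0))
      (bound := fun x => weight x * C1) (Ioo_mem_nhds hs.1 hs.2) ?_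
      (hint s (Ioo_subset_Icc_self hs)) ?_ ?_ (integrable_weight.mul_const _) ?_).2
    · filter_upwards [Ioo_mem_nhds hs.1 hs.2] with r hr
      exact (hint r (Ioo_subset_Icc_self hr)).aestronglyMeasurable
    · refine continuous_weight.aestronglyMeasurable.mul ?_
      have : (fun x => energyDeriv κ c d u v (s, x) (1, 0)) =
          fun x => stDeriv (energyGap κ c d u v) (s, x) (1, 0) := funext fun x => by
        rw [stDeriv, (h.hasFDerivAt_energyGap h' hc0 hu0 (hT s (Ioo_subset_Ioc_self hs)) x).fderiv]
      rw [this]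
      exact (measurable_stDeriv_slice s (1, 0)).aestronglyMeasurable
    · refine Eventually.of_forall fun x r hr => ?_
      rw [norm_mul, Real.norm_of_nonneg (weight_pos x).le]
      refine mul_le_mul_of_nonneg_left ?_ (weight_pos x).le
      simpa using hC1 _ (hmem r (Ioo_subset_Ioc_self hr) x)
    · exact Eventually.of_forall fun x r hr => hdt r (hT r (Ioo_subset_Ioc_self hr)) x
  have hcont : ContinuousOn I (Icc 0 b) := by
    refine continuousOn_of_dominated (bound := fun x => weight x * max C2 0)
      (fun s hs => (hint s hs).aestronglyMeasurable) (fun s hs => Eventually.of_forall fun x => ?_)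
      (integrable_weight.mul_const _) (Eventually.of_forall fun x => ?_)
    · rw [norm_mul, Real.norm_of_nonneg (weight_pos x).le]
      exact mul_le_mul_of_nonneg_left (hC2' s hs x) (weight_pos x).le
    · intro s hs
      rcases hs.1.eq_or_lt with h0 | h0
      -- At time `0` the differentiability of the energy is not available; continuity follows
      -- because the energy without cut-off dominates it and tends to `0`.
      · subst h0
        refine ContinuousWithinAt.mono ?_ (t := Ico 0 T) fun r hr => ⟨hr.1, hr.2.trans_lt hb⟩
        refine continuousWithinAt_const.mul ?_
        rw [ContinuousWithinAt, energyGap_zero hc0 hu0]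
        exact h.tendsto_energyGap_zero h' hc0 hu0 (ht.1.trans ht.2) x
      · exact (hdt s (hT s ⟨h0, hs.2⟩) x).continuousAt.continuousWithinAt
  have hIn : ∀ s ∈ Icc 0 b, 0 ≤ I s := fun s _ =>
    integral_nonneg fun x => mul_nonneg (weight_pos x).le (energyGap_nonneg s x)
  have hbound : ∀ s ∈ Ioo 0 b, |∫ x, weight x * energyDeriv κ c d u v (s, x) (1, 0)| ≤
      (max (C4 + ∑ j, 4 * C3 j) 0) * I s := by
    intro s hs
    have hsT := hT s (Ioo_subset_Ioc_self hs)
    have hsm := hmem s (Ioo_subset_Ioc_self hs)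
    have hfl := fun j => h.integral_fluxDeriv hκ h' hc0 hu0 hsT j
    have hE : Integrable fun x => weight x * energyDeriv κ c d u v (s, x) (1, 0) := by
      refine integrable_weight_mul (C := C1) ?_ fun x => by simpa using hC1 _ (hsm x)
      have : (fun x => energyDeriv κ c d u v (s, x) (1, 0)) =
          fun x => stDeriv (energyGap κ c d u v) (s, x) (1, 0) := funext fun x => by
        rw [stDeriv, (h.hasFDerivAt_energyGap h' hc0 hu0 hsT x).fderiv]
      rw [this]
      exact (measurable_stDeriv_slice s (1, 0)).aestronglyMeasurable
    have hG := hint s (Ioo_subset_Icc_self hs)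
    -- The divergence of the flux is added and subtracted, and the subtracted one is moved onto the
    -- weight. Both resulting terms are bounded by multiples of `I s`.
    have e1 : ∫ x, weight x * energyDeriv κ c d u v (s, x) (1, 0) =
        (∫ x, weight x * (energyDeriv κ c d u v (s, x) (1, 0) +
          ∑ j, fluxDeriv κ c d u v j (s, x) (0, EuclideanSpace.single j 1))) +
        ∑ j, ∫ x, energyFlux κ c d u v j s x * fderiv ℝ weight x (EuclideanSpace.single j 1) := by
      simp only [mul_add, Finset.mul_sum]
      rw [integral_add hE (integrable_finsetSum _ fun j _ => (hfl j).1),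
        integral_finsetSum _ fun j _ => (hfl j).1, add_assoc, ← Finset.sum_add_distrib]
      simp [(hfl _).2.2]
    rw [e1]
    have b1 : |∫ x, weight x * (energyDeriv κ c d u v (s, x) (1, 0) +
          ∑ j, fluxDeriv κ c d u v j (s, x) (0, EuclideanSpace.single j 1))| ≤ C4 * I s := by
      rw [← Real.norm_eq_abs, hI, ← integral_const_mul]
      refine norm_integral_le_of_norm_le (hG.const_mul _) (Eventually.of_forall fun x => ?_)
      rw [norm_mul, Real.norm_of_nonneg (weight_pos x).le]
      have := hC4 _ (hsm x)
      simp only [Real.norm_of_nonneg (energyGap_nonneg s x)] at this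
      calc _ ≤ weight x * (C4 * energyGap κ c d u v s x) :=
            mul_le_mul_of_nonneg_left this (weight_pos x).le
        _ = _ := by ring
    have b2 : ∀ j, |∫ x, energyFlux κ c d u v j s x *
        fderiv ℝ weight x (EuclideanSpace.single j 1)| ≤ 4 * C3 j * I s := by
      intro j
      rw [← Real.norm_eq_abs, hI, ← integral_const_mul]
      refine norm_integral_le_of_norm_le (hG.const_mul _) (Eventually.of_forall fun x => ?_)
      have e2 := hC3 j _ (hsm x)
      simp only [Real.norm_of_nonneg (energyGap_nonneg s x)] at e2
      have e3 := abs_fderiv_weight_le x (EuclideanSpace.single j 1)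
      rw [PiLp.norm_single, norm_one, mul_one] at e3
      rw [norm_mul, Real.norm_eq_abs (fderiv _ _ _ _)]
      calc _ ≤ (C3 j * energyGap κ c d u v s x) * (4 * weight x) :=
            mul_le_mul e2 e3 (abs_nonneg _) ((norm_nonneg _).trans e2)
        _ = _ := by ring
    calc _ ≤ C4 * I s + ∑ j, 4 * C3 j * I s :=
          (abs_add_le _ _).trans (add_le_add b1 ((Finset.abs_sum_le_sum_abs _ _).trans
            (Finset.sum_le_sum fun j _ => b2 j)))
      _ = (C4 + ∑ j, 4 * C3 j) * I s := by rw [add_mul, Finset.sum_mul]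
      _ ≤ _ := mul_le_mul_of_nonneg_right (le_max_left _ _) (hIn s (Ioo_subset_Icc_self hs))
  have hIt : I t = 0 := by
    refine le_antisymm ?_ (hIn t ⟨ht.1.le, htb.le⟩)
    have := le_mul_exp_of_abs_deriv_le hcont hder hbound hIn (le_max_right _ _)
      ⟨le_rfl, hb0.le⟩ (⟨ht.1.le, htb.le⟩ : t ∈ Icc 0 b)
    rwa [hI0, zero_mul] at this
  have hz := (integral_eq_zero_iff_of_nonneg (fun x => mul_nonneg (weight_pos x).le
    (energyGap_nonneg t x)) (hint t ⟨ht.1.le, htb.le⟩)).1 hIt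
  have hz' := (Continuous.ae_eq_iff_eq volume
    (continuous_weight.mul (h.continuous_energyGap h' hc0 hu0 ht)) continuous_const).1 hz
  have := congrFun hz' x
  exact (mul_eq_zero.1 this).resolve_left (weight_pos x).ne'

end Gronwall

/-- Two classical solutions with the same initial state agree in the gas. -/
theorem IsClassical.velocity_eq (hκ : κ ≠ 0) (h : IsClassical κ T c u)
    (h' : IsClassical κ T d v) (hc0 : c 0 = d 0) (hu0 : u 0 = v 0) {t : ℝ} (ht : t ∈ Ico 0 T)
    {x : Plane} (hc : 0 < c t x) : u t x = v t x := by
  rcases ht.1.eq_or_lt with h0 | h0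
  · rw [← h0, hu0]
  · have h1 := h.energyGap_eq_zero hκ h' hc0 hu0 ⟨h0, ht.2⟩ x
    unfold energyGap at h1
    have h2 : ‖velocityGap c u v t x‖ ^ 2 = 0 :=
      le_antisymm (by nlinarith [mul_nonneg (sq_nonneg κ⁻¹) (sq_nonneg (c t x - d t x))])
        (by positivity)
    have h3 : velocityGap c u v t x = 0 := norm_eq_zero.1 (pow_eq_zero_iff two_ne_zero |>.1 h2)
    rw [velocityGap, if_pos hc] at h3
    exact sub_eq_zero.1 h3

end Energy

/-! ### Radial symmetry and persistence of the vacuum at the origin. -/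

section Symmetry

variable {κ T : ℝ} {c : ℝ → Plane → ℝ} {u : ℝ → Plane → Plane} (S : Plane ≃ₗᵢ[ℝ] Plane)

/-- A linear isometry of the plane acting on space-time. -/
def stMap : ℝ × Plane →L[ℝ] ℝ × Plane :=
  (ContinuousLinearMap.id ℝ ℝ).prodMap (S : Plane →L[ℝ] Plane)

lemma IsRegular.stDeriv_conj {V W : Type*} [NormedAddCommGroup V] [NormedSpace ℝ V]
    [NormedAddCommGroup W] [NormedSpace ℝ W] {f : ℝ → Plane → V} (h : IsRegular T f)
    (L : V →L[ℝ] W) {t : ℝ} (ht : t ∈ Ioo 0 T) (x : Plane) :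
    stDeriv (fun t x => L (f t (S x))) (t, x) = L.comp ((stDeriv f (t, S x)).comp (stMap S)) := by
  have h1 := (h.differentiableAt (z := stMap S (t, x)) ⟨ht, mem_univ _⟩).hasFDerivAt
  exact (L.hasFDerivAt.comp (t, x) (h1.comp (t, x) (stMap S).hasFDerivAt)).fderiv

lemma IsRegular.conj {V W : Type*} [NormedAddCommGroup V] [NormedSpace ℝ V]
    [NormedAddCommGroup W] [NormedSpace ℝ W] {f : ℝ → Plane → V} (h : IsRegular T f)
    (L : V →L[ℝ] W) : IsRegular T (fun t x => L (f t (S x))) := by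
  refine ⟨?_, ?_, fun b hb => ?_, fun b hb => ?_⟩
  · exact L.continuous.comp_continuousOn
      (h.cont.comp (stMap S).continuous.continuousOn fun z hz => ⟨hz.1, mem_univ _⟩)
  · exact L.contDiff.comp_contDiffOn
      (h.contDiff.comp (stMap S).contDiff.contDiffOn fun z hz => ⟨hz.1, mem_univ _⟩)
  · obtain ⟨C, hC⟩ := h.bound b hb
    exact ⟨‖L‖ * C, fun t ht x => (L.le_opNorm _).trans (by gcongr; exact hC t ht _)⟩
  · obtain ⟨C, hC⟩ := h.bound_fderiv b hb
    refine ⟨‖L‖ * (C * ‖stMap S‖), fun t ht x => ?_⟩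
    have e := h.stDeriv_conj S L (t := t) ⟨ht.1, ht.2.trans_lt hb⟩ x
    rw [stDeriv] at e
    rw [e]
    refine (ContinuousLinearMap.opNorm_comp_le _ _).trans ?_
    gcongr
    refine (ContinuousLinearMap.opNorm_comp_le _ _).trans ?_
    gcongr
    exact hC t ht _

/-- The divergence is a trace, which does not depend on the orthonormal basis. -/
lemma sum_conj_coord (M : Plane →L[ℝ] Plane) :
    ∑ j, (S.symm (M (S (EuclideanSpace.single j 1)))) j = ∑ j, M (EuclideanSpace.single j 1) j := by
  have h1 : ∀ (v : Plane) (j : Fin 2), v j = inner ℝ (EuclideanSpace.single j (1 : ℝ)) v := by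
    intro v j; simp [EuclideanSpace.inner_single_left]
  have h2 := LinearMap.trace_eq_sum_inner (M : Plane →ₗ[ℝ] Plane)
    (EuclideanSpace.basisFun (Fin 2) ℝ)
  have h3 := LinearMap.trace_eq_sum_inner (M : Plane →ₗ[ℝ] Plane)
    ((EuclideanSpace.basisFun (Fin 2) ℝ).map S)
  rw [h2] at h3
  calc _ = ∑ j, inner ℝ (S (EuclideanSpace.single j (1 : ℝ)))
        (M (S (EuclideanSpace.single j (1 : ℝ)))) := Finset.sum_congr rfl fun j _ => by
        rw [h1, ← S.inner_map_map, S.apply_symm_apply]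
    _ = _ := by
      rw [Finset.sum_congr rfl fun j _ => h1 (M (EuclideanSpace.single j 1)) j]
      simpa using h3.symm

/-- The Euler equations are invariant under linear isometries of the plane. -/
theorem IsClassical.conj (h : IsClassical κ T c u) :
    IsClassical κ T (fun t x => c t (S x)) (fun t x => S.symm (u t (S x))) := by
  have hc : ∀ t ∈ Ioo 0 T, ∀ x w, stDeriv (fun t x => c t (S x)) (t, x) w =
      stDeriv c (t, S x) (w.1, S w.2) := fun t ht x w => by
    have := h.regc.stDeriv_conj S (ContinuousLinearMap.id ℝ ℝ) ht x
    exact congrArg (fun L => L w) this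
  have hu : ∀ t ∈ Ioo 0 T, ∀ x w, stDeriv (fun t x => S.symm (u t (S x))) (t, x) w =
      S.symm (stDeriv u (t, S x) (w.1, S w.2)) := fun t ht x w => by
    have := h.regu.stDeriv_conj S (S.symm : Plane →L[ℝ] Plane) ht x
    exact congrArg (fun L => L w) this
  refine ⟨fun t ht x => h.nonneg t ht _, h.regc.conj S (ContinuousLinearMap.id ℝ ℝ),
    h.regu.conj S (S.symm : Plane →L[ℝ] Plane), fun t ht x => ?_, fun t ht x hx v => ?_⟩
  · have e : divergence (fun t x => S.symm (u t (S x))) (t, x) = divergence u (t, S x) := by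
      unfold divergence
      simp only [hu t ht]
      exact sum_conj_coord S ((stDeriv u (t, S x)).comp (ContinuousLinearMap.inr ℝ ℝ Plane))
    rw [e, hc t ht, ← h.transport t ht (S x)]
    simp
  · rw [hu t ht, hc t ht, ← S.inner_map_map, S.apply_symm_apply]
    simpa using h.accel t ht (S x) hx (S v)

/-- For radially symmetric initial data, the velocity of the gas is radial at all times. -/
theorem IsClassical.velocity_mem_span (hκ : κ ≠ 0) (h : IsClassical κ T c u) {c₀ a : ℝ → ℝ}
    (hc0 : ∀ x, c 0 x = c₀ ‖x‖) (hu0 : ∀ x, u 0 x = a ‖x‖ • x) {t : ℝ} (ht : t ∈ Ico 0 T)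
    {x : Plane} (hx : 0 < c t x) : u t x ∈ Submodule.span ℝ {x} := by
  -- The reflection fixes `x` and preserves radial data, so uniqueness makes the velocity at `x`
  -- fixed by it. For `x = 0` the line degenerates to a point and the conclusion is `u = 0`.
  set S := (Submodule.span ℝ {x}).reflection with hS
  have hSx : S x = x := Submodule.reflection_mem_subspace_eq_self (Submodule.mem_span_singleton_self x)
  have e := h.velocity_eq hκ (h.conj S) (by ext y; simp [hc0]) (by ext1 y; simp [hu0]) ht hx
  simp only [hSx] at e
  have e' := congrArg S e
  rw [S.apply_symm_apply] at e'
  exact (Submodule.reflection_eq_self_iff _).1 e'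

/-- For radially symmetric initial data, a vacuum at the origin persists. -/
theorem IsClassical.eq_zero_at_origin (hκ : κ ≠ 0) (h : IsClassical κ T c u) {c₀ a : ℝ → ℝ}
    (hc0 : ∀ x, c 0 x = c₀ ‖x‖) (hu0 : ∀ x, u 0 x = a ‖x‖ • x) (hvac : c 0 0 = 0) {t : ℝ}
    (ht : t ∈ Ico 0 T) : c t 0 = 0 := by
  obtain ⟨C, hC0, hC⟩ := h.regu.exists_abs_divergence_le ht.2
  have hmem : ∀ s ∈ Icc 0 t, s ∈ Ico 0 T := fun s hs => ⟨hs.1, hs.2.trans_lt ht.2⟩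
  have hmem' : ∀ s ∈ Ioo 0 t, s ∈ Ioo 0 T := fun s hs => ⟨hs.1, hs.2.trans ht.2⟩
  have h1 := le_mul_exp_of_abs_deriv_le (K := |κ| * C)
    ((h.regc.continuousOn_time 0).mono hmem)
    (fun s hs => h.regc.hasDerivAt_time (hmem' s hs) 0) (fun s hs => ?_)
    (fun s hs => h.nonneg s (hmem s hs) _) (by positivity)
    (⟨le_rfl, ht.1⟩ : (0 : ℝ) ∈ Icc 0 t) (⟨ht.1, le_rfl⟩ : t ∈ Icc 0 t)
  · rw [hvac, zero_mul] at h1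
    exact le_antisymm h1 (h.nonneg t ht 0)
  · have hsT := Ioo_subset_Ico_self (hmem' s hs)
    -- If the origin is vacuum at time `s`, the time derivative of `c` vanishes by minimality; if it
    -- is gas, the velocity there is `0` and transport gives `c_t = -κ c div u`.
    rcases (h.nonneg s hsT 0).eq_or_lt with h0 | h0
    · rw [h.stDeriv_eq_zero (hmem' s hs) h0.symm, ← h0]
      simp
    · have hu := h.velocity_mem_span hκ hc0 hu0 hsT h0
      have hu' : u s 0 = 0 := by simpa using hu
      have h2 := h.transport s (hmem' s hs) 0
      rw [hu'] at h2
      rw [h2, abs_neg, abs_mul, abs_mul, abs_of_pos h0]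
      have h4 := hC s (Ioo_subset_Ioc_self hs) 0
      calc |κ| * c s 0 * |divergence u (s, 0)| ≤ |κ| * c s 0 * C := by gcongr
        _ = _ := by ring

end Symmetry

/-! ### Weak derivatives in one variable. -/

section WeakDerivative

/-- The lemma of du Bois-Reymond. -/
lemma exists_eq_const_of_weak {g : ℝ → ℝ} {r : ℝ} (hr : 0 < r) (hg : ContinuousOn g (Ioo 0 r))
    (h : ∀ η : ℝ → ℝ, ContDiff ℝ ∞ η → HasCompactSupport η → tsupport η ⊆ Ioo 0 r →
      ∫ s, g s * deriv η s = 0) : ∃ C, EqOn g (fun _ => C) (Ioo 0 r) := by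
  let B : ContDiffBump (r / 2) := ⟨r / 8, r / 4, by positivity, by linarith⟩
  set θ := B.normed volume with hθ
  have hθs : ContDiff ℝ ∞ θ := B.contDiff_normed
  have hθc : HasCompactSupport θ := B.hasCompactSupport_normed
  have hθt : tsupport θ ⊆ Ioo 0 r := by
    rw [hθ, B.tsupport_normed_eq, Real.closedBall_eq_Icc]
    intro s hs
    have h1 := hs.1
    have h2 := hs.2
    simp only [B] at h1 h2
    constructor <;> linarith
  have hθ1 : ∫ s, θ s = 1 := B.integral_normed
  have hint : ∀ ψ : ℝ → ℝ, ContDiff ℝ ∞ ψ → HasCompactSupport ψ → tsupport ψ ⊆ Ioo 0 r →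
      Integrable fun s => g s * ψ s := fun ψ h1 h2 h3 =>
    integrable_mul_of_tsupport isOpen_Ioo hg h1.continuous h2 h3
  set C := ∫ s, g s * θ s with hC
  have key : ∀ ψ : ℝ → ℝ, ContDiff ℝ ∞ ψ → HasCompactSupport ψ → tsupport ψ ⊆ Ioo 0 r →
      ∫ s, ψ s • (g s - C) = 0 := by
    intro ψ h1 h2 h3
    -- Subtracting a multiple of the fixed bump `θ` makes the mean zero, so that the primitive `η`
    -- has compact support and is an admissible test function.
    set ζ : ℝ → ℝ := fun s => ψ s - (∫ s, ψ s) * θ s with hζ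
    have hζs : ContDiff ℝ ∞ ζ := h1.sub (contDiff_const.mul hθs)
    have hiψ : Integrable ψ := h1.continuous.integrable_of_hasCompactSupport h2
    have hiθ : Integrable θ := hθs.continuous.integrable_of_hasCompactSupport hθc
    have hζ0 : ∫ s, ζ s = 0 := by
      rw [hζ, integral_sub hiψ (hiθ.const_mul _), integral_const_mul, hθ1]; ring
    obtain ⟨p, q, hp, hq, hpq⟩ : ∃ p q, 0 < p ∧ q < r ∧ tsupport ψ ∪ tsupport θ ⊆ Icc p q := by
      have hK : IsCompact (tsupport ψ ∪ tsupport θ) := h2.isCompact.union hθc.isCompact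
      have hKs : tsupport ψ ∪ tsupport θ ⊆ Ioo 0 r := union_subset h3 hθt
      have hne : (tsupport ψ ∪ tsupport θ).Nonempty := by
        refine ⟨r / 2, Or.inr ?_⟩
        rw [hθ, B.tsupport_normed_eq]
        exact Metric.mem_closedBall_self B.rOut_pos.le
      obtain ⟨p, hp⟩ := hK.exists_isLeast hne
      obtain ⟨q, hq⟩ := hK.exists_isGreatest hne
      exact ⟨p, q, (hKs hp.1).1, (hKs hq.1).2, fun s hs => ⟨hp.2 hs, hq.2 hs⟩⟩
    have hζz : ∀ s, s ∉ Icc p q → ζ s = 0 := by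
      intro s hs
      have e1 : ψ s = 0 := image_eq_zero_of_notMem_tsupport fun hh => hs (hpq (Or.inl hh))
      have e2 : θ s = 0 := image_eq_zero_of_notMem_tsupport fun hh => hs (hpq (Or.inr hh))
      simp [hζ, e1, e2]
    set η : ℝ → ℝ := fun s => ∫ x in (0 : ℝ)..s, ζ x with hη
    have hηd : ∀ s, HasDerivAt η (ζ s) s := fun s =>
      (hζs.continuous.integral_hasStrictDerivAt 0 s).hasDerivAt
    have hηd' : deriv η = ζ := funext fun s => (hηd s).deriv
    have hηs : ContDiff ℝ ∞ η :=
      contDiff_infty_iff_deriv.2 ⟨fun s => (hηd s).differentiableAt, by rwa [hηd']⟩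
    have hηz : ∀ s, s ∉ Icc p q → η s = 0 := by
      intro s hs
      rw [mem_Icc, not_and_or, not_le, not_le] at hs
      rcases hs with hs | hs
      · simp only [hη]
        rw [intervalIntegral.integral_congr (g := fun _ => 0)]
        · simp
        · intro x hx
          refine hζz x fun hx' => ?_
          have := hx.2
          rcases le_max_iff.1 this with h4 | h4
          · linarith [hx'.1]
          · linarith [hx'.1]
      · simp only [hη]
        rw [intervalIntegral.integral_eq_integral_of_support_subset, hζ0]
        intro x hx
        by_contra hcon
        refine hx (hζz x fun hx' => hcon ⟨?_, ?_⟩)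
        · linarith [hx'.1]
        · linarith [hx'.2]
    have hηt : tsupport η ⊆ Icc p q := closure_minimal
      (fun s hs => by_contra fun hcon => hs (hηz s hcon)) isClosed_Icc
    have h5 := h η hηs (HasCompactSupport.intro isCompact_Icc hηz)
      (hηt.trans fun s hs => ⟨hp.trans_le hs.1, hs.2.trans_lt hq⟩)
    rw [hηd'] at h5
    have e1 : (fun s => g s * ζ s) = fun s => g s * ψ s - (∫ s, ψ s) * (g s * θ s) := by
      funext s; simp only [hζ]; ring
    rw [e1, integral_sub (hint ψ h1 h2 h3) ((hint θ hθs hθc hθt).const_mul _),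
      integral_const_mul, ← hC] at h5
    have e2 : (fun s => ψ s • (g s - C)) = fun s => g s * ψ s - C * ψ s := by
      funext s; simp only [smul_eq_mul]; ring
    rw [e2, integral_sub (hint ψ h1 h2 h3) (hiψ.const_mul _), integral_const_mul]
    linarith
  have hgC : ContinuousOn (fun s => g s - C) (Ioo 0 r) := hg.sub continuousOn_const
  have hae := isOpen_Ioo.ae_eq_zero_of_integral_contDiff_smul_eq_zero
    (hgC.locallyIntegrableOn (μ := volume) measurableSet_Ioo) key
  have hae' : (fun s => g s - C) =ᵐ[volume.restrict (Ioo 0 r)] fun _ => 0 :=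
    (ae_restrict_iff' measurableSet_Ioo).2 hae
  exact ⟨C, fun s hs => sub_eq_zero.1
    (Measure.eqOn_open_of_ae_eq hae' isOpen_Ioo hgC continuousOn_const hs)⟩

/-- A continuous function with a continuous weak derivative is its primitive. -/
theorem eq_add_integral_of_weak {a b : ℝ → ℝ} {T : ℝ} (ha : ContinuousOn a (Ico 0 T))
    (hb : ContinuousOn b (Ico 0 T))
    (h : ∀ η : ℝ → ℝ, ContDiff ℝ ∞ η → HasCompactSupport η → tsupport η ⊆ Ioo 0 T →
      ∫ s, (a s * deriv η s + b s * η s) = 0) {t : ℝ} (ht : t ∈ Ico 0 T) :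
    a t = a 0 + ∫ s in (0 : ℝ)..t, b s := by
  obtain ⟨r, htr, hrT⟩ := exists_between ht.2
  have hr : 0 < r := ht.1.trans_lt htr
  -- Extending `b` from `[0, r]` by constants gives a primitive that is differentiable on the whole
  -- line; `a` minus it has zero weak derivative on `(0, r)`.
  set β : ℝ → ℝ := IccExtend hr.le ((Icc 0 r).domRestrict b) with hβ
  have hβc : Continuous β := (continuousOn_iff_continuous_domRestrict.1
    (hb.mono fun s hs => ⟨hs.1, hs.2.trans_lt hrT⟩)).Icc_extend'
  have hβb : ∀ s ∈ Icc 0 r, β s = b s := fun s hs => IccExtend_of_mem _ _ hs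
  set P : ℝ → ℝ := fun s => ∫ x in (0 : ℝ)..s, β x with hP
  have hPd : ∀ s, HasDerivAt P (β s) s := fun s =>
    (hβc.integral_hasStrictDerivAt 0 s).hasDerivAt
  have hPc : Continuous P := continuous_iff_continuousAt.2 fun s => (hPd s).continuousAt
  have hg : ContinuousOn (fun s => a s - P s) (Ico 0 r) :=
    (ha.mono fun s hs => ⟨hs.1, hs.2.trans hrT⟩).sub hPc.continuousOn
  obtain ⟨C, hC⟩ := exists_eq_const_of_weak hr (hg.mono Ioo_subset_Ico_self) (by
    intro η h1 h2 h3
    have hT : tsupport η ⊆ Ioo 0 T := h3.trans fun s hs => ⟨hs.1, hs.2.trans hrT⟩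
    have h4 := h η h1 h2 hT
    have hdη : Continuous (deriv η) := h1.continuous_deriv (by norm_num)
    have i1 : Integrable (fun s => a s * deriv η s) := integrable_mul_of_tsupport isOpen_Ioo
      (ha.mono Ioo_subset_Ico_self) hdη h2.deriv ((tsupport_deriv_subset).trans hT)
    have i2 : Integrable (fun s => b s * η s) := integrable_mul_of_tsupport isOpen_Ioo
      (hb.mono Ioo_subset_Ico_self) h1.continuous h2 hT
    have i3 : Integrable (fun s => P s * deriv η s) := integrable_mul_of_tsupport isOpen_univ
      hPc.continuousOn hdη h2.deriv (subset_univ _)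
    have i4 : Integrable (fun s => β s * η s) := integrable_mul_of_tsupport isOpen_univ
      hβc.continuousOn h1.continuous h2 (subset_univ _)
    have i5 : Integrable (fun s => P s * η s) := integrable_mul_of_tsupport isOpen_univ
      hPc.continuousOn h1.continuous h2 (subset_univ _)
    have h5 := integral_mul_deriv_eq_deriv_mul_of_integrable (u := P) (v := η)
      (fun s _ => hPd s)
      (fun s _ => (h1.differentiable (by norm_num) s).hasDerivAt) i3 i4 i5
    have h6 : ∫ s, β s * η s = ∫ s, b s * η s := by
      refine integral_congr_ae (Eventually.of_forall fun s => ?_)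
      by_cases hs : s ∈ Icc 0 r
      · simp only [hβb s hs]
      · have : η s = 0 := image_eq_zero_of_notMem_tsupport fun hh =>
          hs (Ioo_subset_Icc_self (h3 hh))
        simp only [this, mul_zero]
    rw [integral_add i1 i2] at h4
    simp only [sub_mul]
    rw [integral_sub i1 i3, h5, h6]
    linarith)
  have hC' : EqOn (fun s => a s - P s) (fun _ => C) (Ico 0 r) :=
    hC.of_subset_closure hg continuousOn_const Ioo_subset_Ico_self
      (by rw [closure_Ioo hr.ne]; exact Ico_subset_Icc_self)
  have e1 := hC' (⟨le_rfl, hr⟩ : (0 : ℝ) ∈ Ico 0 r)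
  have e2 := hC' (⟨ht.1, htr⟩ : t ∈ Ico 0 r)
  have e3 : P 0 = 0 := by simp [hP]
  have e4 : P t = ∫ s in (0 : ℝ)..t, b s := by
    refine intervalIntegral.integral_congr fun s hs => hβb s ?_
    rw [uIcc_of_le ht.1] at hs
    exact ⟨hs.1, hs.2.trans htr.le⟩
  simp only at e1 e2
  rw [← e4]
  linarith

end WeakDerivative

/-! ### Time derivatives of the moments of the density. -/

section Moments

lemma continuousOn_moment {S : Set ℝ} {f : ℝ → Plane → ℝ} {g : Plane → ℝ}
    (hf : ContinuousOn (fun z : ℝ × Plane => f z.1 z.2) (S ×ˢ univ)) (hg : Continuous g)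
    (hgc : HasCompactSupport g) : ContinuousOn (fun t => ∫ x, f t x * g x) S := by
  refine continuousOn_integral_of_compact_support (k := tsupport g) hgc.isCompact ?_
    fun t x _ hx => by rw [image_eq_zero_of_notMem_tsupport hx, mul_zero]
  exact hf.mul (hg.comp continuous_snd).continuousOn

lemma hasCompactSupport_tensor {η : ℝ → ℝ} {g : Plane → ℝ} (hη : HasCompactSupport η)
    (hg : HasCompactSupport g) : HasCompactSupport fun z : ℝ × Plane => η z.1 * g z.2 := by
  refine HasCompactSupport.intro (hη.isCompact.prod hg.isCompact) fun z hz => ?_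
  rw [mem_prod, not_and_or] at hz
  rcases hz with hz | hz
  · rw [image_eq_zero_of_notMem_tsupport hz, zero_mul]
  · rw [image_eq_zero_of_notMem_tsupport hz, mul_zero]

lemma tsupport_tensor_subset {η : ℝ → ℝ} {g : Plane → ℝ} {T : ℝ} (hη : tsupport η ⊆ Ioo 0 T) :
    tsupport (fun z : ℝ × Plane => η z.1 * g z.2) ⊆ Ioo 0 T ×ˢ univ := by
  have : tsupport (fun z : ℝ × Plane => η z.1 * g z.2) ⊆ Prod.fst ⁻¹' tsupport η :=
    closure_minimal (fun z hz => subset_tsupport _ fun h0 => hz (by simp [h0]))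
      ((isClosed_tsupport η).preimage continuous_fst)
  exact fun z hz => ⟨hη (this hz), mem_univ _⟩

/-- Fubini for a product test function reduces the space-time integral to a one-dimensional one in
which the moment plays the role of a function of time. -/
lemma integral_tensor {T : ℝ} {f : ℝ → Plane → ℝ} {η : ℝ → ℝ} {g : Plane → ℝ}
    (hf : ContinuousOn (fun z : ℝ × Plane => f z.1 z.2) (Ico 0 T ×ˢ univ))
    (hη : Continuous η) (hηc : HasCompactSupport η) (hηT : tsupport η ⊆ Ioo 0 T)
    (hg : Continuous g) (hgc : HasCompactSupport g) :
    Integrable (fun z : ℝ × Plane => f z.1 z.2 * (η z.1 * g z.2)) ∧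
    Integrable (fun t => (∫ x, f t x * g x) * η t) ∧
    ∫ z : ℝ × Plane, f z.1 z.2 * (η z.1 * g z.2) = ∫ t, (∫ x, f t x * g x) * η t := by
  have hsub : Ioo 0 T ×ˢ (univ : Set Plane) ⊆ Ico 0 T ×ˢ univ :=
    prod_mono_left Ioo_subset_Ico_self
  have hi : Integrable (fun z : ℝ × Plane => f z.1 z.2 * (η z.1 * g z.2)) :=
    integrable_mul_of_tsupport (isOpen_slab T) (hf.mono hsub)
      (by fun_prop) (hasCompactSupport_tensor hηc hgc) (tsupport_tensor_subset hηT)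
  refine ⟨hi, integrable_mul_of_tsupport isOpen_Ioo
    ((continuousOn_moment hf hg hgc).mono Ioo_subset_Ico_self) hη hηc hηT, ?_⟩
  rw [Measure.volume_eq_prod] at hi ⊢
  rw [integral_prod _ hi]
  refine integral_congr_ae (Eventually.of_forall fun t => ?_)
  simp only
  rw [← integral_mul_const]
  exact integral_congr_ae (Eventually.of_forall fun x => by simp only; ring)

lemma contDiff_tensor {η : ℝ → ℝ} {g : Plane → ℝ} (hη : ContDiff ℝ ∞ η) (hg : ContDiff ℝ ∞ g) :
    ContDiff ℝ ∞ fun z : ℝ × Plane => η z.1 * g z.2 :=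
  (hη.comp contDiff_fst).mul (hg.comp contDiff_snd)

lemma dt_tensor {η : ℝ → ℝ} {g : Plane → ℝ} (hη : ContDiff ℝ ∞ η) (hg : ContDiff ℝ ∞ g)
    (z : ℝ × Plane) : dt (fun z => η z.1 * g z.2) z = deriv η z.1 * g z.2 := by
  have h1 := ((hη.differentiable (by norm_num) z.1).hasFDerivAt.comp z hasFDerivAt_fst).mul
    ((hg.differentiable (by norm_num) z.2).hasFDerivAt.comp z hasFDerivAt_snd)
  rw [dt]
  erw [h1.fderiv]
  simp [mul_comm]

lemma dx_tensor {η : ℝ → ℝ} {g : Plane → ℝ} (hη : ContDiff ℝ ∞ η) (hg : ContDiff ℝ ∞ g)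
    (i : Fin 2) (z : ℝ × Plane) : dx i (fun z => η z.1 * g z.2) z =
      η z.1 * fderiv ℝ g z.2 (EuclideanSpace.single i 1) := by
  have h1 := ((hη.differentiable (by norm_num) z.1).hasFDerivAt.comp z hasFDerivAt_fst).mul
    ((hg.differentiable (by norm_num) z.2).hasFDerivAt.comp z hasFDerivAt_snd)
  rw [dx]
  erw [h1.fderiv]
  simp

/-- The partial derivative in the plane. -/
def partialDeriv (i : Fin 2) (χ : Plane → ℝ) (x : Plane) : ℝ :=
  fderiv ℝ χ x (EuclideanSpace.single i 1)

lemma contDiff_partialDeriv {χ : Plane → ℝ} (hχ : ContDiff ℝ ∞ χ) (i : Fin 2) :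
    ContDiff ℝ ∞ (partialDeriv i χ) :=
  (hχ.fderiv_right (m := ∞) (by norm_num)).clm_apply contDiff_const

lemma hasCompactSupport_partialDeriv {χ : Plane → ℝ} (hχ : HasCompactSupport χ) (i : Fin 2) :
    HasCompactSupport (partialDeriv i χ) :=
  hχ.fderiv_apply (𝕜 := ℝ) _

variable {A γ T : ℝ} {ρ : ℝ → Plane → ℝ} {u : ℝ → Plane → Plane} {χ : Plane → ℝ}

/-- The rate of change of `∫ ρ χ`. -/
def massFlux (ρ : ℝ → Plane → ℝ) (u : ℝ → Plane → Plane) (χ : Plane → ℝ) (t : ℝ) : ℝ :=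
  ∑ i, ∫ x, ρ t x * u t x i * partialDeriv i χ x

/-- The second derivative in time of `∫ ρ χ`. -/
def massAccel (A γ : ℝ) (ρ : ℝ → Plane → ℝ) (u : ℝ → Plane → Plane) (χ : Plane → ℝ) (t : ℝ) : ℝ :=
  ∑ i, (∑ j, (∫ x, ρ t x * u t x i * u t x j * partialDeriv j (partialDeriv i χ) x) +
    ∫ x, pressure A γ (ρ t x) * partialDeriv i (partialDeriv i χ) x)

lemma IsSolution.continuousOn_velocity_coord (h : IsSolution A γ T ρ u) (i : Fin 2) :
    ContinuousOn (fun z : ℝ × Plane => u z.1 z.2 i) (Ico 0 T ×ˢ univ) :=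
  (EuclideanSpace.proj i : Plane →L[ℝ] ℝ).continuous.comp_continuousOn h.velocity_continuous

lemma IsSolution.continuousOn_pressure (h : IsSolution A γ T ρ u) (hγ : 1 < γ) :
    ContinuousOn (fun z : ℝ × Plane => pressure A γ (ρ z.1 z.2)) (Ico 0 T ×ˢ univ) :=
  continuousOn_const.mul (h.density_continuous.rpow_const fun _ _ => Or.inr (by linarith))

lemma IsSolution.continuousOn_massFlux (h : IsSolution A γ T ρ u) (hχ : ContDiff ℝ ∞ χ)
    (hχc : HasCompactSupport χ) : ContinuousOn (massFlux ρ u χ) (Ico 0 T) :=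
  continuousOn_finsetSum _ fun i _ => continuousOn_moment
    (f := fun t x => ρ t x * u t x i)
    (h.density_continuous.mul (h.continuousOn_velocity_coord i))
    (contDiff_partialDeriv hχ i).continuous (hasCompactSupport_partialDeriv hχc i)

lemma IsSolution.continuousOn_massAccel (h : IsSolution A γ T ρ u) (hγ : 1 < γ)
    (hχ : ContDiff ℝ ∞ χ) (hχc : HasCompactSupport χ) :
    ContinuousOn (massAccel A γ ρ u χ) (Ico 0 T) := by
  have h1 := fun i => contDiff_partialDeriv hχ i
  have h2 := fun i => hasCompactSupport_partialDeriv hχc i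
  refine continuousOn_finsetSum _ fun i _ => (continuousOn_finsetSum _ fun j _ => ?_).add ?_
  · exact continuousOn_moment (f := fun t x => ρ t x * u t x i * u t x j)
      ((h.density_continuous.mul (h.continuousOn_velocity_coord i)).mul
        (h.continuousOn_velocity_coord j))
      (contDiff_partialDeriv (h1 i) j).continuous (hasCompactSupport_partialDeriv (h2 i) j)
  · exact continuousOn_moment (f := fun t x => pressure A γ (ρ t x)) (h.continuousOn_pressure hγ)
      (contDiff_partialDeriv (h1 i) i).continuous (hasCompactSupport_partialDeriv (h2 i) i)

/-- Conservation of mass tested with `η(t) χ(x)` says that `massFlux` is the weak time derivative of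
the moment. -/
lemma IsSolution.integral_mul_eq (h : IsSolution A γ T ρ u) (hχ : ContDiff ℝ ∞ χ)
    (hχc : HasCompactSupport χ) {t : ℝ} (ht : t ∈ Ico 0 T) :
    ∫ x, ρ t x * χ x = (∫ x, ρ 0 x * χ x) + ∫ s in (0 : ℝ)..t, massFlux ρ u χ s := by
  refine eq_add_integral_of_weak
    (continuousOn_moment h.density_continuous hχ.continuous hχc)
    (h.continuousOn_massFlux hχ hχc) (fun η h1 h2 h3 => ?_) ht
  have hm := h.mass (fun z => η z.1 * χ z.2) ⟨contDiff_tensor h1 hχ,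
    hasCompactSupport_tensor h2 hχc, tsupport_tensor_subset h3⟩
  simp only [dt_tensor h1 hχ, dx_tensor h1 hχ] at hm
  obtain ⟨a1, a2, a3⟩ := integral_tensor h.density_continuous (h1.continuous_deriv (by norm_num))
    h2.deriv ((tsupport_deriv_subset).trans h3) hχ.continuous hχc
  have b := fun j => integral_tensor (f := fun t x => ρ t x * u t x j)
    (h.density_continuous.mul (h.continuousOn_velocity_coord j)) h1.continuous h2 h3
    (contDiff_partialDeriv hχ j).continuous (hasCompactSupport_partialDeriv hχc j)
  have hm2 := integral_add a1 (integrable_finsetSum Finset.univ fun j _ => (b j).1)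
  rw [integral_finsetSum _ fun j _ => (b j).1] at hm2
  have e1 := hm2.symm.trans hm
  rw [a3, Finset.sum_congr rfl fun j _ => (b j).2.2] at e1
  simp only [massFlux, Finset.sum_mul]
  rw [integral_add a2 (integrable_finsetSum Finset.univ fun j _ => (b j).2.1),
    integral_finsetSum _ fun j _ => (b j).2.1]
  exact e1

/-- The `i`-th momentum equation is tested with `η(t) ∂ᵢχ(x)` and the results are summed over `i`.
-/
lemma IsSolution.massFlux_eq (h : IsSolution A γ T ρ u) (hγ : 1 < γ) (hχ : ContDiff ℝ ∞ χ)
    (hχc : HasCompactSupport χ) {t : ℝ} (ht : t ∈ Ico 0 T) :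
    massFlux ρ u χ t = massFlux ρ u χ 0 + ∫ s in (0 : ℝ)..t, massAccel A γ ρ u χ s := by
  refine eq_add_integral_of_weak (h.continuousOn_massFlux hχ hχc)
    (h.continuousOn_massAccel hγ hχ hχc) (fun η h1 h2 h3 => ?_) ht
  have d1 := fun i => contDiff_partialDeriv hχ i
  have c1 := fun i => hasCompactSupport_partialDeriv hχc i
  have a := fun i => integral_tensor (f := fun t x => ρ t x * u t x i)
    (h.density_continuous.mul (h.continuousOn_velocity_coord i))
    (h1.continuous_deriv (by norm_num)) h2.deriv ((tsupport_deriv_subset).trans h3)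
    (d1 i).continuous (c1 i)
  have b := fun i j => integral_tensor (f := fun t x => ρ t x * u t x i * u t x j)
    ((h.density_continuous.mul (h.continuousOn_velocity_coord i)).mul
      (h.continuousOn_velocity_coord j)) h1.continuous h2 h3
    (contDiff_partialDeriv (d1 i) j).continuous (hasCompactSupport_partialDeriv (c1 i) j)
  have p := fun i => integral_tensor (f := fun t x => pressure A γ (ρ t x))
    (h.continuousOn_pressure hγ) h1.continuous h2 h3
    (contDiff_partialDeriv (d1 i) i).continuous (hasCompactSupport_partialDeriv (c1 i) i)
  have key : ∀ i, (∫ s, (∫ x, ρ s x * u s x i * partialDeriv i χ x) * deriv η s) +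
      ((∑ j, ∫ s, (∫ x, ρ s x * u s x i * u s x j * partialDeriv j (partialDeriv i χ) x) * η s) +
      ∫ s, (∫ x, pressure A γ (ρ s x) * partialDeriv i (partialDeriv i χ) x) * η s) = 0 := by
    intro i
    have hm := h.momentum i (fun z => η z.1 * partialDeriv i χ z.2)
      ⟨contDiff_tensor h1 (d1 i), hasCompactSupport_tensor h2 (c1 i), tsupport_tensor_subset h3⟩
    simp only [dt_tensor h1 (d1 i), dx_tensor h1 (d1 i)] at hm
    have i1 := integrable_finsetSum Finset.univ fun j _ => (b i j).1
    have hm2 := integral_add ((a i).1.add i1) (p i).1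
    have hm3 := integral_add (a i).1 i1
    rw [integral_finsetSum _ fun j _ => (b i j).1] at hm3
    have e1 := hm2.symm.trans hm
    have e2 := (congrArg (· + ∫ z : ℝ × Plane, pressure A γ (ρ z.1 z.2) *
      (η z.1 * partialDeriv i (partialDeriv i χ) z.2)) hm3).symm.trans e1
    rw [← (a i).2.2, ← (p i).2.2, ← Finset.sum_congr rfl fun j _ => (b i j).2.2, ← add_assoc]
    exact e2
  simp only [massFlux, massAccel, Finset.sum_mul, add_mul]
  have i2 := fun i => integrable_finsetSum Finset.univ fun j _ => (b i j).2.1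
  have i3 := fun i => (i2 i).fun_add (p i).2.1
  rw [integral_add (integrable_finsetSum Finset.univ fun i _ => (a i).2.1)
    (integrable_finsetSum Finset.univ fun i _ => i3 i),
    integral_finsetSum _ fun i _ => (a i).2.1,
    integral_finsetSum _ fun i _ => i3 i, ← Finset.sum_add_distrib]
  refine Finset.sum_eq_zero fun i _ => Eq.trans ?_ (key i)
  congr 1
  refine (integral_add (i2 i) (p i).2.1).trans ?_
  rw [integral_finsetSum _ fun j _ => (b i j).2.1]

end Moments

/-! ### The modified Bessel function and its moments. -/

section Bessel

/-- `∫₀^∞ cosh(t)^n exp(-r cosh t) dt`. -/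
def besselMoment (n : ℕ) (r : ℝ) : ℝ :=
  ∫ t in Ioi (0 : ℝ), Real.cosh t ^ n * Real.exp (-(r * Real.cosh t))

lemma besselK0_eq : besselK0 = besselMoment 0 := by
  ext r; simp [besselK0, besselMoment]

lemma self_le_cosh (t : ℝ) : t ≤ Real.cosh t := by
  have h1 := Real.add_one_le_exp t
  have h2 := Real.exp_pos (-t)
  rcases le_or_gt t 1 with h | h
  · exact h.trans (Real.one_le_cosh t)
  · have h3 := Real.cosh_eq t
    have h4 := Real.quadratic_le_exp_of_nonneg (zero_le_one.trans h.le)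
    nlinarith

/-- Half of the exponent absorbs the power, by `yⁿ / n! ≤ exp y` with `y = r cosh t / 2`; the other
half is integrable since `cosh t ≥ t`. -/
lemma integrableOn_besselMoment (n : ℕ) {r : ℝ} (hr : 0 < r) :
    IntegrableOn (fun t => Real.cosh t ^ n * Real.exp (-(r * Real.cosh t))) (Ioi 0) := by
  refine ((integrableOn_exp_mul_Ioi (a := -(r / 2)) (by linarith) 0).const_mul
    ((2 / r) ^ n * n.factorial)).mono' (Continuous.aestronglyMeasurable (by fun_prop)) ?_
  refine Eventually.of_forall fun t => ?_
  have hc := Real.cosh_pos t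
  rw [Real.norm_of_nonneg (by positivity)]
  have h1 := Real.pow_div_factorial_le_exp (r / 2 * Real.cosh t) (by positivity) n
  rw [div_le_iff₀ (by positivity)] at h1
  have h2 : Real.exp (-(r * Real.cosh t)) =
      Real.exp (-(r / 2 * Real.cosh t)) * Real.exp (-(r / 2 * Real.cosh t)) := by
    rw [← Real.exp_add]; ring_nf
  have h3 : Real.exp (-(r / 2 * Real.cosh t)) ≤ Real.exp (-(r / 2) * t) := by
    refine Real.exp_le_exp.2 ?_
    have := self_le_cosh t
    nlinarith
  have h4 : Real.cosh t ^ n = (2 / r) ^ n * (r / 2 * Real.cosh t) ^ n := by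
    rw [← mul_pow]; congr 1; field_simp
  have h5 : Real.exp (r / 2 * Real.cosh t) * Real.exp (-(r / 2 * Real.cosh t)) = 1 := by
    rw [← Real.exp_add]; simp
  rw [h2, h4]
  calc (2 / r) ^ n * (r / 2 * Real.cosh t) ^ n *
        (Real.exp (-(r / 2 * Real.cosh t)) * Real.exp (-(r / 2 * Real.cosh t)))
      ≤ (2 / r) ^ n * (Real.exp (r / 2 * Real.cosh t) * n.factorial) *
        (Real.exp (-(r / 2 * Real.cosh t)) * Real.exp (-(r / 2) * t)) := by gcongr
    _ = (2 / r) ^ n * n.factorial * Real.exp (-(r / 2) * t) *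
        (Real.exp (r / 2 * Real.cosh t) * Real.exp (-(r / 2 * Real.cosh t))) := by ring
    _ = _ := by rw [h5, mul_one]

lemma hasDerivAt_besselMoment (n : ℕ) {r : ℝ} (hr : 0 < r) :
    HasDerivAt (besselMoment n) (-besselMoment (n + 1) r) r := by
  have h := hasDerivAt_integral_of_dominated_loc_of_deriv_le (μ := volume.restrict (Ioi (0 : ℝ)))
    (F := fun r t => Real.cosh t ^ n * Real.exp (-(r * Real.cosh t)))
    (F' := fun r t => -(Real.cosh t ^ (n + 1) * Real.exp (-(r * Real.cosh t))))
    (bound := fun t => Real.cosh t ^ (n + 1) * Real.exp (-(r / 2 * Real.cosh t)))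
    (x₀ := r) (s := Ioi (r / 2)) (Ioi_mem_nhds (by linarith))
    (Eventually.of_forall fun s => Continuous.aestronglyMeasurable (by fun_prop))
    (integrableOn_besselMoment n hr) (Continuous.aestronglyMeasurable (by fun_prop))
    (Eventually.of_forall fun t s hs => ?_) (integrableOn_besselMoment (n + 1) (by linarith))
    (Eventually.of_forall fun t s hs => ?_)
  · rw [besselMoment, ← integral_neg]
    exact h.2
  · have hc := Real.cosh_pos t
    rw [norm_neg, Real.norm_of_nonneg (by positivity)]
    have : r / 2 ≤ s := le_of_lt hs
    gcongr
  · have h1 : HasDerivAt (fun s => -(s * Real.cosh t)) (-Real.cosh t) s := by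
      exact ((hasDerivAt_id s).mul_const (Real.cosh t)).fun_neg.congr_deriv (by simp)
    have := (h1.exp).const_mul (Real.cosh t ^ n)
    refine this.congr_deriv ?_
    ring

lemma contDiffOn_besselMoment (n : ℕ) : ContDiffOn ℝ ∞ (besselMoment n) (Ioi 0) := by
  rw [contDiffOn_infty]
  intro m
  induction m generalizing n with
  | zero =>
    refine contDiffOn_zero.2 fun r hr => ?_
    exact (hasDerivAt_besselMoment n hr).continuousAt.continuousWithinAt
  | succ m ih =>
    rw [Nat.cast_add, Nat.cast_one, contDiffOn_succ_iff_deriv_of_isOpen isOpen_Ioi]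
    refine ⟨fun r hr => (hasDerivAt_besselMoment n hr).differentiableAt.differentiableWithinAt,
      by simp, ?_⟩
    exact (ih (n + 1)).neg.congr fun r hr => (hasDerivAt_besselMoment n hr).deriv

lemma besselMoment_nonneg (n : ℕ) (r : ℝ) : 0 ≤ besselMoment n r :=
  setIntegral_nonneg measurableSet_Ioi fun t _ => by have := Real.cosh_pos t; positivity

lemma besselMoment_pos (n : ℕ) {r : ℝ} (hr : 0 < r) : 0 < besselMoment n r := by
  refine (setIntegral_pos_iff_support_of_nonneg_ae (Eventually.of_forall fun t => ?_)
    (integrableOn_besselMoment n hr)).2 ?_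
  · have := Real.cosh_pos t
    positivity
  · have : Function.support (fun t => Real.cosh t ^ n * Real.exp (-(r * Real.cosh t))) = univ :=
      eq_univ_of_forall fun t => by
        have := Real.cosh_pos t
        rw [Function.mem_support]
        positivity
    rw [this, univ_inter]
    simp

lemma besselMoment_le_succ (n : ℕ) {r : ℝ} (hr : 0 < r) :
    besselMoment n r ≤ besselMoment (n + 1) r := by
  refine integral_mono (integrableOn_besselMoment n hr) (integrableOn_besselMoment (n + 1) hr)
    fun t => ?_
  have h := Real.one_le_cosh t
  simp only
  gcongr
  · exact Nat.le_succ n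

lemma besselMoment_anti (n : ℕ) {r s : ℝ} (hr : 0 < r) (hrs : r ≤ s) :
    besselMoment n s ≤ besselMoment n r := by
  refine integral_mono (integrableOn_besselMoment n (hr.trans_le hrs))
    (integrableOn_besselMoment n hr) fun t => ?_
  have h := Real.cosh_pos t
  simp only
  gcongr

/-- The modified Bessel equation `r (K₀'' - K₀) = -K₀'`: the function `sinh t exp (-r cosh t)`
vanishes at both ends, so its derivative has integral zero, and `sinh² = cosh² - 1`. -/
lemma mul_besselMoment_two_sub {r : ℝ} (hr : 0 < r) :
    r * (besselMoment 2 r - besselMoment 0 r) = besselMoment 1 r := by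
  have hd : ∀ t ∈ Ici (0 : ℝ), HasDerivAt (fun t => Real.sinh t * Real.exp (-(r * Real.cosh t)))
      (Real.cosh t ^ 1 * Real.exp (-(r * Real.cosh t)) -
        r * (Real.cosh t ^ 2 * Real.exp (-(r * Real.cosh t)) -
          Real.cosh t ^ 0 * Real.exp (-(r * Real.cosh t)))) t := by
    intro t _
    have h1 := ((Real.hasDerivAt_cosh t).const_mul r).neg.exp
    refine ((Real.hasDerivAt_sinh t).mul h1).congr_deriv ?_
    have := Real.cosh_sq t
    simp only [Pi.neg_apply]
    linear_combination (r * Real.exp (-(r * Real.cosh t))) * this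
  have hlim : Tendsto (fun t => Real.sinh t * Real.exp (-(r * Real.cosh t))) atTop (𝓝 0) := by
    have h1 : Tendsto (fun y => y ^ 1 * Real.exp (-r * y)) atTop (𝓝 0) := by
      have h2 := (Real.tendsto_pow_mul_exp_neg_atTop_nhds_zero 1).comp
        (tendsto_id.const_mul_atTop hr)
      have h3 := h2.const_mul r⁻¹
      rw [mul_zero] at h3
      refine h3.congr fun y => ?_
      simp only [Function.comp, id]
      field_simp
    have hcosh : Tendsto Real.cosh atTop atTop :=
      tendsto_atTop_mono self_le_cosh tendsto_id
    refine squeeze_zero_norm' ?_ (h1.comp hcosh)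
    refine Eventually.of_forall fun t => ?_
    rw [norm_mul, Real.norm_of_nonneg (Real.exp_pos _).le, Function.comp, pow_one, neg_mul]
    gcongr
    rw [Real.norm_eq_abs, abs_le]
    have h1 := Real.cosh_eq t
    have h2 := Real.sinh_eq t
    have h3 := Real.exp_pos t
    have h4 := Real.exp_pos (-t)
    constructor <;> linarith
  have i := fun n => integrableOn_besselMoment n hr
  have h := integral_Ioi_of_hasDerivAt_of_tendsto' hd
    ((i 1).sub (((i 2).sub (i 0)).const_mul r)) hlim
  have e1 := integral_sub (i 1) (((i 2).sub (i 0)).const_mul r)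
  have e2 := integral_sub (i 2) (i 0)
  rw [integral_const_mul] at e1
  simp only [Pi.sub_apply] at e1
  rw [e2] at e1
  rw [e1] at h
  simp only [besselMoment]
  simp only [Real.sinh_zero, zero_mul, sub_zero] at h
  linarith

/-- Replacing `cosh` by the smaller `sinh` in the exponent turns the integrand into an exact
derivative. -/
lemma besselMoment_one_le {r : ℝ} (hr : 0 < r) : besselMoment 1 r ≤ 1 / r := by
  have hd : ∀ t ∈ Ici (0 : ℝ), HasDerivAt (fun t => -(r⁻¹ * Real.exp (-(r * Real.sinh t))))
      (Real.cosh t * Real.exp (-(r * Real.sinh t))) t := by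
    intro t _
    refine ((((Real.hasDerivAt_sinh t).const_mul r).neg.exp).const_mul r⁻¹).neg.congr_deriv ?_
    simp only [Pi.neg_apply]
    field_simp
  have hpos : ∀ t ∈ Ioi (0 : ℝ), 0 ≤ Real.cosh t * Real.exp (-(r * Real.sinh t)) := fun t _ => by
    have := Real.cosh_pos t; positivity
  have hlim : Tendsto (fun t => -(r⁻¹ * Real.exp (-(r * Real.sinh t)))) atTop (𝓝 0) := by
    have h1 : Tendsto Real.sinh atTop atTop := tendsto_atTop_mono'
      atTop (by filter_upwards [eventually_ge_atTop 0] with t ht using Real.self_le_sinh_iff.2 ht)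
      tendsto_id
    have h2 := (Real.tendsto_exp_neg_atTop_nhds_zero.comp (h1.const_mul_atTop hr)).const_mul r⁻¹
    simpa using h2.neg
  have h1 := integral_Ioi_of_hasDerivAt_of_nonneg' hd hpos hlim
  have h2 := integrableOn_Ioi_deriv_of_nonneg' hd hpos hlim
  have h3 : besselMoment 1 r ≤ ∫ t in Ioi (0 : ℝ), Real.cosh t * Real.exp (-(r * Real.sinh t)) := by
    refine integral_mono (integrableOn_besselMoment 1 hr) h2 fun t => ?_
    have := (Real.sinh_lt_cosh t).le
    have := Real.cosh_pos t
    simp only [pow_one]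
    gcongr
  rw [h1] at h3
  simpa using h3

/-- From `exp (-y) ≤ 2 / y²` with `y = r cosh t` and `cosh t ≥ exp t / 2`. -/
lemma besselMoment_zero_le {r : ℝ} (hr : 0 < r) : besselMoment 0 r ≤ 4 / r ^ 2 := by
  have h1 : besselMoment 0 r ≤ ∫ t in Ioi (0 : ℝ), 8 / r ^ 2 * Real.exp (-2 * t) := by
    refine integral_mono (integrableOn_besselMoment 0 hr)
      ((integrableOn_exp_mul_Ioi (by norm_num) 0).const_mul _) fun t => ?_
    have hc := Real.cosh_pos t
    have h2 := Real.pow_div_factorial_le_exp (r * Real.cosh t) (by positivity) 2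
    have h3 : Real.exp t ≤ 2 * Real.cosh t := by
      rw [Real.cosh_eq]; linarith [Real.exp_pos (-t)]
    have h4 : Real.exp (2 * t) ≤ 4 * Real.cosh t ^ 2 := by
      have : Real.exp (2 * t) = Real.exp t ^ 2 := by rw [← Real.exp_nat_mul]; norm_num
      rw [this]; nlinarith [Real.exp_pos t]
    simp only [pow_zero, one_mul, neg_mul, Real.exp_neg]
    rw [div_mul_eq_mul_div, le_div_iff₀ (by positivity), inv_mul_le_iff₀ (by positivity),
      ← mul_assoc, ← div_eq_mul_inv, le_div_iff₀ (by positivity)]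
    have h5 : (Nat.factorial 2 : ℝ) = 2 := by norm_num [Nat.factorial]
    rw [h5, mul_pow] at h2
    nlinarith [sq_nonneg r, mul_le_mul_of_nonneg_left h4 (sq_nonneg r)]
  refine h1.trans_eq ?_
  rw [integral_const_mul, integral_exp_mul_Ioi (by norm_num)]
  norm_num
  ring

/-- Half of the exponent is bounded using `cosh t ≥ 1`. The factor `r` is the polar Jacobian, so
this is integrability in the plane. -/
lemma besselMoment_one_le_exp {r : ℝ} (hr : 0 < r) :
    r * besselMoment 1 r ≤ 2 * Real.exp (-(1 / 2) * r) := by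
  have h1 : besselMoment 1 r ≤ Real.exp (-(1 / 2) * r) * besselMoment 1 (r / 2) := by
    rw [besselMoment, besselMoment, ← integral_const_mul]
    refine integral_mono (integrableOn_besselMoment 1 hr)
      ((integrableOn_besselMoment 1 (half_pos hr)).const_mul _) fun t => ?_
    have hc := Real.one_le_cosh t
    have : Real.exp (-(r * Real.cosh t)) ≤
        Real.exp (-(1 / 2) * r) * Real.exp (-(r / 2 * Real.cosh t)) := by
      rw [← Real.exp_add]
      refine Real.exp_le_exp.2 ?_
      nlinarith
    simp only
    calc _ ≤ Real.cosh t ^ 1 * (Real.exp (-(1 / 2) * r) * Real.exp (-(r / 2 * Real.cosh t))) := by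
          gcongr
      _ = _ := by ring
  have h2 := besselMoment_one_le (half_pos hr)
  calc r * besselMoment 1 r ≤ r * (Real.exp (-(1 / 2) * r) * (1 / (r / 2))) := by
        gcongr; exact h1.trans (by gcongr)
    _ = _ := by field_simp

lemma integrable_besselMoment_one_norm : Integrable fun x : Plane => besselMoment 1 ‖x‖ := by
  refine (integrable_fun_norm_addHaar volume).2 ?_
  have hd : Module.finrank ℝ Plane - 1 = 1 := by simp
  rw [hd]
  refine ((integrableOn_exp_mul_Ioi (a := -(1 / 2)) (by norm_num) 0).const_mul 2).mono' ?_ ?_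
  · refine ContinuousOn.aestronglyMeasurable ?_ measurableSet_Ioi
    exact (continuous_pow 1).continuousOn.smul (contDiffOn_besselMoment 1).continuousOn
  · filter_upwards [ae_restrict_mem measurableSet_Ioi] with r hr
    have hr' : 0 < r := hr
    rw [pow_one, smul_eq_mul, Real.norm_of_nonneg (mul_nonneg hr'.le (besselMoment_nonneg 1 r))]
    exact besselMoment_one_le_exp hr

lemma ae_ne_zero : ∀ᵐ x : Plane, x ≠ 0 := by
  simp [ae_iff]

lemma aestronglyMeasurable_besselMoment_norm (n : ℕ) :
    AEStronglyMeasurable (fun x : Plane => besselMoment n ‖x‖) volume := by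
  have h1 : ContinuousOn (fun x : Plane => besselMoment n ‖x‖) {0}ᶜ :=
    (contDiffOn_besselMoment n).continuousOn.comp continuous_norm.continuousOn
      fun x hx => norm_pos_iff.2 hx
  have h2 := h1.aestronglyMeasurable (μ := volume) (measurableSet_singleton 0).compl
  rwa [Measure.restrict_eq_self_of_ae_mem (by simpa using ae_ne_zero)] at h2

lemma integrable_besselMoment_zero_norm : Integrable fun x : Plane => besselMoment 0 ‖x‖ := by
  refine integrable_besselMoment_one_norm.mono' (aestronglyMeasurable_besselMoment_norm 0) ?_
  filter_upwards [ae_ne_zero] with x hx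
  rw [Real.norm_of_nonneg (besselMoment_nonneg 0 _)]
  exact besselMoment_le_succ 0 (norm_pos_iff.2 hx)

end Bessel

/-! ### The Bessel function in the squared radius. -/

section Profile

/-- `K₀(√q)`. -/
def besselSqrt (q : ℝ) : ℝ := besselMoment 0 (Real.sqrt q)

/-- Minus the derivative of `K₀(√q)`. -/
def besselSqrtD (q : ℝ) : ℝ := besselMoment 1 (Real.sqrt q) / (2 * Real.sqrt q)

/-- The second derivative of `K₀(√q)`. -/
def besselSqrtDD (q : ℝ) : ℝ :=
  besselMoment 2 (Real.sqrt q) / (4 * q) + besselMoment 1 (Real.sqrt q) / (4 * q * Real.sqrt q)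

variable {q : ℝ}

lemma hasDerivAt_besselMoment_sqrt (n : ℕ) (hq : 0 < q) :
    HasDerivAt (fun q => besselMoment n (Real.sqrt q))
      (-besselMoment (n + 1) (Real.sqrt q) * (1 / (2 * Real.sqrt q))) q :=
  (hasDerivAt_besselMoment n (Real.sqrt_pos.2 hq)).comp q (Real.hasDerivAt_sqrt hq.ne')

lemma hasDerivAt_besselSqrt (hq : 0 < q) : HasDerivAt besselSqrt (-besselSqrtD q) q :=
  (hasDerivAt_besselMoment_sqrt 0 hq).congr_deriv (by rw [besselSqrtD]; ring)

lemma hasDerivAt_besselSqrtD (hq : 0 < q) : HasDerivAt besselSqrtD (-besselSqrtDD q) q := by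
  have hs := Real.sqrt_pos.2 hq
  have h1 : HasDerivAt (fun q => 2 * Real.sqrt q) (2 * (1 / (2 * Real.sqrt q))) q :=
    (Real.hasDerivAt_sqrt hq.ne').const_mul 2
  refine ((hasDerivAt_besselMoment_sqrt 1 hq).div h1 (by positivity)).congr_deriv ?_
  rw [besselSqrtDD]
  have h2 := Real.sq_sqrt hq.le
  have h3 : q = Real.sqrt q * Real.sqrt q := (Real.mul_self_sqrt hq.le).symm
  set s := Real.sqrt q
  rw [h3]
  field_simp
  ring

lemma besselSqrt_nonneg (q : ℝ) : 0 ≤ besselSqrt q := besselMoment_nonneg 0 _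

lemma besselSqrtD_nonneg (q : ℝ) : 0 ≤ besselSqrtD q :=
  div_nonneg (besselMoment_nonneg 1 _) (by positivity)

lemma besselSqrtDD_nonneg (hq : 0 < q) : 0 ≤ besselSqrtDD q :=
  add_nonneg (div_nonneg (besselMoment_nonneg 2 _) (by positivity))
    (div_nonneg (besselMoment_nonneg 1 _) (by positivity))

/-- The left side is the planar Laplacian `4 q F'' + 4 F'` of a function `F(|x|²)`; this is `ΔK₀ =
K₀` away from the origin. -/
lemma besselSqrt_ode (hq : 0 < q) : 4 * q * besselSqrtDD q - 4 * besselSqrtD q = besselSqrt q := by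
  have hs := Real.sqrt_pos.2 hq
  have h1 := mul_besselMoment_two_sub hs
  have h3 : q = Real.sqrt q * Real.sqrt q := (Real.mul_self_sqrt hq.le).symm
  rw [besselSqrtDD, besselSqrtD, besselSqrt]
  set s := Real.sqrt q
  rw [h3]
  field_simp
  linear_combination 2 * h1

/-- The left side is the second derivative in `s` of `F(s²)`, here `K₀''(s)`, which is the moment of
order two. -/
lemma besselSqrt_convex (hq : 0 < q) : 0 ≤ 4 * q * besselSqrtDD q - 2 * besselSqrtD q := by
  have hs := Real.sqrt_pos.2 hq
  have h3 : q = Real.sqrt q * Real.sqrt q := (Real.mul_self_sqrt hq.le).symm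
  have h4 : 4 * q * besselSqrtDD q - 2 * besselSqrtD q = besselMoment 2 (Real.sqrt q) := by
    rw [besselSqrtDD, besselSqrtD]
    set s := Real.sqrt q
    rw [h3]
    field_simp
    ring
  rw [h4]
  exact besselMoment_nonneg 2 _

/-- With `s = √q`: `s M₁ ≤ 1` and `s² M₀ ≤ 4`, so the Bessel equation gives `s² M₂ ≤ 5`; the sum `6`
over `4 s⁴` is the bound. -/
lemma besselSqrtDD_le (hq : 0 < q) : besselSqrtDD q ≤ 3 / 2 / q ^ 2 := by
  have hs := Real.sqrt_pos.2 hq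
  have h1 := mul_besselMoment_two_sub hs
  have h2 := besselMoment_one_le hs
  have h4 := besselMoment_zero_le hs
  have h3 : q = Real.sqrt q * Real.sqrt q := (Real.mul_self_sqrt hq.le).symm
  rw [besselSqrtDD]
  set s := Real.sqrt q
  rw [h3]
  rw [le_div_iff₀ hs] at h2
  rw [le_div_iff₀ (by positivity)] at h4
  have h5 : besselMoment 2 s / (4 * (s * s)) + besselMoment 1 s / (4 * (s * s) * s) =
      (s ^ 2 * besselMoment 2 s + besselMoment 1 s * s) / (4 * s ^ 4) := by field_simp
  have h6 : 3 / 2 / (s * s) ^ 2 = 6 / (4 * s ^ 4) := by field_simp; norm_num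
  rw [h5, h6]
  gcongr
  nlinarith

lemma contDiffAt_besselSqrt (hq : 0 < q) : ContDiffAt ℝ ∞ besselSqrt q :=
  ContDiffAt.comp q ((contDiffOn_besselMoment 0).contDiffAt (Ioi_mem_nhds (Real.sqrt_pos.2 hq)))
    (Real.contDiffAt_sqrt hq.ne')

lemma continuousOn_besselSqrt : ContinuousOn besselSqrt (Ioi 0) := fun _ hq =>
  (hasDerivAt_besselSqrt hq).continuousAt.continuousWithinAt

end Profile

/-! ### Smooth convex truncation at small values. -/

section Truncation

/-- A smooth convex approximation of `max y 0` that vanishes for `y ≤ ε`. -/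
def truncation (ε y : ℝ) : ℝ := ∫ z in (0 : ℝ)..y, Real.smoothTransition (z / ε - 1)

variable {ε : ℝ}

lemma contDiff_truncationD (ε : ℝ) :
    ContDiff ℝ ∞ fun z => Real.smoothTransition (z / ε - 1) :=
  Real.smoothTransition.contDiff.comp (by fun_prop)

lemma hasDerivAt_truncation (ε y : ℝ) :
    HasDerivAt (truncation ε) (Real.smoothTransition (y / ε - 1)) y :=
  ((contDiff_truncationD ε).continuous.integral_hasStrictDerivAt 0 y).hasDerivAt

lemma contDiff_truncation (ε : ℝ) : ContDiff ℝ ∞ (truncation ε) := by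
  refine contDiff_infty_iff_deriv.2 ⟨fun y => (hasDerivAt_truncation ε y).differentiableAt, ?_⟩
  rw [funext fun y => (hasDerivAt_truncation ε y).deriv]
  exact contDiff_truncationD ε

/-- The second derivative of `truncation`. -/
def truncationDD (ε y : ℝ) : ℝ := deriv (fun z => Real.smoothTransition (z / ε - 1)) y

lemma hasDerivAt_truncationD (ε y : ℝ) :
    HasDerivAt (fun z => Real.smoothTransition (z / ε - 1)) (truncationDD ε y) y :=
  ((contDiff_truncationD ε).differentiable (by norm_num) y).hasDerivAt

lemma truncationDD_nonneg (hε : 0 < ε) (y : ℝ) : 0 ≤ truncationDD ε y := by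
  have hm : Monotone fun z => Real.smoothTransition (z / ε - 1) := fun a b hab =>
    Real.smoothTransition.monotone (by gcongr)
  exact hm.deriv_nonneg

lemma truncation_eq_zero (hε : 0 < ε) {y : ℝ} (hy0 : 0 ≤ y) (hy : y ≤ ε) : truncation ε y = 0 := by
  rw [truncation, intervalIntegral.integral_congr (g := fun _ => 0), intervalIntegral.integral_zero]
  intro z hz
  rw [uIcc_of_le hy0] at hz
  refine Real.smoothTransition.zero_of_nonpos ?_
  rw [sub_nonpos, div_le_one hε]
  exact hz.2.trans hy

lemma truncation_nonneg (ε : ℝ) {y : ℝ} (hy : 0 ≤ y) : 0 ≤ truncation ε y :=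
  intervalIntegral.integral_nonneg hy fun _ _ => Real.smoothTransition.nonneg _

lemma truncation_le (ε : ℝ) {y : ℝ} (hy : 0 ≤ y) : truncation ε y ≤ y := by
  have h := intervalIntegral.integral_mono_on (μ := volume) hy
    ((contDiff_truncationD ε).continuous.intervalIntegrable 0 y)
    (continuous_const.intervalIntegrable (μ := volume) (u := fun _ => (1 : ℝ)) 0 y) fun z _ =>
      Real.smoothTransition.le_one _
  simpa [truncation] using h

/-- The slope `smoothTransition (z / ε - 1)` reaches `1` at `z = 2 ε`, after which nothing more is
lost. -/
lemma le_truncation_add (hε : 0 < ε) {y : ℝ} (hy : 0 ≤ y) : y ≤ truncation ε y + 2 * ε := by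
  rcases le_total y (2 * ε) with h | h
  · linarith [truncation_nonneg ε hy]
  · have hi : ∀ a b, IntervalIntegrable (fun z => Real.smoothTransition (z / ε - 1)) volume a b :=
      fun a b => (contDiff_truncationD ε).continuous.intervalIntegrable a b
    have h1 : truncation ε y = truncation ε (2 * ε) +
        ∫ z in (2 * ε)..y, Real.smoothTransition (z / ε - 1) :=
      (intervalIntegral.integral_add_adjacent_intervals (hi _ _) (hi _ _)).symm
    have h2 : ∫ z in (2 * ε)..y, Real.smoothTransition (z / ε - 1) = y - 2 * ε := by
      rw [intervalIntegral.integral_congr (g := fun _ => 1)]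
      · simp
      · intro z hz
        rw [uIcc_of_le h] at hz
        refine Real.smoothTransition.one_of_one_le ?_
        rw [le_sub_iff_add_le, le_div_iff₀ hε]
        linarith [hz.1]
    rw [h1, h2]
    linarith [truncation_nonneg ε (y := 2 * ε) (by positivity)]

end Truncation

/-! ### Smooth compactly supported approximations of the Bessel kernel. -/

section TestFunction

lemma hasFDerivAt_radial {F : ℝ → ℝ} {F' : ℝ} {x : Plane} (h : HasDerivAt F F' (‖x‖ ^ 2)) :
    HasFDerivAt (fun x : Plane => F (‖x‖ ^ 2)) ((2 * F') • innerSL ℝ x) x := by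
  have h1 : HasFDerivAt (fun x : Plane => ‖x‖ ^ 2) (2 • innerSL ℝ x) x :=
    (hasStrictFDerivAt_norm_sq x).hasFDerivAt
  refine (h.comp_hasFDerivAt x h1).congr_fderiv ?_
  ext v
  simp
  ring

lemma partialDeriv_radial {F : ℝ → ℝ} {F' : ℝ} {x : Plane} (h : HasDerivAt F F' (‖x‖ ^ 2))
    (i : Fin 2) : partialDeriv i (fun x : Plane => F (‖x‖ ^ 2)) x = 2 * x i * F' := by
  rw [partialDeriv, (hasFDerivAt_radial h).fderiv]
  simp [EuclideanSpace.inner_single_right]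
  ring

lemma partialDeriv_partialDeriv_radial {F F' : ℝ → ℝ} {F'' : ℝ} {x : Plane}
    (h : ∀ q, 0 ≤ q → HasDerivAt F (F' q) q) (h' : HasDerivAt F' F'' (‖x‖ ^ 2)) (i j : Fin 2) :
    partialDeriv j (partialDeriv i (fun x : Plane => F (‖x‖ ^ 2))) x =
      2 * (if i = j then 1 else 0) * F' (‖x‖ ^ 2) + 4 * x i * x j * F'' := by
  have e : partialDeriv i (fun x : Plane => F (‖x‖ ^ 2)) = fun x => 2 * x i * F' (‖x‖ ^ 2) :=
    funext fun x => partialDeriv_radial (h _ (by positivity)) i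
  have h1 : HasFDerivAt (fun x : Plane => 2 * x i)
      ((2 : ℝ) • (EuclideanSpace.proj i : Plane →L[ℝ] ℝ)) x :=
    ((EuclideanSpace.proj i : Plane →L[ℝ] ℝ).hasFDerivAt).const_mul 2
  have h2 := h1.mul (hasFDerivAt_radial h')
  rw [e, partialDeriv]
  erw [h2.fderiv]
  simp [EuclideanSpace.inner_single_right]
  split_ifs <;> ring

/-- The test functions approximating `K₀`, as functions of the squared radius. -/
def testProfile (ε δ q : ℝ) : ℝ := truncation ε (besselSqrt (q + δ ^ 2))

/-- The derivative of `testProfile`. -/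
def testProfileD (ε δ q : ℝ) : ℝ :=
  -(Real.smoothTransition (besselSqrt (q + δ ^ 2) / ε - 1) * besselSqrtD (q + δ ^ 2))

/-- The second derivative of `testProfile`. -/
def testProfileDD (ε δ q : ℝ) : ℝ :=
  truncationDD ε (besselSqrt (q + δ ^ 2)) * besselSqrtD (q + δ ^ 2) ^ 2 +
    Real.smoothTransition (besselSqrt (q + δ ^ 2) / ε - 1) * besselSqrtDD (q + δ ^ 2)

/-- The test functions approximating `K₀`. -/
def testFunction (ε δ : ℝ) (x : Plane) : ℝ := testProfile ε δ (‖x‖ ^ 2)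

variable {ε δ q : ℝ}

lemma hasDerivAt_besselSqrt_add (hq : 0 < q + δ ^ 2) :
    HasDerivAt (fun q => besselSqrt (q + δ ^ 2)) (-besselSqrtD (q + δ ^ 2)) q :=
  (hasDerivAt_besselSqrt hq).comp_add_const q _

lemma hasDerivAt_testProfile (ε : ℝ) (hq : 0 < q + δ ^ 2) :
    HasDerivAt (testProfile ε δ) (testProfileD ε δ q) q :=
  ((hasDerivAt_truncation ε _).comp q (hasDerivAt_besselSqrt_add hq)).congr_deriv
    (by rw [testProfileD]; ring)

lemma hasDerivAt_testProfileD (ε : ℝ) (hq : 0 < q + δ ^ 2) :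
    HasDerivAt (testProfileD ε δ) (testProfileDD ε δ q) q := by
  have h1 := (hasDerivAt_truncationD ε _).comp q (hasDerivAt_besselSqrt_add hq)
  have h2 := (hasDerivAt_besselSqrtD hq).comp_add_const q (δ ^ 2)
  refine (h1.mul h2).neg.congr_deriv ?_
  rw [testProfileDD]
  simp only [Function.comp]
  ring

lemma contDiff_testFunction (ε : ℝ) (hδ : 0 < δ) : ContDiff ℝ ∞ (testFunction ε δ) := by
  refine contDiff_iff_contDiffAt.2 fun x => ?_
  refine (contDiff_truncation ε).contDiffAt.comp x ?_
  refine ContDiffAt.comp (f := fun x : Plane => ‖x‖ ^ 2 + δ ^ 2) x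
    (contDiffAt_besselSqrt (by positivity)) ?_
  exact ((contDiff_norm_sq ℝ).contDiffAt).add contDiffAt_const

lemma besselSqrt_le (hq : 0 < q) : besselSqrt q ≤ 4 / q :=
  (besselMoment_zero_le (Real.sqrt_pos.2 hq)).trans_eq (by rw [Real.sq_sqrt hq.le])

lemma besselSqrt_norm_le (hε : 0 < ε) (hδ : 0 < δ) {x : Plane}
    (hx : x ∉ Metric.closedBall (0 : Plane) (4 / ε + 1)) : besselSqrt (‖x‖ ^ 2 + δ ^ 2) ≤ ε := by
  rw [mem_closedBall_zero_iff, not_le] at hx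
  have h0 : 0 < 4 / ε := by positivity
  have hq : 0 < ‖x‖ ^ 2 + δ ^ 2 := by positivity
  refine (besselSqrt_le hq).trans ?_
  rw [div_le_iff₀ hq]
  -- The `+ 1` in the radius ensures `‖x‖ ≥ 1`, hence `‖x‖² ≥ ‖x‖`.
  have h1 : 4 / ε ≤ ‖x‖ ^ 2 + δ ^ 2 := by nlinarith [sq_nonneg δ]
  rwa [div_le_iff₀ hε, mul_comm] at h1

lemma hasCompactSupport_testFunction (hε : 0 < ε) (hδ : 0 < δ) :
    HasCompactSupport (testFunction ε δ) :=
  HasCompactSupport.intro (isCompact_closedBall (0 : Plane) (4 / ε + 1)) fun _ hx =>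
    truncation_eq_zero hε (besselSqrt_nonneg _) (besselSqrt_norm_le hε hδ hx)

lemma partialDeriv_testFunction (ε : ℝ) (hδ : 0 < δ) (i : Fin 2) (x : Plane) :
    partialDeriv i (testFunction ε δ) x = 2 * x i * testProfileD ε δ (‖x‖ ^ 2) :=
  partialDeriv_radial (hasDerivAt_testProfile ε (by positivity)) i

lemma partialDeriv_partialDeriv_testFunction (ε : ℝ) (hδ : 0 < δ) (i j : Fin 2) (x : Plane) :
    partialDeriv j (partialDeriv i (testFunction ε δ)) x =
      2 * (if i = j then 1 else 0) * testProfileD ε δ (‖x‖ ^ 2) +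
        4 * x i * x j * testProfileDD ε δ (‖x‖ ^ 2) :=
  partialDeriv_partialDeriv_radial (fun q hq => hasDerivAt_testProfile ε (by positivity))
    (hasDerivAt_testProfileD ε (by positivity)) i j

/-- The truncation is convex, so its second derivative contributes with the favourable sign and can
be dropped. -/
lemma le_testProfileDD (hε : 0 < ε) (δ q : ℝ) :
    Real.smoothTransition (besselSqrt (q + δ ^ 2) / ε - 1) * besselSqrtDD (q + δ ^ 2) ≤
      testProfileDD ε δ q :=
  le_add_of_nonneg_left (mul_nonneg (truncationDD_nonneg hε _) (sq_nonneg _))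

/-- The convexity of `K₀` in the radial direction survives in the test functions up to an error
concentrated near the origin. -/
lemma le_radial_testProfile (hε : 0 < ε) (hδ : 0 < δ) (hq : 0 ≤ q) :
    -(6 * δ ^ 2 / (q + δ ^ 2) ^ 2) ≤ 2 * testProfileD ε δ q + 4 * q * testProfileDD ε δ q := by
  have hQ : 0 < q + δ ^ 2 := by positivity
  have h1 := le_testProfileDD hε δ q
  have h2 := besselSqrt_convex hQ
  have h3 := besselSqrtDD_le hQ
  have h4 := besselSqrtDD_nonneg hQ
  rw [testProfileD]
  set σ := Real.smoothTransition (besselSqrt (q + δ ^ 2) / ε - 1)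
  have hσ0 : 0 ≤ σ := Real.smoothTransition.nonneg _
  have hσ1 : σ ≤ 1 := Real.smoothTransition.le_one _
  -- The profile is evaluated at `q + δ²` but multiplied by `4 q`; the missing `4 δ²` times the
  -- second derivative costs at most `4 · (3/2) = 6`.
  have h5 : 6 * δ ^ 2 / (q + δ ^ 2) ^ 2 = 4 * δ ^ 2 * (3 / 2 / (q + δ ^ 2) ^ 2) := by
    field_simp; norm_num
  rw [h5]
  have h6 : 4 * δ ^ 2 * (σ * besselSqrtDD (q + δ ^ 2)) ≤
      4 * δ ^ 2 * (3 / 2 / (q + δ ^ 2) ^ 2) := by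
    gcongr
    exact (mul_le_of_le_one_left h4 hσ1).trans h3
  have h7 : 4 * q * (σ * besselSqrtDD (q + δ ^ 2)) ≤ 4 * q * testProfileDD ε δ q := by gcongr
  have h8 := mul_nonneg hσ0 h2
  linarith

/-- `Δ K₀ = K₀` survives in the test functions up to an error concentrated near the origin. -/
lemma le_laplacian_testProfile (hε : 0 < ε) (hδ : 0 < δ) (hq : 0 ≤ q) :
    Real.smoothTransition (besselSqrt (q + δ ^ 2) / ε - 1) * besselSqrt (q + δ ^ 2) -
      6 * δ ^ 2 / (q + δ ^ 2) ^ 2 ≤ 4 * testProfileD ε δ q + 4 * q * testProfileDD ε δ q := by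
  have hQ : 0 < q + δ ^ 2 := by positivity
  have h1 := le_testProfileDD hε δ q
  have h2 := besselSqrt_ode hQ
  have h3 := besselSqrtDD_le hQ
  have h4 := besselSqrtDD_nonneg hQ
  rw [testProfileD]
  set σ := Real.smoothTransition (besselSqrt (q + δ ^ 2) / ε - 1)
  have hσ0 : 0 ≤ σ := Real.smoothTransition.nonneg _
  have hσ1 : σ ≤ 1 := Real.smoothTransition.le_one _
  have h5 : 6 * δ ^ 2 / (q + δ ^ 2) ^ 2 = 4 * δ ^ 2 * (3 / 2 / (q + δ ^ 2) ^ 2) := by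
    field_simp; norm_num
  rw [h5]
  have h6 : 4 * δ ^ 2 * (σ * besselSqrtDD (q + δ ^ 2)) ≤
      4 * δ ^ 2 * (3 / 2 / (q + δ ^ 2) ^ 2) := by
    gcongr
    exact (mul_le_of_le_one_left h4 hσ1).trans h3
  have h7 : 4 * q * (σ * besselSqrtDD (q + δ ^ 2)) ≤ 4 * q * testProfileDD ε δ q := by gcongr
  rw [← h2] at *
  linarith

end TestFunction

/-! ### Lower bound for the second time derivative of the weighted mass. -/

section Stress

variable {A γ T : ℝ} {ρ : ℝ → Plane → ℝ} {u : ℝ → Plane → Plane}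

/-- The kinetic stress plus the pressure. -/
def stress (A γ : ℝ) (ρ : ℝ → Plane → ℝ) (u : ℝ → Plane → Plane) (t : ℝ) (x : Plane) : ℝ :=
  ρ t x * ‖u t x‖ ^ 2 + pressure A γ (ρ t x)

lemma pressure_nonneg (hA : 0 < A) {r : ℝ} (hr : 0 ≤ r) : 0 ≤ pressure A γ r :=
  mul_nonneg hA.le (Real.rpow_nonneg hr _)

lemma pressure_zero (hγ : 1 < γ) : pressure A γ 0 = 0 := by
  rw [pressure, Real.zero_rpow (by linarith), mul_zero]

lemma IsSolution.continuousOn_stress (h : IsSolution A γ T ρ u) (hγ : 1 < γ) :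
    ContinuousOn (fun z : ℝ × Plane => stress A γ ρ u z.1 z.2) (Ico 0 T ×ˢ univ) :=
  (h.density_continuous.mul (h.velocity_continuous.norm.pow 2)).add (h.continuousOn_pressure hγ)

lemma IsSolution.stress_nonneg (h : IsSolution A γ T ρ u) (hA : 0 < A) {t : ℝ} (ht : t ∈ Ico 0 T)
    (x : Plane) : 0 ≤ stress A γ ρ u t x :=
  add_nonneg (mul_nonneg (h.density_nonneg t ht x) (sq_nonneg _))
    (pressure_nonneg hA (h.density_nonneg t ht x))

/-- Density, velocity, pressure and stress are bounded on compact time intervals. -/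
lemma IsSolution.exists_bound (h : IsSolution A γ T ρ u) (hA : 0 < A) (hγ : 1 < γ) {b : ℝ}
    (hb : b < T) : ∃ W, 0 ≤ W ∧ ∀ t ∈ Icc 0 b, ∀ x, ρ t x ≤ W ∧ ‖u t x‖ ≤ W ∧
      pressure A γ (ρ t x) ≤ W ∧ stress A γ ρ u t x ≤ W := by
  obtain ⟨C, hC⟩ := (h.isRegular_soundSpeed hγ).bound b hb
  obtain ⟨D, hD⟩ := h.isRegular_velocity.bound b hb
  have hs : 0 < Real.sqrt (A * γ) := Real.sqrt_pos.2 (by nlinarith)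
  set R := (max C 0 / Real.sqrt (A * γ)) ^ (2 / (γ - 1)) with hR
  have hR0 : 0 ≤ R := by positivity
  have hρ : ∀ t ∈ Icc 0 b, ∀ x, 0 ≤ ρ t x ∧ ρ t x ≤ R := by
    intro t ht x
    have h0 := h.density_nonneg t ⟨ht.1, ht.2.trans_lt hb⟩ x
    refine ⟨h0, ?_⟩
    rw [rpow_soundSpeed hA hγ h0]
    have h1 := soundSpeed_nonneg A γ h0
    have h2 := (le_abs_self _).trans (hC t ht x)
    refine Real.rpow_le_rpow (by positivity) ?_ (div_nonneg zero_le_two (by linarith))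
    gcongr
    exact h2.trans (le_max_left _ _)
  have hp : ∀ t ∈ Icc 0 b, ∀ x, pressure A γ (ρ t x) ≤ A * R ^ γ := by
    intro t ht x
    obtain ⟨h1, h2⟩ := hρ t ht x
    unfold pressure
    gcongr
  have hu : ∀ t ∈ Icc 0 b, ∀ x, ‖u t x‖ ≤ max D 0 := fun t ht x =>
    (hD t ht x).trans (le_max_left _ _)
  have hP : 0 ≤ A * R ^ γ := by positivity
  have hU : 0 ≤ max D 0 := le_max_right _ _
  have hRU : 0 ≤ R * max D 0 ^ 2 := by positivity
  refine ⟨R + max D 0 + A * R ^ γ + R * max D 0 ^ 2, by positivity, fun t ht x => ?_⟩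
  obtain ⟨h1, h2⟩ := hρ t ht x
  have h3 := hp t ht x
  have h4 := hu t ht x
  refine ⟨by linarith, by linarith, by linarith, ?_⟩
  have h5 : ρ t x * ‖u t x‖ ^ 2 ≤ R * max D 0 ^ 2 := by gcongr
  unfold stress
  linarith

/-- The concentrated part of the error, up to scaling. -/
def stressError (A γ : ℝ) (ρ : ℝ → Plane → ℝ) (u : ℝ → Plane → Plane) (δ t : ℝ) : ℝ :=
  6 * ∫ y, weight y * stress A γ ρ u t (δ • y)

lemma IsSolution.continuous_stress (h : IsSolution A γ T ρ u) (hγ : 1 < γ) {t : ℝ}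
    (ht : t ∈ Ico 0 T) : Continuous (stress A γ ρ u t) :=
  ((h.continuous_slice ht).mul ((h.continuous_velocity_slice ht).norm.pow 2)).add
    (continuous_const.mul ((h.continuous_slice ht).rpow_const fun _ => Or.inr (by linarith)))

lemma IsSolution.abs_stress_le (h : IsSolution A γ T ρ u) (hA : 0 < A) {b W : ℝ} (hb : b < T)
    (hW : ∀ t ∈ Icc 0 b, ∀ x, stress A γ ρ u t x ≤ W) {t : ℝ} (ht : t ∈ Icc 0 b) (x : Plane) :
    |stress A γ ρ u t x| ≤ W := by
  rw [abs_of_nonneg (h.stress_nonneg hA ⟨ht.1, ht.2.trans_lt hb⟩ x)]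
  exact hW t ht x

/-- The substitution `x = δ y`: in the plane the kernel has mass independent of `δ` and concentrates
at the origin. -/
lemma IsSolution.integrable_stress (h : IsSolution A γ T ρ u) (hA : 0 < A) (hγ : 1 < γ) {δ : ℝ}
    (hδ : 0 < δ) {t : ℝ} (ht : t ∈ Ico 0 T) :
    Integrable (fun x => 6 * δ ^ 2 / (‖x‖ ^ 2 + δ ^ 2) ^ 2 * stress A γ ρ u t x) ∧
    ∫ x, 6 * δ ^ 2 / (‖x‖ ^ 2 + δ ^ 2) ^ 2 * stress A γ ρ u t x = stressError A γ ρ u δ t := by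
  obtain ⟨W, hW0, hW⟩ := h.exists_bound hA hγ ht.2
  have hi : Integrable fun y => weight y * stress A γ ρ u t (δ • y) :=
    integrable_weight_mul (C := W)
      ((h.continuous_stress hγ ht).comp (continuous_const_smul δ)).aestronglyMeasurable
      fun y => h.abs_stress_le hA ht.2 (fun t ht x => (hW t ht x).2.2.2) ⟨ht.1, le_rfl⟩ _
  set f : Plane → ℝ := fun x => weight (δ⁻¹ • x) * stress A γ ρ u t x with hf
  have hfy : (fun y => f (δ • y)) = fun y => weight y * stress A γ ρ u t (δ • y) := by
    ext y; simp only [hf, smul_smul, inv_mul_cancel₀ hδ.ne', one_smul]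
  have hfe : (fun x => 6 * δ ^ 2 / (‖x‖ ^ 2 + δ ^ 2) ^ 2 * stress A γ ρ u t x) =
      fun x => 6 / δ ^ 2 * f x := by
    ext x
    simp only [hf, weight, norm_smul, norm_inv, Real.norm_of_nonneg hδ.le]
    field_simp
    ring
  rw [← hfy] at hi
  rw [hfe]
  refine ⟨((integrable_comp_smul_iff volume f hδ.ne').1 hi).const_mul _, ?_⟩
  rw [integral_const_mul, stressError, ← hfy, Measure.integral_comp_smul]
  simp only [finrank_euclideanSpace, Fintype.card_fin, smul_eq_mul]
  rw [abs_of_pos (by positivity)]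
  field_simp

lemma IsSolution.continuousOn_stressError (h : IsSolution A γ T ρ u) (hA : 0 < A) (hγ : 1 < γ)
    (δ : ℝ) {b : ℝ} (hb : b < T) : ContinuousOn (stressError A γ ρ u δ) (Icc 0 b) := by
  obtain ⟨W, hW0, hW⟩ := h.exists_bound hA hγ hb
  refine continuousOn_const.mul (continuousOn_of_dominated (bound := fun x => weight x * W)
    (fun s hs => ?_) (fun s hs => Eventually.of_forall fun x => ?_)
    (integrable_weight.mul_const _) (Eventually.of_forall fun x => ?_))
  · exact (continuous_weight.mul ((h.continuous_stress hγ ⟨hs.1, hs.2.trans_lt hb⟩).comp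
      (continuous_const_smul δ))).aestronglyMeasurable
  · rw [norm_mul, Real.norm_of_nonneg (weight_pos x).le]
    exact mul_le_mul_of_nonneg_left
      (h.abs_stress_le hA hb (fun t ht x => (hW t ht x).2.2.2) hs _) (weight_pos x).le
  · have : ContinuousOn (fun t : ℝ => ((t, δ • x) : ℝ × Plane)) (Icc 0 b) := by fun_prop
    exact continuousOn_const.mul ((h.continuousOn_stress hγ).comp this fun t ht =>
      ⟨⟨ht.1, ht.2.trans_lt hb⟩, mem_univ _⟩)

lemma IsSolution.abs_stressError_le (h : IsSolution A γ T ρ u) (hA : 0 < A) {b W : ℝ} (hb : b < T)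
    (hW : ∀ t ∈ Icc 0 b, ∀ x, stress A γ ρ u t x ≤ W) (δ : ℝ) {t : ℝ} (ht : t ∈ Icc 0 b) :
    |stressError A γ ρ u δ t| ≤ 6 * ∫ y, weight y * W := by
  rw [stressError, abs_mul, abs_of_pos (by norm_num : (0 : ℝ) < 6), ← Real.norm_eq_abs]
  gcongr
  refine norm_integral_le_of_norm_le (integrable_weight.mul_const _)
    (Eventually.of_forall fun x => ?_)
  rw [norm_mul, Real.norm_of_nonneg (weight_pos x).le]
  exact mul_le_mul_of_nonneg_left (h.abs_stress_le hA hb hW ht _) (weight_pos x).le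

/-- The limit is a multiple of the stress at the origin, which is zero there. This is how the vacuum
removes the point mass of `ΔK₀`. -/
lemma IsSolution.tendsto_stressError (h : IsSolution A γ T ρ u) (hA : 0 < A) (hγ : 1 < γ) {t : ℝ}
    (ht : t ∈ Ico 0 T) (hvac : ρ t 0 = 0) {δ : ℕ → ℝ} (hδ : Tendsto δ atTop (𝓝 0)) :
    Tendsto (fun n => stressError A γ ρ u (δ n) t) atTop (𝓝 0) := by
  obtain ⟨W, hW0, hW⟩ := h.exists_bound hA hγ ht.2
  have h0 : stress A γ ρ u t 0 = 0 := by simp [stress, hvac, pressure_zero hγ]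
  have := tendsto_integral_of_dominated_convergence (μ := volume)
    (F := fun n y => weight y * stress A γ ρ u t (δ n • y)) (f := fun _ => 0)
    (fun y => weight y * W)
    (fun n => (continuous_weight.mul ((h.continuous_stress hγ ht).comp
      (continuous_const_smul (δ n)))).aestronglyMeasurable)
    (integrable_weight.mul_const _) (fun n => Eventually.of_forall fun x => ?_)
    (Eventually.of_forall fun y => ?_)
  · simpa [stressError] using this.const_mul 6
  · rw [norm_mul, Real.norm_of_nonneg (weight_pos x).le]
    exact mul_le_mul_of_nonneg_left (h.abs_stress_le hA ht.2 (fun t ht x => (hW t ht x).2.2.2)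
      ⟨ht.1, le_rfl⟩ _) (weight_pos x).le
  · have h1 : Tendsto (fun n => δ n • y) atTop (𝓝 0) := by
      simpa using hδ.smul_const y
    have h2 := ((h.continuous_stress hγ ht).tendsto 0).comp h1
    rw [h0] at h2
    simpa using h2.const_mul (weight y)

/-- The regularized kernel that multiplies the pressure. -/
def testKernel (ε δ : ℝ) (x : Plane) : ℝ :=
  Real.smoothTransition (besselSqrt (‖x‖ ^ 2 + δ ^ 2) / ε - 1) * besselSqrt (‖x‖ ^ 2 + δ ^ 2)

lemma continuous_besselSqrt_norm {δ : ℝ} (hδ : 0 < δ) :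
    Continuous fun x : Plane => besselSqrt (‖x‖ ^ 2 + δ ^ 2) :=
  continuousOn_besselSqrt.comp_continuous (by fun_prop) fun x => by
    rw [mem_Ioi]; positivity

lemma continuous_testKernel (ε : ℝ) {δ : ℝ} (hδ : 0 < δ) : Continuous (testKernel ε δ) := by
  have h1 := continuous_besselSqrt_norm hδ
  exact (Real.smoothTransition.continuous.comp (by fun_prop)).mul h1

lemma hasCompactSupport_testKernel {ε δ : ℝ} (hε : 0 < ε) (hδ : 0 < δ) :
    HasCompactSupport (testKernel ε δ) :=
  HasCompactSupport.intro (isCompact_closedBall (0 : Plane) (4 / ε + 1)) fun x hx => by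
    rw [testKernel, Real.smoothTransition.zero_of_nonpos, zero_mul]
    rw [sub_nonpos, div_le_one hε]
    exact besselSqrt_norm_le hε hδ hx

/-- For radial flows the second derivative of `∫ ρ χ`, for the regularized `K₀`, is bounded below
by the weighted pressure. -/
lemma IsSolution.le_massAccel_testFunction (h : IsSolution A γ T ρ u) (hA : 0 < A) (hγ : 1 < γ)
    {ε δ : ℝ} (hε : 0 < ε) (hδ : 0 < δ) {t : ℝ} (ht : t ∈ Ico 0 T)
    (hrad : ∀ x, 0 < ρ t x → u t x ∈ Submodule.span ℝ {x}) :
    (∫ x, pressure A γ (ρ t x) * testKernel ε δ x) - stressError A γ ρ u δ t ≤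
      massAccel A γ ρ u (testFunction ε δ) t := by
  have hρc := h.continuous_slice ht
  have huc : ∀ i, Continuous fun x => u t x i := fun i =>
    (EuclideanSpace.proj i : Plane →L[ℝ] ℝ).continuous.comp (h.continuous_velocity_slice ht)
  have hpc : Continuous fun x => pressure A γ (ρ t x) :=
    continuous_const.mul (hρc.rpow_const fun _ => Or.inr (by linarith))
  have hs := contDiff_testFunction ε hδ
  have hc := hasCompactSupport_testFunction hε hδ
  have hD : ∀ i j, Continuous (partialDeriv j (partialDeriv i (testFunction ε δ))) := fun i j =>
    (contDiff_partialDeriv (contDiff_partialDeriv hs i) j).continuous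
  have hDc : ∀ i j, HasCompactSupport (partialDeriv j (partialDeriv i (testFunction ε δ))) :=
    fun i j => hasCompactSupport_partialDeriv (hasCompactSupport_partialDeriv hc i) j
  have hint : ∀ {f g : Plane → ℝ}, Continuous f → Continuous g → HasCompactSupport g →
      Integrable fun x => f x * g x := fun hf hg hgc =>
    (hf.mul hg).integrable_of_hasCompactSupport hgc.mul_left
  have i1 : ∀ i j, Integrable fun x => ρ t x * u t x i * u t x j *
      partialDeriv j (partialDeriv i (testFunction ε δ)) x := fun i j =>
    hint ((hρc.mul (huc i)).mul (huc j)) (hD i j) (hDc i j)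
  have i2 : ∀ i, Integrable fun x => pressure A γ (ρ t x) *
      partialDeriv i (partialDeriv i (testFunction ε δ)) x := fun i => hint hpc (hD i i) (hDc i i)
  have i3 := fun i => (integrable_finsetSum Finset.univ fun j _ => i1 i j).fun_add (i2 i)
  have e : massAccel A γ ρ u (testFunction ε δ) t = ∫ x, ∑ i, ((∑ j, ρ t x * u t x i * u t x j *
      partialDeriv j (partialDeriv i (testFunction ε δ)) x) + pressure A γ (ρ t x) *
      partialDeriv i (partialDeriv i (testFunction ε δ)) x) := by
    rw [integral_finsetSum _ fun i _ => i3 i, massAccel]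
    refine Finset.sum_congr rfl fun i _ => ?_
    rw [integral_add (integrable_finsetSum Finset.univ fun j _ => i1 i j) (i2 i),
      integral_finsetSum _ fun j _ => i1 i j]
  obtain ⟨i4, e4⟩ := h.integrable_stress hA hγ hδ ht
  have i5 : Integrable fun x => pressure A γ (ρ t x) * testKernel ε δ x :=
    hint hpc (continuous_testKernel ε hδ) (hasCompactSupport_testKernel hε hδ)
  rw [e, ← e4, ← integral_sub i5 i4]
  refine integral_mono (i5.sub i4) (integrable_finsetSum _ fun i _ => i3 i) fun x => ?_
  have hq : 0 ≤ ‖x‖ ^ 2 := by positivity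
  have k1 := le_radial_testProfile hε hδ hq
  have k2 := le_laplacian_testProfile hε hδ hq
  have hρ0 := h.density_nonneg t ht x
  have hp0 := pressure_nonneg (γ := γ) hA hρ0
  have hn : ‖x‖ ^ 2 = x 0 ^ 2 + x 1 ^ 2 := by
    rw [EuclideanSpace.real_norm_sq_eq, Fin.sum_univ_two]
  simp only [partialDeriv_partialDeriv_testFunction ε hδ, Fin.sum_univ_two, stress]
  change pressure A γ (ρ t x) * (Real.smoothTransition (besselSqrt (‖x‖ ^ 2 + δ ^ 2) / ε - 1) *
    besselSqrt (‖x‖ ^ 2 + δ ^ 2)) - _ ≤ _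
  rcases hρ0.eq_or_lt with h0 | h0
  · rw [← h0, pressure_zero hγ]
    simp
  -- With `u = a x` the Hessian is tested only in the radial direction: the kinetic part is `ρ a²
  -- |x|²` times the radial second derivative, and the pressure part is `p` times the Laplacian.
  · obtain ⟨a, ha⟩ := Submodule.mem_span_singleton.1 (hrad x h0)
    have hu2 : ‖u t x‖ ^ 2 = a ^ 2 * ‖x‖ ^ 2 := by
      rw [← ha, norm_smul, mul_pow, Real.norm_eq_abs, sq_abs]
    have hui : ∀ i, u t x i = a * x i := fun i => by rw [← ha]; simp
    rw [hu2, hui, hui]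
    have m1 := mul_le_mul_of_nonneg_left k1 (by positivity : 0 ≤ ρ t x * (a ^ 2 * ‖x‖ ^ 2))
    have m2 := mul_le_mul_of_nonneg_left k2 hp0
    simp only [if_true, Fin.isValue, zero_ne_one, one_ne_zero, if_false]
    generalize 6 * δ ^ 2 / (‖x‖ ^ 2 + δ ^ 2) ^ 2 = E at *
    generalize testProfileD ε δ (‖x‖ ^ 2) = F1 at *
    generalize testProfileDD ε δ (‖x‖ ^ 2) = F2 at *
    generalize Real.smoothTransition (besselSqrt (‖x‖ ^ 2 + δ ^ 2) / ε - 1) *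
      besselSqrt (‖x‖ ^ 2 + δ ^ 2) = k at *
    rw [hn] at *
    linarith

end Stress

/-! ### Removal of the regularization. -/

section Limit

/-- A sequence of regularization parameters. -/
def regScale (n : ℕ) : ℝ := 1 / ((n : ℝ) + 1)

lemma regScale_pos (n : ℕ) : 0 < regScale n := Nat.one_div_pos_of_nat

lemma tendsto_regScale : Tendsto regScale atTop (𝓝 0) := tendsto_one_div_add_atTop_nhds_zero_nat

lemma besselSqrt_norm_sq (x : Plane) : besselSqrt (‖x‖ ^ 2) = besselMoment 0 ‖x‖ := by
  rw [besselSqrt, Real.sqrt_sq (norm_nonneg x)]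

lemma norm_le_sqrt_add (x : Plane) (δ : ℝ) : ‖x‖ ≤ Real.sqrt (‖x‖ ^ 2 + δ ^ 2) :=
  Real.le_sqrt_of_sq_le (by nlinarith [sq_nonneg δ])

lemma besselSqrt_add_le {x : Plane} (hx : x ≠ 0) (δ : ℝ) :
    besselSqrt (‖x‖ ^ 2 + δ ^ 2) ≤ besselMoment 0 ‖x‖ :=
  besselMoment_anti 0 (norm_pos_iff.2 hx) (norm_le_sqrt_add x δ)

lemma tendsto_norm_sq_add (x : Plane) :
    Tendsto (fun n => ‖x‖ ^ 2 + regScale n ^ 2) atTop (𝓝 (‖x‖ ^ 2)) := by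
  simpa using (tendsto_regScale.pow 2).const_add (‖x‖ ^ 2)

lemma tendsto_besselSqrt {x : Plane} (hx : x ≠ 0) :
    Tendsto (fun n => besselSqrt (‖x‖ ^ 2 + regScale n ^ 2)) atTop (𝓝 (besselMoment 0 ‖x‖)) := by
  have hq : 0 < ‖x‖ ^ 2 := by have := norm_pos_iff.2 hx; positivity
  rw [← besselSqrt_norm_sq]
  exact (hasDerivAt_besselSqrt hq).continuousAt.tendsto.comp (tendsto_norm_sq_add x)

/-- Away from the origin the kernel tends to the positive number `K₀(|x|)`, while the truncation
level tends to `0`. -/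
lemma eventually_smoothTransition_eq_one {x : Plane} (hx : x ≠ 0) :
    ∀ᶠ n in atTop, Real.smoothTransition
      (besselSqrt (‖x‖ ^ 2 + regScale n ^ 2) / regScale n - 1) = 1 := by
  have hK := besselMoment_pos 0 (norm_pos_iff.2 hx)
  filter_upwards [(tendsto_besselSqrt hx).eventually_const_lt (half_lt_self hK),
    tendsto_regScale.eventually_lt_const (by positivity : 0 < besselMoment 0 ‖x‖ / 4)] with n h1 h2
  refine Real.smoothTransition.one_of_one_le ?_
  rw [le_sub_iff_add_le, le_div_iff₀ (regScale_pos n)]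
  linarith

lemma testFunction_nonneg (ε δ : ℝ) (x : Plane) : 0 ≤ testFunction ε δ x :=
  truncation_nonneg ε (besselSqrt_nonneg _)

lemma testFunction_le (ε δ : ℝ) {x : Plane} (hx : x ≠ 0) :
    testFunction ε δ x ≤ besselMoment 0 ‖x‖ :=
  (truncation_le ε (besselSqrt_nonneg _)).trans (besselSqrt_add_le hx δ)

lemma tendsto_testFunction {x : Plane} (hx : x ≠ 0) :
    Tendsto (fun n => testFunction (regScale n) (regScale n) x) atTop
      (𝓝 (besselMoment 0 ‖x‖)) := by
  have h1 := (tendsto_besselSqrt hx).sub (tendsto_regScale.const_mul 2)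
  rw [mul_zero, sub_zero] at h1
  refine tendsto_of_tendsto_of_tendsto_of_le_of_le h1 (tendsto_besselSqrt hx)
    (fun n => ?_) fun n => truncation_le _ (besselSqrt_nonneg _)
  have := le_truncation_add (regScale_pos n) (besselSqrt_nonneg (‖x‖ ^ 2 + regScale n ^ 2))
  rw [testFunction, testProfile]
  simp only
  linarith

lemma testKernel_nonneg (ε δ : ℝ) (x : Plane) : 0 ≤ testKernel ε δ x :=
  mul_nonneg (Real.smoothTransition.nonneg _) (besselSqrt_nonneg _)

lemma testKernel_le (ε δ : ℝ) {x : Plane} (hx : x ≠ 0) : testKernel ε δ x ≤ besselMoment 0 ‖x‖ :=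
  (mul_le_of_le_one_left (besselSqrt_nonneg _) (Real.smoothTransition.le_one _)).trans
    (besselSqrt_add_le hx δ)

lemma tendsto_testKernel {x : Plane} (hx : x ≠ 0) :
    Tendsto (fun n => testKernel (regScale n) (regScale n) x) atTop (𝓝 (besselMoment 0 ‖x‖)) := by
  refine (tendsto_besselSqrt hx).congr' ?_
  filter_upwards [eventually_smoothTransition_eq_one hx] with n hn
  rw [testKernel, hn, one_mul]

/-- Bounds the gradient of the test functions by `-K₀'`, uniformly in the parameters: the cut-off
slope is at most `1` and the moment of order one decreases in the radius. -/
lemma abs_testProfileD_le (ε δ : ℝ) {x : Plane} (hx : x ≠ 0) :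
    2 * ‖x‖ * |testProfileD ε δ (‖x‖ ^ 2)| ≤ besselMoment 1 ‖x‖ := by
  have hx0 := norm_pos_iff.2 hx
  have hq : 0 < ‖x‖ ^ 2 + δ ^ 2 := by positivity
  have hs := Real.sqrt_pos.2 hq
  rw [testProfileD, abs_neg, abs_mul, abs_of_nonneg (Real.smoothTransition.nonneg _),
    abs_of_nonneg (besselSqrtD_nonneg _)]
  have h1 := besselMoment_nonneg 1 (Real.sqrt (‖x‖ ^ 2 + δ ^ 2))
  have h2 := norm_le_sqrt_add x δ
  calc _ ≤ 2 * ‖x‖ * besselSqrtD (‖x‖ ^ 2 + δ ^ 2) := by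
        gcongr
        exact mul_le_of_le_one_left (besselSqrtD_nonneg _) (Real.smoothTransition.le_one _)
    _ ≤ 2 * Real.sqrt (‖x‖ ^ 2 + δ ^ 2) * besselSqrtD (‖x‖ ^ 2 + δ ^ 2) := by
        have := besselSqrtD_nonneg (‖x‖ ^ 2 + δ ^ 2)
        gcongr
    _ = besselMoment 1 (Real.sqrt (‖x‖ ^ 2 + δ ^ 2)) := by
        rw [besselSqrtD]; field_simp
    _ ≤ _ := besselMoment_anti 1 hx0 h2

lemma tendsto_testProfileD {x : Plane} (hx : x ≠ 0) :
    Tendsto (fun n => testProfileD (regScale n) (regScale n) (‖x‖ ^ 2)) atTop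
      (𝓝 (-(besselMoment 1 ‖x‖ / (2 * ‖x‖)))) := by
  have hq : 0 < ‖x‖ ^ 2 := by have := norm_pos_iff.2 hx; positivity
  have h1 := ((hasDerivAt_besselSqrtD hq).continuousAt.tendsto.comp (tendsto_norm_sq_add x)).neg
  rw [besselSqrtD, Real.sqrt_sq (norm_nonneg x)] at h1
  refine h1.congr' ?_
  filter_upwards [eventually_smoothTransition_eq_one hx] with n hn
  rw [testProfileD, hn, one_mul]
  rfl

variable {A γ T : ℝ} {ρ : ℝ → Plane → ℝ} {u : ℝ → Plane → Plane}

lemma massFlux_testFunction (h : IsSolution A γ T ρ u) {ε δ : ℝ} (hε : 0 < ε) (hδ : 0 < δ) {t : ℝ}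
    (ht : t ∈ Ico 0 T) : massFlux ρ u (testFunction ε δ) t =
      ∫ x, ρ t x * (2 * inner ℝ x (u t x) * testProfileD ε δ (‖x‖ ^ 2)) := by
  have huc : ∀ i, Continuous fun x => u t x i := fun i =>
    (EuclideanSpace.proj i : Plane →L[ℝ] ℝ).continuous.comp (h.continuous_velocity_slice ht)
  have hi : ∀ i, Integrable fun x => ρ t x * u t x i * partialDeriv i (testFunction ε δ) x :=
    fun i => Continuous.integrable_of_hasCompactSupport
      (((h.continuous_slice ht).mul (huc i)).mul
        (contDiff_partialDeriv (contDiff_testFunction ε hδ) i).continuous)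
      (hasCompactSupport_partialDeriv (hasCompactSupport_testFunction hε hδ) i).mul_left
  rw [massFlux, ← integral_finsetSum _ fun i _ => hi i]
  refine integral_congr_ae (Eventually.of_forall fun x => ?_)
  simp only [partialDeriv_testFunction ε hδ, PiLp.inner_apply, RCLike.inner_apply, conj_trivial,
    Fin.sum_univ_two]
  ring

lemma continuous_testProfileD (ε : ℝ) {δ : ℝ} (hδ : 0 < δ) :
    Continuous fun x : Plane => testProfileD ε δ (‖x‖ ^ 2) :=
  continuous_iff_continuousAt.2 fun x => ContinuousAt.comp (f := fun x : Plane => ‖x‖ ^ 2)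
    (hasDerivAt_testProfileD ε (by positivity)).continuousAt (by fun_prop)

lemma IsSolution.tendsto_massFlux (h : IsSolution A γ T ρ u) (hA : 0 < A) (hγ : 1 < γ) {t : ℝ}
    (ht : t ∈ Ico 0 T) :
    Tendsto (fun n => massFlux ρ u (testFunction (regScale n) (regScale n)) t) atTop
      (𝓝 (∫ x, ρ t x * (2 * inner ℝ x (u t x) * -(besselMoment 1 ‖x‖ / (2 * ‖x‖))))) := by
  obtain ⟨W, hW0, hW⟩ := h.exists_bound hA hγ ht.2
  simp only [massFlux_testFunction h (regScale_pos _) (regScale_pos _) ht]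
  refine tendsto_integral_of_dominated_convergence (fun x => W * (W * besselMoment 1 ‖x‖))
    (fun n => ?_) ((integrable_besselMoment_one_norm.const_mul _).const_mul _) (fun n => ?_) ?_
  · have h1 := h.continuous_slice ht
    have h2 := h.continuous_velocity_slice ht
    have h3 := continuous_testProfileD (regScale n) (regScale_pos n)
    exact Continuous.aestronglyMeasurable (by fun_prop)
  · filter_upwards [ae_ne_zero] with x hx
    obtain ⟨w1, w2, -⟩ := hW t ⟨ht.1, le_rfl⟩ x
    have h0 := h.density_nonneg t ht x
    have h1 := abs_testProfileD_le (regScale n) (regScale n) hx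
    have h2 := abs_real_inner_le_norm x (u t x)
    have h3 := besselMoment_nonneg 1 ‖x‖
    rw [norm_mul, Real.norm_of_nonneg h0, Real.norm_eq_abs, abs_mul, abs_mul, abs_two]
    calc _ ≤ W * (‖u t x‖ * (2 * ‖x‖ * |testProfileD (regScale n) (regScale n) (‖x‖ ^ 2)|)) := by
          refine mul_le_mul w1 ?_ (by positivity) hW0
          calc _ ≤ 2 * (‖x‖ * ‖u t x‖) * |testProfileD (regScale n) (regScale n) (‖x‖ ^ 2)| := by
                gcongr
            _ = _ := by ring
      _ ≤ _ := by gcongr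
  · filter_upwards [ae_ne_zero] with x hx
    exact ((tendsto_testProfileD hx).const_mul _).const_mul _

/-- `∫ f K₀ dx` at time `t`. -/
def besselAverage (f : ℝ → Plane → ℝ) (t : ℝ) : ℝ := ∫ x, f t x * besselMoment 0 ‖x‖

lemma integrable_mul_besselMoment {f : Plane → ℝ} (hf : Continuous f) {W : ℝ}
    (hW : ∀ x, |f x| ≤ W) : Integrable fun x => f x * besselMoment 0 ‖x‖ := by
  refine (integrable_besselMoment_zero_norm.const_mul W).mono'
    (hf.aestronglyMeasurable.mul (aestronglyMeasurable_besselMoment_norm 0))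
    (Eventually.of_forall fun x => ?_)
  rw [norm_mul, Real.norm_of_nonneg (besselMoment_nonneg 0 _)]
  exact mul_le_mul_of_nonneg_right (hW x) (besselMoment_nonneg 0 _)

lemma continuousOn_besselAverage {f : ℝ → Plane → ℝ}
    (hf : ContinuousOn (fun z : ℝ × Plane => f z.1 z.2) (Ico 0 T ×ˢ univ))
    (hb : ∀ b < T, ∃ W, ∀ t ∈ Icc 0 b, ∀ x, |f t x| ≤ W) :
    ContinuousOn (besselAverage f) (Ico 0 T) := by
  intro t ht
  obtain ⟨b, htb, hbT⟩ := exists_between ht.2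
  obtain ⟨W, hW⟩ := hb b hbT
  have h1 : ContinuousOn (besselAverage f) (Icc 0 b) := by
    refine continuousOn_of_dominated (bound := fun x => W * besselMoment 0 ‖x‖)
      (fun s hs => ?_) (fun s hs => Eventually.of_forall fun x => ?_)
      (integrable_besselMoment_zero_norm.const_mul _) (Eventually.of_forall fun x => ?_)
    · have h2 : ContinuousOn (fun x : Plane => ((s, x) : ℝ × Plane)) univ := by fun_prop
      have h3 : Continuous (f s) := continuousOn_univ.1
        (hf.comp h2 fun x _ => ⟨⟨hs.1, hs.2.trans_lt hbT⟩, mem_univ _⟩)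
      exact (integrable_mul_besselMoment h3 (hW s hs)).aestronglyMeasurable
    · rw [norm_mul, Real.norm_of_nonneg (besselMoment_nonneg 0 _)]
      exact mul_le_mul_of_nonneg_right (hW s hs x) (besselMoment_nonneg 0 _)
    · have h2 : ContinuousOn (fun t : ℝ => ((t, x) : ℝ × Plane)) (Icc 0 b) := by fun_prop
      exact (hf.comp h2 fun s hs => ⟨⟨hs.1, hs.2.trans_lt hbT⟩, mem_univ _⟩).mul
        continuousOn_const
  refine (h1 t ⟨ht.1, htb.le⟩).mono_of_mem_nhdsWithin ?_
  filter_upwards [self_mem_nhdsWithin, mem_nhdsWithin_of_mem_nhds (Iio_mem_nhds htb)] with s h2 h3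
  exact ⟨h2.1, le_of_lt h3⟩

lemma IsSolution.tendsto_integral_testFunction (h : IsSolution A γ T ρ u) (hA : 0 < A) (hγ : 1 < γ)
    {t : ℝ} (ht : t ∈ Ico 0 T) :
    Tendsto (fun n => ∫ x, ρ t x * testFunction (regScale n) (regScale n) x) atTop
      (𝓝 (besselAverage ρ t)) := by
  obtain ⟨W, hW0, hW⟩ := h.exists_bound hA hγ ht.2
  refine tendsto_integral_of_dominated_convergence (fun x => W * besselMoment 0 ‖x‖)
    (fun n => ?_) (integrable_besselMoment_zero_norm.const_mul _) (fun n => ?_) ?_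
  · exact ((h.continuous_slice ht).mul
      (contDiff_testFunction _ (regScale_pos n)).continuous).aestronglyMeasurable
  · filter_upwards [ae_ne_zero] with x hx
    have h0 := h.density_nonneg t ht x
    rw [norm_mul, Real.norm_of_nonneg h0, Real.norm_of_nonneg (testFunction_nonneg _ _ _)]
    exact mul_le_mul (hW t ⟨ht.1, le_rfl⟩ x).1 (testFunction_le _ _ hx)
      (testFunction_nonneg _ _ _) hW0
  · filter_upwards [ae_ne_zero] with x hx
    exact (tendsto_testFunction hx).const_mul _

lemma IsSolution.abs_pressure_le (h : IsSolution A γ T ρ u) (hA : 0 < A) {b W : ℝ} (hb : b < T)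
    (hW : ∀ t ∈ Icc 0 b, ∀ x, pressure A γ (ρ t x) ≤ W) {t : ℝ} (ht : t ∈ Icc 0 b) (x : Plane) :
    |pressure A γ (ρ t x)| ≤ W := by
  rw [abs_of_nonneg (pressure_nonneg hA (h.density_nonneg t ⟨ht.1, ht.2.trans_lt hb⟩ x))]
  exact hW t ht x

lemma norm_pressure_mul_testKernel_le {W p : ℝ} (hp : |p| ≤ W) (ε δ : ℝ) {x : Plane}
    (hx : x ≠ 0) : ‖p * testKernel ε δ x‖ ≤ W * besselMoment 0 ‖x‖ := by
  rw [norm_mul, Real.norm_of_nonneg (testKernel_nonneg ε δ x)]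
  exact mul_le_mul hp (testKernel_le _ _ hx) (testKernel_nonneg _ _ _) ((abs_nonneg _).trans hp)

lemma IsSolution.tendsto_integral_testKernel (h : IsSolution A γ T ρ u) (hA : 0 < A) (hγ : 1 < γ)
    {t : ℝ} (ht : t ∈ Ico 0 T) :
    Tendsto (fun n => ∫ x, pressure A γ (ρ t x) * testKernel (regScale n) (regScale n) x) atTop
      (𝓝 (besselAverage (fun t x => pressure A γ (ρ t x)) t)) := by
  obtain ⟨W, hW0, hW⟩ := h.exists_bound hA hγ ht.2
  have hpc : Continuous fun x => pressure A γ (ρ t x) :=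
    continuous_const.mul ((h.continuous_slice ht).rpow_const fun _ => Or.inr (by linarith))
  refine tendsto_integral_of_dominated_convergence (fun x => W * besselMoment 0 ‖x‖)
    (fun n => (hpc.mul (continuous_testKernel _ (regScale_pos n))).aestronglyMeasurable)
    (integrable_besselMoment_zero_norm.const_mul _) (fun n => ?_) ?_
  · filter_upwards [ae_ne_zero] with x hx
    exact norm_pressure_mul_testKernel_le (h.abs_pressure_le hA ht.2
      (fun t ht x => (hW t ht x).2.2.1) ⟨ht.1, le_rfl⟩ x) _ _ hx
  · filter_upwards [ae_ne_zero] with x hx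
    exact (tendsto_testKernel hx).const_mul _

/-- The integrated form of `(∫ ρ K₀)'' ≥ ∫ p K₀` for radial flows with vacuum at the origin. -/
theorem IsSolution.le_besselAverage (h : IsSolution A γ T ρ u) (hA : 0 < A) (hγ : 1 < γ)
    (hrad : ∀ t ∈ Ico 0 T, ∀ x, 0 < ρ t x → u t x ∈ Submodule.span ℝ {x})
    (hvac : ∀ t ∈ Ico 0 T, ρ t 0 = 0) {t : ℝ} (ht : t ∈ Ico 0 T) :
    besselAverage ρ 0 + ∫ s in (0 : ℝ)..t,
      ((∫ x, ρ 0 x * (2 * inner ℝ x (u 0 x) * -(besselMoment 1 ‖x‖ / (2 * ‖x‖)))) +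
        ∫ r in (0 : ℝ)..s, besselAverage (fun t x => pressure A γ (ρ t x)) r) ≤
      besselAverage ρ t := by
  obtain ⟨W, hW0, hW⟩ := h.exists_bound hA hγ ht.2
  have h0T : (0 : ℝ) ∈ Ico 0 T := ⟨le_rfl, ht.1.trans_lt ht.2⟩
  have hmem : ∀ s ∈ Icc 0 t, s ∈ Ico 0 T := fun s hs => ⟨hs.1, hs.2.trans_lt ht.2⟩
  set f : ℕ → Plane → ℝ := fun n => testFunction (regScale n) (regScale n) with hf
  have hfs : ∀ n, ContDiff ℝ ∞ (f n) := fun n => contDiff_testFunction _ (regScale_pos n)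
  have hfc : ∀ n, HasCompactSupport (f n) := fun n =>
    hasCompactSupport_testFunction (regScale_pos n) (regScale_pos n)
  set q : ℕ → ℝ → ℝ := fun n s =>
    (∫ x, pressure A γ (ρ s x) * testKernel (regScale n) (regScale n) x) -
      stressError A γ ρ u (regScale n) s with hq
  set J := ∫ x, ρ 0 x * (2 * inner ℝ x (u 0 x) * -(besselMoment 1 ‖x‖ / (2 * ‖x‖))) with hJ
  -- A bound for `q n` independent of `n` and of time, for dominated convergence in the time
  -- integrals.
  set C := (∫ x : Plane, W * besselMoment 0 ‖x‖) + 6 * ∫ y, weight y * W with hC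
  have hqc : ∀ n, ContinuousOn (q n) (Icc 0 t) := fun n =>
    ((continuousOn_moment (h.continuousOn_pressure hγ) (continuous_testKernel _ (regScale_pos n))
      (hasCompactSupport_testKernel (regScale_pos n) (regScale_pos n))).mono hmem).sub
      (h.continuousOn_stressError hA hγ _ ht.2)
  have hqb : ∀ n, ∀ s ∈ Icc 0 t, ‖q n s‖ ≤ C := by
    intro n s hs
    refine (norm_sub_le _ _).trans (add_le_add ?_ ?_)
    · refine norm_integral_le_of_norm_le (integrable_besselMoment_zero_norm.const_mul _) ?_
      filter_upwards [ae_ne_zero] with x hx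
      exact norm_pressure_mul_testKernel_le (h.abs_pressure_le hA ht.2
        (fun t ht x => (hW t ht x).2.2.1) hs x) _ _ hx
    · exact h.abs_stressError_le hA ht.2 (fun t ht x => (hW t ht x).2.2.2) _ hs
  have hC0 : 0 ≤ C := (norm_nonneg _).trans (hqb 0 0 ⟨le_rfl, ht.1⟩)
  have hqlim : ∀ s ∈ Icc 0 t, Tendsto (fun n => q n s) atTop
      (𝓝 (besselAverage (fun t x => pressure A γ (ρ t x)) s)) := by
    intro s hs
    have := (h.tendsto_integral_testKernel hA hγ (hmem s hs)).sub
      (h.tendsto_stressError hA hγ (hmem s hs) (hvac s (hmem s hs)) tendsto_regScale)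
    rwa [sub_zero] at this
  have hqi : ∀ n, ∀ s ∈ Icc 0 t, IntervalIntegrable (q n) volume 0 s := fun n s hs =>
    ((hqc n).mono (Icc_subset_Icc_right hs.2)).intervalIntegrable_of_Icc hs.1
  set L : ℕ → ℝ → ℝ := fun n s =>
    massFlux ρ u (f n) 0 + ∫ r in (0 : ℝ)..s, q n r with hL
  have hLc : ∀ n, ContinuousOn (L n) (Icc 0 t) := fun n => by
    have := intervalIntegral.continuousOn_primitive_interval (μ := volume) (f := q n)
      (a := 0) (b := t) (by
        rw [uIcc_of_le ht.1]; exact (hqc n).integrableOn_Icc)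
    rw [uIcc_of_le ht.1] at this
    exact continuousOn_const.add this
  have hLlim : ∀ s ∈ Icc 0 t, Tendsto (fun n => L n s) atTop
      (𝓝 (J + ∫ r in (0 : ℝ)..s, besselAverage (fun t x => pressure A γ (ρ t x)) r)) := by
    intro s hs
    have hsub : ∀ r, r ∈ uIoc 0 s → r ∈ Icc 0 t := fun r hr => by
      rw [uIoc_of_le hs.1] at hr
      exact ⟨hr.1.le, hr.2.trans hs.2⟩
    refine (h.tendsto_massFlux hA hγ h0T).add ?_
    refine intervalIntegral.tendsto_integral_filter_of_dominated_convergence (fun _ => C)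
      (Eventually.of_forall fun n => (hqi n s hs).aestronglyMeasurable_restrict_uIoc)
      (Eventually.of_forall fun n => Eventually.of_forall fun r hr => hqb n r (hsub r hr))
      intervalIntegrable_const (Eventually.of_forall fun r hr => hqlim r (hsub r hr))
  obtain ⟨D, hD⟩ := (h.tendsto_massFlux hA hγ h0T).norm.isBoundedUnder_le.bddAbove_range
  have hLb : ∀ n, ∀ s ∈ Icc 0 t, ‖L n s‖ ≤ D + C * t := by
    intro n s hs
    refine (norm_add_le _ _).trans (add_le_add (hD ⟨n, rfl⟩) ?_)
    refine (intervalIntegral.norm_integral_le_of_norm_le_const fun r hr => ?_).trans ?_ (b := C * |s - 0|)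
    · rw [uIoc_of_le hs.1] at hr
      exact hqb n r ⟨hr.1.le, hr.2.trans hs.2⟩
    · rw [sub_zero, abs_of_nonneg hs.1]
      exact mul_le_mul_of_nonneg_left hs.2 hC0
  have hLi : Tendsto (fun n => ∫ s in (0 : ℝ)..t, L n s) atTop (𝓝 (∫ s in (0 : ℝ)..t,
      (J + ∫ r in (0 : ℝ)..s, besselAverage (fun t x => pressure A γ (ρ t x)) r))) := by
    have hsub : ∀ r, r ∈ uIoc 0 t → r ∈ Icc 0 t := fun r hr => by
      rw [uIoc_of_le ht.1] at hr
      exact Ioc_subset_Icc_self hr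
    exact intervalIntegral.tendsto_integral_filter_of_dominated_convergence (fun _ => D + C * t)
      (Eventually.of_forall fun n =>
        ((hLc n).intervalIntegrable_of_Icc ht.1).aestronglyMeasurable_restrict_uIoc)
      (Eventually.of_forall fun n => Eventually.of_forall fun r hr => hLb n r (hsub r hr))
      intervalIntegrable_const (Eventually.of_forall fun r hr => hLlim r (hsub r hr))
  refine le_of_tendsto_of_tendsto' ((h.tendsto_integral_testFunction hA hγ h0T).add hLi)
    (h.tendsto_integral_testFunction hA hγ ht) fun n => ?_
  -- For each `n` the moment is an exact double time integral of `massAccel`, which is at least `q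
  -- n`.
  rw [h.integral_mul_eq (hfs n) (hfc n) ht]
  gcongr
  refine intervalIntegral.integral_mono_on ht.1 ((hLc n).intervalIntegrable_of_Icc ht.1)
    (((h.continuousOn_massFlux (hfs n) (hfc n)).mono hmem).intervalIntegrable_of_Icc ht.1)
    fun s hs => ?_
  rw [h.massFlux_eq hγ (hfs n) (hfc n) (hmem s hs)]
  simp only [hL]
  gcongr
  refine intervalIntegral.integral_mono_on hs.1 (hqi n s hs)
    (((h.continuousOn_massAccel hγ (hfs n) (hfc n)).mono fun r hr =>
      hmem r ⟨hr.1, hr.2.trans hs.2⟩).intervalIntegrable_of_Icc hs.1) fun r hr => ?_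
  have hr' := hmem r ⟨hr.1, hr.2.trans hs.2⟩
  exact h.le_massAccel_testFunction hA hγ (regScale_pos n) (regScale_pos n) hr' (hrad r hr')

end Limit

/-! ### Jensen's inequality with the Bessel weight. -/

section Jensen

/-- The tangent line of the convex power at `m`, from Bernoulli's inequality for `r / m`. -/
lemma rpow_tangent {γ m r : ℝ} (hγ : 1 < γ) (hm : 0 < m) (hr : 0 ≤ r) :
    m ^ γ + γ * m ^ (γ - 1) * (r - m) ≤ r ^ γ := by
  have h1 := one_add_mul_self_le_rpow_one_add (s := r / m - 1) (by
    have : 0 ≤ r / m := by positivity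
    linarith) hγ.le
  have h2 : (1 + (r / m - 1)) ^ γ = r ^ γ / m ^ γ := by
    rw [add_sub_cancel, Real.div_rpow hr hm.le]
  have h3 : m ^ γ = m ^ (γ - 1) * m := by
    rw [← Real.rpow_add_one hm.ne']; ring_nf
  have hp : 0 < m ^ γ := Real.rpow_pos_of_pos hm _
  rw [h2, le_div_iff₀ hp] at h1
  refine le_trans (le_of_eq ?_) h1
  rw [h3]
  field_simp

lemma besselMass_eq : besselMass = ∫ x : Plane, besselMoment 0 ‖x‖ := by
  rw [besselMass, besselK0_eq]

lemma besselMass_pos : 0 < besselMass := by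
  rw [besselMass_eq]
  refine (integral_pos_iff_support_of_nonneg_ae (Eventually.of_forall fun x =>
    besselMoment_nonneg 0 _) integrable_besselMoment_zero_norm).2 ?_
  have h : {0}ᶜ ⊆ Function.support fun x : Plane => besselMoment 0 ‖x‖ := fun x hx =>
    (besselMoment_pos 0 (norm_pos_iff.2 hx)).ne'
  refine lt_of_lt_of_le ?_ (measure_mono h)
  exact isOpen_compl_singleton.measure_pos volume ⟨EuclideanSpace.single 0 1, by simp⟩

variable {A γ T : ℝ} {ρ : ℝ → Plane → ℝ} {u : ℝ → Plane → Plane}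

lemma IsSolution.besselAverage_nonneg (h : IsSolution A γ T ρ u) {t : ℝ} (ht : t ∈ Ico 0 T) :
    0 ≤ besselAverage ρ t :=
  integral_nonneg fun x => mul_nonneg (h.density_nonneg t ht x) (besselMoment_nonneg 0 _)

lemma IsSolution.integrable_besselAverage (h : IsSolution A γ T ρ u) (hA : 0 < A) (hγ : 1 < γ)
    {t : ℝ} (ht : t ∈ Ico 0 T) : Integrable (fun x => ρ t x * besselMoment 0 ‖x‖) ∧
      Integrable (fun x => pressure A γ (ρ t x) * besselMoment 0 ‖x‖) := by
  obtain ⟨W, hW0, hW⟩ := h.exists_bound hA hγ ht.2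
  have htt : t ∈ Icc 0 t := ⟨ht.1, le_rfl⟩
  refine ⟨integrable_mul_besselMoment (h.continuous_slice ht) (W := W) fun x => ?_,
    integrable_mul_besselMoment (continuous_const.mul
      ((h.continuous_slice ht).rpow_const fun _ => Or.inr (by linarith))) (W := W) fun x => ?_⟩
  · rw [abs_of_nonneg (h.density_nonneg t ht x)]
    exact (hW t htt x).1
  · exact h.abs_pressure_le hA ht.2 (fun t ht x => (hW t ht x).2.2.1) htt x

/-- Jensen's inequality for the pressure. -/
lemma IsSolution.le_besselAverage_pressure (h : IsSolution A γ T ρ u) (hA : 0 < A) (hγ : 1 < γ)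
    {t : ℝ} (ht : t ∈ Ico 0 T) :
    A * besselMass ^ (1 - γ) * besselAverage ρ t ^ γ ≤
      besselAverage (fun t x => pressure A γ (ρ t x)) t := by
  have hB := besselMass_pos
  obtain ⟨i1, i2⟩ := h.integrable_besselAverage hA hγ ht
  rcases (h.besselAverage_nonneg ht).eq_or_lt with h0 | h0
  · rw [← h0, Real.zero_rpow (by linarith), mul_zero]
    exact integral_nonneg fun x => mul_nonneg (pressure_nonneg hA (h.density_nonneg t ht x))
      (besselMoment_nonneg 0 _)
  set G := besselAverage ρ t with hG
  -- The tangent at the weighted mean `m` of the density is integrated; its linear part cancels.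
  set m := G / besselMass with hm
  have hm0 : 0 < m := div_pos h0 hB
  have key : ∫ x, (A * (m ^ γ - γ * m ^ (γ - 1) * m) * besselMoment 0 ‖x‖ +
      A * (γ * m ^ (γ - 1)) * (ρ t x * besselMoment 0 ‖x‖)) ≤
      besselAverage (fun t x => pressure A γ (ρ t x)) t := by
    refine integral_mono ((integrable_besselMoment_zero_norm.const_mul _).add (i1.const_mul _)) i2
      fun x => ?_
    have h1 := rpow_tangent hγ hm0 (h.density_nonneg t ht x)
    have h2 := mul_le_mul_of_nonneg_right (mul_le_mul_of_nonneg_left h1 hA.le)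
      (besselMoment_nonneg 0 ‖x‖)
    simp only [pressure]
    linarith
  rw [integral_add (integrable_besselMoment_zero_norm.const_mul _) (i1.const_mul _),
    integral_const_mul, integral_const_mul, ← besselMass_eq] at key
  refine le_trans (le_of_eq ?_) key
  have e1 : ∫ x, ρ t x * besselMoment 0 ‖x‖ = m * besselMass := by
    rw [hm, div_mul_cancel₀ _ hB.ne', hG, besselAverage]
  have e2 : besselMass ^ (1 - γ) * G ^ γ = m ^ γ * besselMass := by
    rw [hm, Real.div_rpow h0.le hB.le, Real.rpow_sub hB, Real.rpow_one]
    ring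
  rw [e1, mul_assoc, e2]
  ring

end Jensen

/-! ### The differential inequality and the time of blow-up. -/

section Blowup

lemma continuousOn_primitive {P : ℝ → ℝ} {T : ℝ} (hP : ContinuousOn P (Ico 0 T)) :
    ContinuousOn (fun t => ∫ s in (0 : ℝ)..t, P s) (Ico 0 T) := by
  intro t ht
  obtain ⟨b, htb, hb⟩ := exists_between ht.2
  have h1 := intervalIntegral.continuousOn_primitive_interval (μ := volume) (f := P)
    (a := 0) (b := b) (by
      rw [uIcc_of_le (ht.1.trans htb.le)]
      exact (hP.mono fun s hs => ⟨hs.1, hs.2.trans_lt hb⟩).integrableOn_Icc)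
  rw [uIcc_of_le (ht.1.trans htb.le)] at h1
  refine (h1 t ⟨ht.1, htb.le⟩).mono_of_mem_nhdsWithin ?_
  filter_upwards [self_mem_nhdsWithin, mem_nhdsWithin_of_mem_nhds (Iio_mem_nhds htb)] with s h2 h3
  exact ⟨h2.1, le_of_lt h3⟩

lemma hasDerivAt_primitive {P : ℝ → ℝ} {T : ℝ} (hP : ContinuousOn P (Ico 0 T)) {t : ℝ}
    (ht : t ∈ Ioo 0 T) : HasDerivAt (fun t => ∫ s in (0 : ℝ)..t, P s) (P t) t := by
  have hP' := hP.mono Ioo_subset_Ico_self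
  refine intervalIntegral.integral_hasDerivAt_right ?_
    (hP'.stronglyMeasurableAtFilter isOpen_Ioo t ht) (hP'.continuousAt (isOpen_Ioo.mem_nhds ht))
  exact (hP.mono fun s hs => ⟨hs.1, hs.2.trans_lt ht.2⟩).intervalIntegrable_of_Icc ht.1.le

/-- A function that satisfies the integrated form of `G'' ≥ (γ + 1) C² G ^ γ` and
`G' ≥ C G ^ ((γ + 1) / 2)` at time `0` blows up in finite time. -/
theorem lt_of_superlinear {G₀ G₁ C γ T : ℝ} {P G : ℝ → ℝ} (hT : 0 < T) (hG₀ : 0 < G₀) (hγ : 1 < γ)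
    (hC : 0 < C) (hP : ContinuousOn P (Ico 0 T))
    (hPG : ∀ s ∈ Ico 0 T, C ^ 2 * (γ + 1) * G s ^ γ ≤ P s)
    (hG : ∀ t ∈ Ico 0 T, G₀ + ∫ s in (0 : ℝ)..t, (G₁ + ∫ r in (0 : ℝ)..s, P r) ≤ G t)
    (hGn : ∀ t ∈ Ico 0 T, 0 ≤ G t) (hG₁ : C * G₀ ^ ((γ + 1) / 2) ≤ G₁) :
    T < 2 * G₀ ^ (-((γ - 1) / 2)) / ((γ - 1) * C) := by
  set V : ℝ → ℝ := fun s => G₁ + ∫ r in (0 : ℝ)..s, P r with hV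
  -- Only an integrated inequality is known for `G`. Its lower bound `Y` is differentiable with
  -- derivative `V`, and `V' = P` dominates `Y ^ γ` since `G ≥ Y`.
  set Y : ℝ → ℝ := fun t => G₀ + ∫ s in (0 : ℝ)..t, V s with hY
  have hVc : ContinuousOn V (Ico 0 T) := continuousOn_const.add (continuousOn_primitive hP)
  have hYc : ContinuousOn Y (Ico 0 T) := continuousOn_const.add (continuousOn_primitive hVc)
  have hVd : ∀ t ∈ Ioo 0 T, HasDerivAt V (P t) t := fun t ht =>
    (hasDerivAt_primitive hP ht).const_add G₁
  have hYd : ∀ t ∈ Ioo 0 T, HasDerivAt Y (V t) t := fun t ht =>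
    (hasDerivAt_primitive hVc ht).const_add G₀
  have h0 : (0 : ℝ) ∈ Ico 0 T := ⟨le_rfl, hT⟩
  have hV0 : V 0 = G₁ := by simp [hV]
  have hY0 : Y 0 = G₀ := by simp [hY]
  have hG₁0 : 0 < G₁ := (mul_pos hC (Real.rpow_pos_of_pos hG₀ _)).trans_le hG₁
  have hP0 : ∀ s ∈ Ico 0 T, 0 ≤ P s := fun s hs => le_trans (by
    have := Real.rpow_nonneg (hGn s hs) γ
    positivity) (hPG s hs)
  have hcx : Convex ℝ (Ico 0 T) := convex_Ico 0 T
  have hVm : MonotoneOn V (Ico 0 T) := by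
    refine monotoneOn_of_deriv_nonneg hcx hVc ?_ ?_ <;> rw [interior_Ico]
    · exact fun t ht => (hVd t ht).differentiableAt.differentiableWithinAt
    · exact fun t ht => by rw [(hVd t ht).deriv]; exact hP0 t (Ioo_subset_Ico_self ht)
  have hVp : ∀ t ∈ Ico 0 T, 0 < V t := fun t ht =>
    (hV0 ▸ hG₁0 : 0 < V 0).trans_le (hVm h0 ht ht.1)
  have hYm : StrictMonoOn Y (Ico 0 T) := by
    refine strictMonoOn_of_deriv_pos hcx hYc ?_
    rw [interior_Ico]
    exact fun t ht => by rw [(hYd t ht).deriv]; exact hVp t (Ioo_subset_Ico_self ht)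
  have hYp : ∀ t ∈ Ico 0 T, 0 < Y t := fun t ht =>
    (hY0 ▸ hG₀ : 0 < Y 0).trans_le (hYm.monotoneOn h0 ht ht.1)
  -- Multiplying `V' ≥ C² (γ + 1) Y ^ γ` by `2 V = 2 Y'` gives `(V²)' ≥ 2 C² (Y ^ (γ + 1))'`.
  have hΦ : MonotoneOn (fun t => V t ^ 2 - 2 * C ^ 2 * Y t ^ (γ + 1)) (Ico 0 T) := by
    have hd : ∀ t ∈ Ioo 0 T, HasDerivAt (fun t => V t ^ 2 - 2 * C ^ 2 * Y t ^ (γ + 1))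
        (2 * V t * (P t - C ^ 2 * (γ + 1) * Y t ^ γ)) t := by
      intro t ht
      have h1 := ((hVd t ht).fun_pow 2).fun_sub (((hYd t ht).rpow_const (p := γ + 1)
        (Or.inr (by linarith))).const_mul (2 * C ^ 2))
      refine h1.congr_deriv ?_
      rw [add_sub_cancel_right]
      push_cast
      ring
    refine monotoneOn_of_deriv_nonneg hcx ((hVc.pow 2).sub (continuousOn_const.mul
      (hYc.rpow_const fun t ht => Or.inr (by linarith)))) ?_ ?_ <;> rw [interior_Ico]
    · exact fun t ht => (hd t ht).differentiableAt.differentiableWithinAt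
    · intro t ht
      have ht' := Ioo_subset_Ico_self ht
      rw [(hd t ht).deriv]
      refine mul_nonneg (mul_nonneg zero_le_two (hVp t ht').le) (sub_nonneg.2 ?_)
      refine le_trans ?_ (hPG t ht')
      have := hYp t ht'
      have := hG t ht'
      gcongr
  -- The initial condition supplies `C² G₀ ^ (γ + 1)`, half of what is subtracted; the gain is
  -- strict because `Y` has strictly increased.
  have hVY : ∀ t ∈ Ioo 0 T, C * Y t ^ ((γ + 1) / 2) < V t := by
    intro t ht
    have ht' := Ioo_subset_Ico_self ht
    have h1 := hΦ h0 ht' ht.1.le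
    simp only [hV0, hY0] at h1
    have hsq : ∀ y : ℝ, 0 < y → (y ^ ((γ + 1) / 2)) ^ 2 = y ^ (γ + 1) := fun y hy => by
      rw [← Real.rpow_natCast, ← Real.rpow_mul hy.le]; norm_num
    have h2 : G₀ ^ (γ + 1) < Y t ^ (γ + 1) :=
      Real.rpow_lt_rpow hG₀.le (hY0 ▸ hYm h0 ht' ht.1) (by linarith)
    have h3 : (C * G₀ ^ ((γ + 1) / 2)) ^ 2 ≤ G₁ ^ 2 :=
      pow_le_pow_left₀ (mul_pos hC (Real.rpow_pos_of_pos hG₀ _)).le hG₁ 2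
    rw [mul_pow, hsq G₀ hG₀] at h3
    refine lt_of_pow_lt_pow_left₀ 2 (hVp t ht').le ?_
    rw [mul_pow, hsq _ (hYp t ht')]
    have hC2 : 0 < C ^ 2 := by positivity
    nlinarith [mul_lt_mul_of_pos_left h2 hC2]
  have hγ' : 0 < (γ - 1) / 2 := by linarith
  -- Separation of variables: `Y' > C Y ^ ((γ + 1) / 2)` means that this function strictly
  -- decreases.
  set D : ℝ → ℝ := fun t => Y t ^ (-((γ - 1) / 2)) + (γ - 1) / 2 * C * t with hD
  have hDa : StrictAntiOn D (Ico 0 T) := by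
    refine strictAntiOn_of_deriv_neg hcx ((hYc.rpow_const fun t ht =>
      Or.inl (hYp t ht).ne').add (by fun_prop)) ?_
    rw [interior_Ico]
    intro t ht
    have hy := hYp t (Ioo_subset_Ico_self ht)
    have hd : HasDerivAt D (V t * -((γ - 1) / 2) * Y t ^ (-((γ - 1) / 2) - 1) +
        (γ - 1) / 2 * C * 1) t :=
      ((hYd t ht).rpow_const (Or.inl hy.ne')).add ((hasDerivAt_id t).const_mul _)
    rw [hd.deriv]
    have e : Y t ^ (-((γ - 1) / 2) - 1) = (Y t ^ ((γ + 1) / 2))⁻¹ := by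
      rw [← Real.rpow_neg hy.le]; ring_nf
    have hp : 0 < Y t ^ ((γ + 1) / 2) := Real.rpow_pos_of_pos hy _
    have h1 : C < V t * (Y t ^ ((γ + 1) / 2))⁻¹ := by
      rw [← div_eq_mul_inv, lt_div_iff₀ hp]; exact hVY t ht
    rw [e]
    nlinarith
  -- Comparing at `T / 2` instead of `0` keeps the inequality strict when `t` tends to `T`.
  have hhalf : T / 2 ∈ Ico 0 T := ⟨by linarith, by linarith⟩
  have h1 : D (T / 2) < G₀ ^ (-((γ - 1) / 2)) := by
    have := hDa h0 hhalf (by linarith)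
    simpa [hD, hY0] using this
  have h2 : (γ - 1) / 2 * C * T ≤ D (T / 2) := by
    -- Otherwise, at some `t` close to `T`, the linear term of `D` alone would exceed `D (T / 2)`,
    -- although `D` decreases and its other term is positive.
    by_contra hcon
    rw [not_le] at hcon
    have hK : 0 < (γ - 1) / 2 * C := mul_pos hγ' hC
    obtain ⟨t, ht1, ht2⟩ := exists_between (max_lt (by linarith : T / 2 < T)
      ((div_lt_iff₀' hK).2 hcon))
    have ht' : t ∈ Ico 0 T := ⟨by linarith [le_max_left (T / 2) (D (T / 2) / ((γ - 1) / 2 * C))], ht2⟩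
    have h3 := hDa hhalf ht' (lt_of_le_of_lt (le_max_left _ _) ht1)
    have h4 := (div_lt_iff₀' hK).1 (lt_of_le_of_lt (le_max_right _ _) ht1)
    have h5 : 0 < Y t ^ (-((γ - 1) / 2)) := Real.rpow_pos_of_pos (hYp t ht') _
    simp only [hD] at h3 h4
    linarith
  rw [lt_div_iff₀ (by nlinarith)]
  linarith

/-- A radially symmetric `H³` solution with vacuum at the origin that satisfies the initial
condition on the weighted momentum exists only before `blowupTime`. -/
theorem IsSolution.lt_blowupTime {A γ T : ℝ} {ρ₀ v₀ : ℝ → ℝ} {ρ : ℝ → Plane → ℝ}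
    {u : ℝ → Plane → Plane} (hsol : IsSolution A γ T ρ u) (hA : 0 < A) (hγ : 1 < γ) (hT : 0 < T)
    (hvac : ρ₀ 0 = 0) (hmass : 0 < ∫⁻ x : Plane, ENNReal.ofReal (ρ₀ ‖x‖))
    (hcond : Real.sqrt (A / (γ + 1)) *
        (weightedMass ρ₀ ^ ((γ + 1) / 2) / besselMass ^ ((γ - 1) / 2)) ≤
      ∫ x : Plane, ρ₀ ‖x‖ * v₀ ‖x‖ * deriv besselK0 ‖x‖)
    (hρ : ∀ x, ρ 0 x = ρ₀ ‖x‖) (hu : ∀ x, u 0 x = radialField v₀ x) :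
    T < blowupTime A γ ρ₀ := by
  have h0 : (0 : ℝ) ∈ Ico 0 T := ⟨le_rfl, hT⟩
  have hκ : (γ - 1) / 2 ≠ 0 := by linarith
  have hcl := hsol.isClassical hA hγ
  have hc0 : ∀ x, soundSpeed A γ (ρ 0 x) = soundSpeed A γ (ρ₀ ‖x‖) := fun x => by rw [hρ]
  have hrad : ∀ t ∈ Ico 0 T, ∀ x, 0 < ρ t x → u t x ∈ Submodule.span ℝ {x} := fun t ht x hx =>
    hcl.velocity_mem_span hκ (c₀ := fun r => soundSpeed A γ (ρ₀ r)) (a := fun r => v₀ r / r)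
      hc0 hu ht ((soundSpeed_pos_iff hA hγ hx.le).2 hx)
  have horigin : ∀ t ∈ Ico 0 T, ρ t 0 = 0 := fun t ht => by
    have h1 := hcl.eq_zero_at_origin hκ (c₀ := fun r => soundSpeed A γ (ρ₀ r))
      (a := fun r => v₀ r / r) hc0 hu
      (by simp only [hc0, norm_zero, hvac]; rw [soundSpeed, Real.zero_rpow hκ, mul_zero]) ht
    have h2 := hsol.density_nonneg t ht 0
    by_contra h3
    exact ((soundSpeed_pos_iff hA hγ h2).2 (lt_of_le_of_ne h2 (Ne.symm h3))).ne' h1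
  have hB := besselMass_pos
  have hW : weightedMass ρ₀ = besselAverage ρ 0 := by
    simp only [weightedMass, besselAverage, hρ, besselK0_eq]
  -- Away from the origin `K₀'` is minus the moment of order one, and the inner product of `x` with
  -- the radial field is `|x| v₀`.
  have hJ : ∫ x : Plane, ρ₀ ‖x‖ * v₀ ‖x‖ * deriv besselK0 ‖x‖ =
      ∫ x, ρ 0 x * (2 * inner ℝ x (u 0 x) * -(besselMoment 1 ‖x‖ / (2 * ‖x‖))) := by
    refine integral_congr_ae ?_
    filter_upwards [ae_ne_zero] with x hx
    have hx0 := norm_pos_iff.2 hx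
    rw [besselK0_eq, (hasDerivAt_besselMoment 0 hx0).deriv, hρ, hu, radialField, inner_smul_right,
      real_inner_self_eq_norm_sq]
    field_simp
  have hG0 : 0 < besselAverage ρ 0 := by
    refine (hsol.besselAverage_nonneg h0).lt_of_ne fun hz => hmass.ne' ?_
    have h1 := (integral_eq_zero_iff_of_nonneg (fun x => mul_nonneg (hsol.density_nonneg 0 h0 x)
      (besselMoment_nonneg 0 ‖x‖)) (hsol.integrable_besselAverage hA hγ h0).1).1 hz.symm
    rw [lintegral_eq_zero_iff' ?_]
    · filter_upwards [h1, ae_ne_zero] with x hx hx0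
      have := (mul_eq_zero.1 hx).resolve_right (besselMoment_pos 0 (norm_pos_iff.2 hx0)).ne'
      rw [← hρ, this]
      simp
    · simp only [← hρ]
      exact (hsol.continuous_slice h0).measurable.ennreal_ofReal.aemeasurable
  set C := Real.sqrt (A / (γ + 1)) * besselMass ^ (-((γ - 1) / 2)) with hC
  have hC0 : 0 < C := mul_pos (Real.sqrt_pos.2 (by positivity)) (Real.rpow_pos_of_pos hB _)
  -- The normalization of `C` matches the constant in Jensen's inequality.
  have hC2 : C ^ 2 * (γ + 1) = A * besselMass ^ (1 - γ) := by
    rw [hC, mul_pow, Real.sq_sqrt (by positivity), ← Real.rpow_natCast (besselMass ^ _),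
      ← Real.rpow_mul hB.le]
    have : -((γ - 1) / 2) * ((2 : ℕ) : ℝ) = 1 - γ := by push_cast; ring
    rw [this]
    field_simp
  rw [blowupTime, hW]
  refine lt_of_superlinear (G := besselAverage ρ)
    (P := besselAverage fun t x => pressure A γ (ρ t x)) hT hG0 hγ hC0
    (continuousOn_besselAverage (hsol.continuousOn_pressure hγ) fun b hb => ?_)
    (fun s hs => ?_) (fun t ht => hsol.le_besselAverage hA hγ hrad horigin ht)
    (fun t ht => hsol.besselAverage_nonneg ht) ?_
  · obtain ⟨W, -, hW⟩ := hsol.exists_bound hA hγ hb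
    exact ⟨W, fun t ht x => hsol.abs_pressure_le hA hb (fun t ht x => (hW t ht x).2.2.1) ht x⟩
  · rw [hC2]
    exact hsol.le_besselAverage_pressure hA hγ hs
  · rw [← hJ]
    refine le_trans (le_of_eq ?_) hcond
    rw [hW, Real.rpow_neg hB.le]
    ring

end Blowup

end CompressibleEuler

end

theorem theorem2 (A γ : ℝ) (hA : 0 < A) (hγ : 1 < γ) (ρ₀ v₀ : ℝ → ℝ)
    (hρ₀ : ∀ r, 0 ≤ r → 0 ≤ ρ₀ r)
    (hc₀ : CompressibleEuler.MemH 3 (fun x => CompressibleEuler.soundSpeed A γ (ρ₀ ‖x‖)))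
    (hu₀ : ∀ i, CompressibleEuler.MemH 3 (fun x => CompressibleEuler.radialField v₀ x i))
    (hvac : ρ₀ 0 = 0)
    (hmass : 0 < ∫⁻ x : CompressibleEuler.Plane, ENNReal.ofReal (ρ₀ ‖x‖))
    (hcond : Real.sqrt (A / (γ + 1)) *
        (CompressibleEuler.weightedMass ρ₀ ^ ((γ + 1) / 2) /
          CompressibleEuler.besselMass ^ ((γ - 1) / 2)) ≤
      ∫ x : CompressibleEuler.Plane,
        ρ₀ ‖x‖ * v₀ ‖x‖ * deriv CompressibleEuler.besselK0 ‖x‖)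
    (T : ℝ) (hT : 0 < T)
    (ρ : ℝ → CompressibleEuler.Plane → ℝ)
    (u : ℝ → CompressibleEuler.Plane → CompressibleEuler.Plane)
    (hsol : CompressibleEuler.IsSolution A γ T ρ u)
    (hρ : ∀ x, ρ 0 x = ρ₀ ‖x‖)
    (hu : ∀ x, u 0 x = CompressibleEuler.radialField v₀ x) :
    T ≤ CompressibleEuler.blowupTime A γ ρ₀ ∧
      ∀ M : ℝ, (∀ t ∈ Ico 0 T, CompressibleEuler.stateNorm A γ ρ u t ≤ ENNReal.ofReal M) →
        T < CompressibleEuler.blowupTime A γ ρ₀ := by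
  have h := hsol.lt_blowupTime hA hγ hT hvac hmass hcond hρ hu
  exact ⟨h.le, fun _ _ => h⟩
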